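/- Let $\{X_i\}_{i\in\mathbb Z}$ be a strictly stationary real-valued process on a probability space, with strong mixing coefficients $$\alpha(t)=\sup_{k\in\mathbb Z}\ \sup\{|P(A\cap B)-P(A)P(B)|:\ A\in\sigma(X_i,\,i\le k),\ B\in\sigma(X_i,\,i\ge k+t)\}$$ satisfying $\alpha(t)=O(e^{-Ct})$ as $t\to\infty$ for some $C>0$. Assume that $X_1$ has a bounded density $f$ and that, for each $d\ge1$, the vectors $(X_0,X_{i_1},\ldots,X_{i_d})$ with $0<i_1<\cdots<i_d$ have joint densities $f_{i_1\cdots i_d}$ that are bounded by a constant depending only on $d$. Fix $x_0\in\mathbb R$ such that $f(x_0)>0$ and $f$ is four times continuously differentiable at $x_0$. Let $K$ be a non-negative, symmetric, bounded kernel with $\int K(u)\,du=1$, $\mu_2=\int u^2K(u)\,du<\infty$, $\int|u|^3K(u)\,du<\infty$ and $\nu_2=\int K(u)^2\,du<\infty$. For a bandwidth $h>0$ put $\hat f_h(x_0)=(nh)^{-1}\sum_{i=1}^nK((X_i-x_0)/h)$, and let $\Phi$ be the standard normal distribution function. (a) Let $h=h_n>0$ satisfy $nh\to\infty$ and $h=O(n^{-1/5})$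 as $n\to\infty$. Then, for every fixed $y\in\mathbb R$, $$P\Big((nh)^{1/2}\{\hat f_h(x_0)-f(x_0)\}\le y\Big)=\Phi\left(\frac{y-n^{1/2}h^{5/2}f''(x_0)\mu_2/2}{\sqrt{f(x_0)\nu_2}}\right)+O\big\{h\log n+(nh)^{-1/2}\big\}.$$ (b) The smallest order of the error bound $h\log n+(nh)^{-1/2}$ over all bandwidth sequences $h>0$ is $n^{-1/3}(\log n)^{1/3}$: for every such sequence $n^{-1/3}(\log n)^{1/3}=O\{h\log n+(nh)^{-1/2}\}$, and $h\log n+(nh)^{-1/2}$ is of exact order $n^{-1/3}(\log n)^{1/3}$ if and only if $h$ is of exact order $n^{-1/3}(\log n)^{-2/3}$. For such $h$, and every fixed $y$, the error of the normal approximation in (a) is $O\{n^{-1/3}(\log n)^{1/3}\}$. -/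

import Mathlib

open MeasureTheory ProbabilityTheory Filter Asymptotics Topology

noncomputable section

/-- Strict stationarity of a doubly infinite real process: every finite-dimensional law is
invariant under time shifts. -/
def StrictlyStationary {Ω : Type*} [MeasurableSpace Ω] (μ : Measure Ω) (X : ℤ → Ω → ℝ) : Prop :=
  ∀ (d : ℕ) (i : Fin d → ℤ) (s : ℤ),
    μ.map (fun ω (j : Fin d) => X (i j + s) ω) = μ.map (fun ω (j : Fin d) => X (i j) ω)

/-- The strong mixing coefficient between two sigma-algebras,
`sup |P(A ∩ B) - P(A) P(B)|` over `A` in the first and `B` in the second. -/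
def alphaCoeff {Ω : Type*} [MeasurableSpace Ω] (μ : Measure Ω) (m₁ m₂ : MeasurableSpace Ω) : ℝ :=
  ⨆ p : {A : Set Ω // MeasurableSet[m₁] A} × {B : Set Ω // MeasurableSet[m₂] B},
    |μ.real (p.1.1 ∩ p.2.1) - μ.real p.1.1 * μ.real p.2.1|

/-- The sigma-algebra generated by the `X i` with `i ≤ k`. -/
abbrev pastSigma {Ω : Type*} (X : ℤ → Ω → ℝ) (k : ℤ) : MeasurableSpace Ω :=
  ⨆ i : {i : ℤ // i ≤ k}, MeasurableSpace.comap (X i.1) inferInstance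

/-- The sigma-algebra generated by the `X i` with `i ≥ k`. -/
abbrev futureSigma {Ω : Type*} (X : ℤ → Ω → ℝ) (k : ℤ) : MeasurableSpace Ω :=
  ⨆ i : {i : ℤ // k ≤ i}, MeasurableSpace.comap (X i.1) inferInstance

/-- The strong mixing coefficient `α(t)` of the process. -/
def alphaMixing {Ω : Type*} [MeasurableSpace Ω] (μ : Measure Ω) (X : ℤ → Ω → ℝ) (t : ℕ) : ℝ :=
  ⨆ k : ℤ, alphaCoeff μ (pastSigma X k) (futureSigma X (k + t))

/-- `f` is a bounded (everywhere defined) probability density of the random variable `Y`. -/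
structure IsBoundedDensity {Ω : Type*} [MeasurableSpace Ω] (μ : Measure Ω) (Y : Ω → ℝ)
    (f : ℝ → ℝ) : Prop where
  measurable : Measurable f
  nonneg : ∀ x, 0 ≤ f x
  bounded : ∃ M : ℝ, ∀ x, f x ≤ M
  law : μ.map Y = volume.withDensity (fun x => ENNReal.ofReal (f x))

/-- For every `d`, the vectors `(X 0, X i₁, …, X i_d)` with `0 < i₁ < ⋯ < i_d` have joint
densities that are bounded by a constant depending on `d` only. -/
def HasBoundedJointDensities {Ω : Type*} [MeasurableSpace Ω] (μ : Measure Ω)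
    (X : ℤ → Ω → ℝ) : Prop :=
  ∀ d : ℕ, ∃ M : ℝ, ∀ i : Fin d → ℤ, StrictMono i → (∀ j, 0 < i j) →
    ∃ g : (Fin (d + 1) → ℝ) → ℝ, Measurable g ∧ (∀ x, 0 ≤ g x ∧ g x ≤ M) ∧
      μ.map (fun ω => (Fin.cons (X 0 ω) (fun j => X (i j) ω) : Fin (d + 1) → ℝ)) =
        volume.withDensity (fun x => ENNReal.ofReal (g x))

/-- Non-negative, symmetric, bounded kernels of unit mass, with finite second and third absolute
moments and finite squared `L²` norm. -/
structure IsDensityKernel (K : ℝ → ℝ) : Prop where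
  measurable : Measurable K
  nonneg : ∀ u, 0 ≤ K u
  symm : ∀ u, K (-u) = K u
  bounded : ∃ B : ℝ, ∀ u, K u ≤ B
  integrable : Integrable K
  integral_eq_one : ∫ u, K u = 1
  second_moment : Integrable (fun u => u ^ 2 * K u)
  third_moment : Integrable (fun u => |u| ^ 3 * K u)
  sq_integrable : Integrable (fun u => K u ^ 2)

/-- `μ₂ = ∫ u² K(u) du`. -/
def kernelMu2 (K : ℝ → ℝ) : ℝ := ∫ u, u ^ 2 * K u

/-- `ν₂ = ∫ K(u)² du`. -/
def kernelNu2 (K : ℝ → ℝ) : ℝ := ∫ u, K u ^ 2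

/-- The kernel density estimator `(n h)⁻¹ ∑_{i=1}^n K((X_i - x₀) / h)`. -/
def kde {Ω : Type*} (X : ℤ → Ω → ℝ) (K : ℝ → ℝ) (x₀ : ℝ) (n : ℕ) (h : ℝ) (ω : Ω) : ℝ :=
  ((n : ℝ) * h)⁻¹ * ∑ i ∈ Finset.Icc 1 n, K ((X (i : ℤ) ω - x₀) / h)

/-- `P((n h)^{1/2} (f̂_h(x₀) - f(x₀)) ≤ y)`. -/
def kdeCdf {Ω : Type*} [MeasurableSpace Ω] (μ : Measure Ω) (X : ℤ → Ω → ℝ) (K f : ℝ → ℝ)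
    (x₀ : ℝ) (n : ℕ) (h y : ℝ) : ℝ :=
  μ.real {ω | √((n : ℝ) * h) * (kde X K x₀ n h ω - f x₀) ≤ y}

/-- The bias-shifted normal approximation
`Φ((y - n^{1/2} h^{5/2} f''(x₀) μ₂ / 2) / (f(x₀) ν₂)^{1/2})`. -/
def normalApprox (K f : ℝ → ℝ) (x₀ : ℝ) (n : ℕ) (h y : ℝ) : ℝ :=
  cdf (gaussianReal 0 1)
    ((y - (n : ℝ) ^ (1 / 2 : ℝ) * h ^ (5 / 2 : ℝ) * iteratedDeriv 2 f x₀ * kernelMu2 K / 2) /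
      √(f x₀ * kernelNu2 K))

/-- The error order `h log n + (n h)^{-1/2}`. -/
def errorOrder (n : ℕ) (h : ℝ) : ℝ :=
  h * Real.log n + ((n : ℝ) * h) ^ (-(1 / 2) : ℝ)

end

/-! The normal approximation is proved by the Stein–Tikhomirov method. Let `G` be the kernel
rescaled by `h` and centred in mean, `N = √(nh)`, `W = N⁻¹ ∑ G(X_j)`, and let `φ` be the
characteristic function of `W`. Then `φ'(t)` is a sum of terms `E[G(X_i) e^{itW}]`. In each of them
the sum is cut into the indices within `m` of `i`, those at distance between `m` and `2m`, and the
rest. Mixing with gap `m` decouples the distant part, and expanding the near part gives `φ' = -v t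
φ` plus errors, where `v = f(x₀) ν₂` (`norm_integral_mul_expI_sub_le`,
`SparseMoments.norm_deriv_charFun_add_le`).

The rate depends on two features of these errors. First, bounded joint densities give each new
distinct index a factor `h` in the absolute moments (`SparseMoments`), so overlaps of blocks cost `m
h` only. Second, the genuine third-order term multiplies `|φ|`, so it is damped by the Gaussian
factor when the differential inequality is solved (`norm_sub_exp_le_of_norm_deriv_add_le`). This
keeps the comparison valid up to `|t|` of order `N`, and the smoothing inequality
`exists_abs_cdf_sub_cdf_le` then bounds the distance to the normal law by `|v - w/h| + m h + 1/N +
α(m) B n`, with `w` the variance and `B` the sup bound of a summand.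

A lag `m` of order `log n` makes `α(m)` of order `n⁻²` and turns `m h` into `h log n`. Taylor
expansion of `f` gives `w/h = v + O(h)` and a bias `h² f''(x₀) μ₂ / 2 + O(h³)`. After scaling by `N`
the bias remainder is `O(h)`, because `n h⁵` is bounded, and the Gaussian distribution function is
Lipschitz.

The optimal order comes from one identity: in the unit where the two error terms balance, `r = h /
optimalBandwidth`, the error order is `optimalError` times `r + r^{-1/2}`. This factor is at least
one and stays bounded exactly when `r` is bounded above and away from zero. -/

/-! ### Balancing the two error terms over the bandwidth. -/

/-- The optimal bandwidth order `n^{-1/3} (log n)^{-2/3}`. -/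
noncomputable def optimalBandwidth (n : ℕ) : ℝ := (n : ℝ) ^ (-(1 / 3) : ℝ) * Real.log n ^ (-(2 / 3) : ℝ)

/-- The optimal error order `n^{-1/3} (log n)^{1/3}`. -/
noncomputable def optimalError (n : ℕ) : ℝ := (n : ℝ) ^ (-(1 / 3) : ℝ) * Real.log n ^ (1 / 3 : ℝ)

lemma log_natCast_pos {n : ℕ} (hn : 2 ≤ n) : 0 < Real.log n :=
  Real.log_pos (by exact_mod_cast hn)

lemma optimalBandwidth_pos {n : ℕ} (hn : 2 ≤ n) : 0 < optimalBandwidth n := by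
  have h1 : (0 : ℝ) < n := by positivity
  have h2 := log_natCast_pos hn
  unfold optimalBandwidth; positivity

lemma optimalError_pos {n : ℕ} (hn : 2 ≤ n) : 0 < optimalError n := by
  have h1 : (0 : ℝ) < n := by positivity
  have h2 := log_natCast_pos hn
  unfold optimalError; positivity

/-- At `h = optimalBandwidth n` the two terms `h log n` and `(nh)^{-1/2}` both equal `optimalError
n`; for other `h` they scale as the first and the `-1/2` power of the ratio. -/
lemma errorOrder_eq {n : ℕ} (hn : 2 ≤ n) {h : ℝ} (hh : 0 < h) :
    errorOrder n h = optimalError n *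
      (h / optimalBandwidth n + (h / optimalBandwidth n) ^ (-(1 / 2) : ℝ)) := by
  have hr : 0 < h / optimalBandwidth n := div_pos hh (optimalBandwidth_pos hn)
  obtain ⟨r, hr', hrd⟩ : ∃ r, 0 < r ∧ h = r * optimalBandwidth n :=
    ⟨_, hr, by field_simp [(optimalBandwidth_pos hn).ne']⟩
  have hb := (optimalBandwidth_pos hn).ne'
  rw [hrd, mul_div_cancel_right₀ _ hb]
  have h1 : (0 : ℝ) < n := by positivity
  have h2 := log_natCast_pos hn
  generalize Real.log n = l at *
  have e1 : optimalBandwidth n = (n : ℝ) ^ (-(1 / 3) : ℝ) * Real.log n ^ (-(2 / 3) : ℝ) := rfl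
  unfold errorOrder optimalError optimalBandwidth
  have hl := log_natCast_pos hn
  generalize Real.log n = l at *
  generalize (n : ℝ) = x at *
  have e2 : l ^ (-(2 / 3) : ℝ) * l = l ^ (1 / 3 : ℝ) := by
    nth_rw 2 [← Real.rpow_one l]
    rw [← Real.rpow_add hl]; norm_num
  have e3 : x * (r * (x ^ (-(1 / 3) : ℝ) * l ^ (-(2 / 3) : ℝ)))
      = r * (x ^ (2 / 3 : ℝ) * l ^ (-(2 / 3) : ℝ)) := by
    have : x * x ^ (-(1 / 3) : ℝ) = x ^ (2 / 3 : ℝ) := by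
      nth_rw 1 [← Real.rpow_one x]
      rw [← Real.rpow_add h1]; norm_num
    rw [← this]; ring
  rw [e3, Real.mul_rpow hr'.le (by positivity), Real.mul_rpow (by positivity) (by positivity),
    ← Real.rpow_mul h1.le, ← Real.rpow_mul hl.le, ← e2]
  norm_num
  rw [← e2]
  norm_num
  ring

lemma one_le_add_rpow_neg_half {r : ℝ} (hr : 0 < r) : 1 ≤ r + r ^ (-(1 / 2) : ℝ) := by
  have : 0 < r ^ (-(1 / 2) : ℝ) := by positivity
  rcases le_total 1 r with h | h
  · linarith
  · have := Real.one_le_rpow_of_pos_of_le_one_of_nonpos hr h (by norm_num : (-(1 / 2) : ℝ) ≤ 0)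
    linarith

lemma optimalError_le_errorOrder {n : ℕ} (hn : 2 ≤ n) {h : ℝ} (hh : 0 < h) :
    optimalError n ≤ errorOrder n h := by
  rw [errorOrder_eq hn hh]
  exact le_mul_of_one_le_right (optimalError_pos hn).le
    (one_le_add_rpow_neg_half (div_pos hh (optimalBandwidth_pos hn)))

lemma optimalError_isBigO_errorOrder (h : ℕ → ℝ) (hh : ∀ n, 0 < h n) :
    optimalError =O[atTop] (fun n : ℕ => errorOrder n (h n)) := by
  refine IsBigO.of_bound 1 ?_
  filter_upwards [eventually_ge_atTop 2] with n hn
  have h1 := optimalError_le_errorOrder hn (hh n)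
  have h2 := optimalError_pos hn
  rw [Real.norm_of_nonneg h2.le, Real.norm_of_nonneg (by linarith)]
  linarith

/-- Since both summands of `r + r^{-1/2}` are positive, a bound `c` on the sum bounds each: the
first gives `r ≤ c`, the second `1/r ≤ c²`. -/
lemma errorOrder_isTheta_iff (h : ℕ → ℝ) (hh : ∀ n, 0 < h n) :
    ((fun n : ℕ => errorOrder n (h n)) =Θ[atTop] optimalError) ↔
      h =Θ[atTop] optimalBandwidth := by
  constructor
  · rintro ⟨h1, -⟩
    obtain ⟨c, hc, hb⟩ := h1.exists_pos
    have key : ∀ᶠ n : ℕ in atTop, h n ≤ c * optimalBandwidth n ∧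
        optimalBandwidth n ≤ c ^ 2 * h n := by
      filter_upwards [hb.bound, eventually_ge_atTop 2] with n hn h2
      have hE := optimalError_pos h2
      have hB := optimalBandwidth_pos h2
      rw [Real.norm_of_nonneg hE.le, errorOrder_eq h2 (hh n)] at hn
      have hr := div_pos (hh n) hB
      have hn' := (le_abs_self _).trans hn
      rw [mul_comm c, mul_le_mul_iff_right₀ hE] at hn'
      have hp : 0 < (h n / optimalBandwidth n) ^ (-(1 / 2) : ℝ) := by positivity
      constructor
      · rw [← div_le_iff₀ hB]; linarith
      · have h3 : (h n / optimalBandwidth n) ^ (-(1 / 2) : ℝ) ≤ c := by linarith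
        have h4 : ((h n / optimalBandwidth n) ^ (-(1 / 2) : ℝ)) ^ 2 ≤ c ^ 2 := by gcongr
        rw [← Real.rpow_natCast, ← Real.rpow_mul hr.le] at h4
        norm_num at h4
        rw [Real.rpow_neg_one, inv_div, div_le_iff₀ (hh n)] at h4
        exact h4
    constructor
    · refine IsBigO.of_bound c ?_
      filter_upwards [key, eventually_ge_atTop 2] with n hn h2
      rw [Real.norm_of_nonneg (hh n).le, Real.norm_of_nonneg (optimalBandwidth_pos h2).le]
      exact hn.1
    · refine IsBigO.of_bound (c ^ 2) ?_
      filter_upwards [key, eventually_ge_atTop 2] with n hn h2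
      rw [Real.norm_of_nonneg (hh n).le, Real.norm_of_nonneg (optimalBandwidth_pos h2).le]
      exact hn.2
  · rintro ⟨h1, h2⟩
    refine ⟨?_, optimalError_isBigO_errorOrder h hh⟩
    obtain ⟨c, hc, hb⟩ := h1.exists_pos
    obtain ⟨d, hd, hb'⟩ := h2.exists_pos
    refine IsBigO.of_bound (c + d ^ (1 / 2 : ℝ)) ?_
    filter_upwards [hb.bound, hb'.bound, eventually_ge_atTop 2] with n hn hn' h2
    have hE := optimalError_pos h2
    have hB := optimalBandwidth_pos h2
    have hr := div_pos (hh n) hB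
    rw [Real.norm_of_nonneg (hh n).le, Real.norm_of_nonneg hB.le] at hn hn'
    rw [Real.norm_of_nonneg hE.le, errorOrder_eq h2 (hh n), Real.norm_of_nonneg (by positivity),
      mul_comm]
    gcongr
    · rwa [div_le_iff₀ hB]
    · rw [Real.rpow_neg hr.le, ← Real.inv_rpow hr.le, inv_div]
      refine Real.rpow_le_rpow (div_pos hB (hh n)).le ?_ (by norm_num)
      rwa [div_le_iff₀ (hh n)]

/-- Optimal bandwidths undersmooth, so the normal approximation applies to them. -/
lemma isBigO_rpow_of_isTheta_optimalBandwidth (h : ℕ → ℝ)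
    (hT : h =Θ[atTop] optimalBandwidth) :
    h =O[atTop] (fun n : ℕ => (n : ℝ) ^ (-(1 / 5) : ℝ)) := by
  refine hT.1.trans (IsBigO.of_bound 1 ?_)
  -- From `n = 3 > e` on, `log n ≥ 1` and its negative power can be dropped.
  filter_upwards [eventually_ge_atTop 3] with n h2
  have hn0 : (1 : ℝ) ≤ n := by exact_mod_cast (by omega : 1 ≤ n)
  have hl : 1 ≤ Real.log n := by
    rw [Real.le_log_iff_exp_le (by linarith)]
    have := Real.exp_one_lt_d9
    have h3 : (3 : ℝ) ≤ n := by exact_mod_cast h2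
    linarith
  have hB := optimalBandwidth_pos (n := n) (by omega)
  rw [Real.norm_of_nonneg hB.le, Real.norm_of_nonneg (by positivity), one_mul]
  unfold optimalBandwidth
  calc _ ≤ (n : ℝ) ^ (-(1 / 3) : ℝ) * 1 := by
        gcongr
        exact Real.rpow_le_one_of_one_le_of_nonpos hl (by norm_num)
    _ ≤ _ := by
        rw [mul_one]
        exact Real.rpow_le_rpow_of_exponent_le hn0 (by norm_num)

/-! ### Covariance inequalities under strong mixing. -/

section Mixing
variable {Ω : Type*} {m0 : MeasurableSpace Ω} {μ : Measure Ω} [IsProbabilityMeasure μ]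

lemma Complex.re_integral {Ω : Type*} {m : MeasurableSpace Ω} {μ : Measure Ω} {F : Ω → ℂ}
    (hF : Integrable F μ) : (∫ ω, F ω ∂μ).re = ∫ ω, (F ω).re ∂μ :=
  (integral_re hF).symm

lemma Complex.im_integral {Ω : Type*} {m : MeasurableSpace Ω} {μ : Measure Ω} {F : Ω → ℂ}
    (hF : Integrable F μ) : (∫ ω, F ω ∂μ).im = ∫ ω, (F ω).im ∂μ :=
  (integral_im hF).symm

lemma nonneg_of_forall_norm_le {E : Type*} [NormedAddCommGroup E] (μ : Measure Ω)
    [IsProbabilityMeasure μ] {V : Ω → E} {v : ℝ} (hVb : ∀ ω, ‖V ω‖ ≤ v) : 0 ≤ v := by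
  obtain ⟨ω⟩ : Nonempty Ω := nonempty_of_isProbabilityMeasure μ
  exact (norm_nonneg _).trans (hVb ω)

/-- Replacing `g` by its conditional expectation `c` leaves the integral unchanged. Splitting by the
sign of `c`, itself an event of `m`, bounds the `L¹` norm of `c` by `2a`. -/
lemma abs_integral_mul_le_of_setIntegral {m : MeasurableSpace Ω} (hm : m ≤ m0) {g V : Ω → ℝ}
    (hg : Integrable g μ) (hV : Measurable[m] V) {a v : ℝ} (hVb : ∀ ω, ‖V ω‖ ≤ v)
    (hB : ∀ B, MeasurableSet[m] B → |∫ ω in B, g ω ∂μ| ≤ a) :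
    |∫ ω, g ω * V ω ∂μ| ≤ 2 * a * v := by
  have hv := nonneg_of_forall_norm_le μ hVb
  have hVs : StronglyMeasurable[m] V := hV.stronglyMeasurable
  set c : Ω → ℝ := μ[g | m] with hc
  have hcm : StronglyMeasurable[m] c := stronglyMeasurable_condExp
  have hci : Integrable c μ := integrable_condExp
  have e1 : ∫ ω, g ω * V ω ∂μ = ∫ ω, V ω * c ω ∂μ := by
    have := condExp_stronglyMeasurable_mul_of_bound hm hVs hg v (ae_of_all _ hVb)
    calc ∫ ω, g ω * V ω ∂μ = ∫ ω, (V * g) ω ∂μ := by simp [mul_comm]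
      _ = ∫ ω, (μ[V * g | m]) ω ∂μ := (integral_condExp hm).symm
      _ = ∫ ω, V ω * c ω ∂μ := integral_congr_ae this
  have hS : MeasurableSet[m] {ω | 0 ≤ c ω} := hcm.measurable measurableSet_Ici
  have e2 : ∫ ω, |c ω| ∂μ ≤ 2 * a := by
    rw [← integral_add_compl (hm _ hS) hci.abs]
    have h1 : ∫ ω in {ω | 0 ≤ c ω}, |c ω| ∂μ = ∫ ω in {ω | 0 ≤ c ω}, g ω ∂μ := by
      rw [← setIntegral_condExp hm hg hS]
      exact setIntegral_congr_fun (hm _ hS) fun ω hω => abs_of_nonneg hω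
    have h2 : ∫ ω in {ω | 0 ≤ c ω}ᶜ, |c ω| ∂μ = -∫ ω in {ω | 0 ≤ c ω}ᶜ, g ω ∂μ := by
      rw [← setIntegral_condExp hm hg hS.compl, ← integral_neg]
      exact setIntegral_congr_fun (hm _ hS.compl) fun ω hω =>
        abs_of_neg (not_le.1 hω)
    rw [h1, h2]
    have h3 := (abs_le.1 (hB _ hS)).2
    have h4 := (abs_le.1 (hB _ hS.compl)).1
    linarith
  rw [e1]
  calc |∫ ω, V ω * c ω ∂μ| ≤ ∫ ω, |V ω * c ω| ∂μ := abs_integral_le_integral_abs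
    _ ≤ ∫ ω, v * |c ω| ∂μ := by
        refine integral_mono_of_nonneg (ae_of_all _ fun ω => abs_nonneg _) (hci.abs.const_mul v)
          (ae_of_all _ fun ω => ?_)
        simp only [abs_mul]
        exact mul_le_mul_of_nonneg_right (hVb ω) (abs_nonneg _)
    _ = v * ∫ ω, |c ω| ∂μ := integral_const_mul _ _
    _ ≤ v * (2 * a) := by gcongr
    _ = _ := by ring

lemma integrable_of_measurable_of_le {E : Type*} [NormedAddCommGroup E] [MeasurableSpace E]
    [BorelSpace E] [SecondCountableTopology E] {m : MeasurableSpace Ω} (hm : m ≤ m0) {V : Ω → E}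
    (hV : Measurable[m] V) {v : ℝ} (hVb : ∀ ω, ‖V ω‖ ≤ v) : Integrable V μ :=
  Integrable.of_bound (hV.mono hm le_rfl).aestronglyMeasurable v (ae_of_all _ hVb)

variable {m₁ m₂ : MeasurableSpace Ω} {a : ℝ}

/-- The duality bound is used twice: against `1_B - P(B)` it replaces the event `A` by `U`, then
against `U - E U` it replaces `B` by `V`. Each use costs a factor two. -/
lemma abs_covariance_le_of_strongMixing (h₁ : m₁ ≤ m0) (h₂ : m₂ ≤ m0)
    (hmix : ∀ A B, MeasurableSet[m₁] A → MeasurableSet[m₂] B →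
      |μ.real (A ∩ B) - μ.real A * μ.real B| ≤ a)
    {U V : Ω → ℝ} (hU : Measurable[m₁] U) (hV : Measurable[m₂] V) {u v : ℝ}
    (hUb : ∀ ω, ‖U ω‖ ≤ u) (hVb : ∀ ω, ‖V ω‖ ≤ v) :
    |∫ ω, U ω * V ω ∂μ - (∫ ω, U ω ∂μ) * ∫ ω, V ω ∂μ| ≤ 4 * a * u * v := by
  have hUi : Integrable U μ := integrable_of_measurable_of_le h₁ hU hUb
  have hVi : Integrable V μ := integrable_of_measurable_of_le h₂ hV hVb
  have step : ∀ B, MeasurableSet[m₂] B →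
      |∫ ω in B, (U ω - ∫ ω, U ω ∂μ) ∂μ| ≤ 2 * a * u := by
    intro B hB
    have h1i : Integrable (B.indicator fun _ => (1 : ℝ)) μ :=
      (integrable_const _).indicator (h₂ _ hB)
    have hgi : Integrable (fun ω => B.indicator (fun _ => (1 : ℝ)) ω - μ.real B) μ :=
      h1i.sub (integrable_const _)
    have := abs_integral_mul_le_of_setIntegral (μ := μ) h₁ hgi hU hUb (a := a) (by
      intro A hA
      rw [integral_sub h1i.restrict (integrable_const _), setIntegral_indicator (h₂ _ hB)]
      simpa [mul_comm] using hmix A B hA hB)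
    refine le_of_eq_of_le ?_ this
    congr 1
    rw [integral_sub hUi.integrableOn (integrable_const _)]
    simp_rw [sub_mul]
    rw [integral_sub]
    · rw [integral_const_mul, ← integral_indicator (h₂ _ hB)]
      have : B.indicator U = fun ω => B.indicator (fun _ => (1 : ℝ)) ω * U ω := by
        ext ω
        by_cases h : ω ∈ B <;> simp [h]
      simp [this]
    · have := hUi.indicator (h₂ _ hB)
      refine this.congr (ae_of_all _ fun ω => ?_)
      by_cases h : ω ∈ B <;> simp [h]
    · exact hUi.const_mul _
  have := abs_integral_mul_le_of_setIntegral (μ := μ) h₂ (hUi.sub (integrable_const (∫ ω, U ω ∂μ)))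
    hV hVb step
  have e : ∫ ω, (U ω - ∫ ω, U ω ∂μ) * V ω ∂μ
      = ∫ ω, U ω * V ω ∂μ - (∫ ω, U ω ∂μ) * ∫ ω, V ω ∂μ := by
    simp_rw [sub_mul]
    rw [integral_sub, integral_const_mul]
    · exact hUi.mul_bdd (hV.mono h₂ le_rfl).aestronglyMeasurable (ae_of_all _ hVb)
    · exact hVi.const_mul _
  simp only [Pi.sub_apply] at this
  rw [e] at this
  linarith

/-- The real and imaginary parts each consist of two real covariances, hence `4 · 4 = 16`. -/
lemma norm_covariance_le_of_strongMixing (h₁ : m₁ ≤ m0) (h₂ : m₂ ≤ m0)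
    (hmix : ∀ A B, MeasurableSet[m₁] A → MeasurableSet[m₂] B →
      |μ.real (A ∩ B) - μ.real A * μ.real B| ≤ a)
    {U V : Ω → ℂ} (hU : Measurable[m₁] U) (hV : Measurable[m₂] V) {u v : ℝ}
    (hUb : ∀ ω, ‖U ω‖ ≤ u) (hVb : ∀ ω, ‖V ω‖ ≤ v) :
    ‖∫ ω, U ω * V ω ∂μ - (∫ ω, U ω ∂μ) * ∫ ω, V ω ∂μ‖ ≤ 16 * a * u * v := by
  have hUi : Integrable U μ := integrable_of_measurable_of_le h₁ hU hUb
  have hVi : Integrable V μ := integrable_of_measurable_of_le h₂ hV hVb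
  have hUV : Integrable (fun ω => U ω * V ω) μ :=
    hUi.mul_bdd (hV.mono h₂ le_rfl).aestronglyMeasurable (ae_of_all _ hVb)
  have r1 : Measurable[m₁] fun ω => (U ω).re := Complex.measurable_re.comp hU
  have r2 : Measurable[m₁] fun ω => (U ω).im := Complex.measurable_im.comp hU
  have r3 : Measurable[m₂] fun ω => (V ω).re := Complex.measurable_re.comp hV
  have r4 : Measurable[m₂] fun ω => (V ω).im := Complex.measurable_im.comp hV
  have b1 : ∀ ω, ‖(U ω).re‖ ≤ u := fun ω => (Complex.abs_re_le_norm _).trans (hUb ω)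
  have b2 : ∀ ω, ‖(U ω).im‖ ≤ u := fun ω => (Complex.abs_im_le_norm _).trans (hUb ω)
  have b3 : ∀ ω, ‖(V ω).re‖ ≤ v := fun ω => (Complex.abs_re_le_norm _).trans (hVb ω)
  have b4 : ∀ ω, ‖(V ω).im‖ ≤ v := fun ω => (Complex.abs_im_le_norm _).trans (hVb ω)
  have c13 := abs_covariance_le_of_strongMixing h₁ h₂ hmix r1 r3 b1 b3
  have c14 := abs_covariance_le_of_strongMixing h₁ h₂ hmix r1 r4 b1 b4
  have c23 := abs_covariance_le_of_strongMixing h₁ h₂ hmix r2 r3 b2 b3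
  have c24 := abs_covariance_le_of_strongMixing h₁ h₂ hmix r2 r4 b2 b4
  have int : ∀ {f g : Ω → ℝ}, Measurable[m₁] f → Measurable[m₂] g → (∀ ω, ‖f ω‖ ≤ u) →
      (∀ ω, ‖g ω‖ ≤ v) → Integrable (fun ω => f ω * g ω) μ := fun hf hg hfb hgb =>
    (integrable_of_measurable_of_le h₁ hf hfb).mul_bdd
      (hg.mono h₂ le_rfl).aestronglyMeasurable (ae_of_all _ hgb)
  refine (Complex.norm_le_abs_re_add_abs_im _).trans ?_
  rw [Complex.sub_re, Complex.sub_im, Complex.mul_re, Complex.mul_im, Complex.re_integral hUV, Complex.im_integral hUV, Complex.re_integral hUi,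
    Complex.re_integral hVi, Complex.im_integral hUi, Complex.im_integral hVi]
  simp_rw [Complex.mul_re, Complex.mul_im]
  rw [integral_sub (int r1 r3 b1 b3) (int r2 r4 b2 b4),
    integral_add (int r1 r4 b1 b4) (int r2 r3 b2 b3)]
  rw [abs_le] at c13 c14 c23 c24
  have : ∀ x y : ℝ, |x| ≤ 8 * a * u * v → |y| ≤ 8 * a * u * v → |x| + |y| ≤ 16 * a * u * v :=
    fun x y hx hy => by linarith
  apply this <;> rw [abs_le] <;> constructor <;> linarith

end Mixing

/-! ### Decoupling a middle block from past and future. -/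

lemma measurable_pastSigma {Ω : Type*} {X : ℤ → Ω → ℝ} {i k : ℤ} (h : i ≤ k) : Measurable[pastSigma X k] (X i) :=
  (comap_measurable (X i)).mono
    (le_iSup (fun i : {i : ℤ // i ≤ k} => MeasurableSpace.comap (X i.1) inferInstance) ⟨i, h⟩) le_rfl

lemma measurable_futureSigma {Ω : Type*} {X : ℤ → Ω → ℝ} {i k : ℤ} (h : k ≤ i) : Measurable[futureSigma X k] (X i) :=
  (comap_measurable (X i)).mono
    (le_iSup (fun i : {i : ℤ // k ≤ i} => MeasurableSpace.comap (X i.1) inferInstance) ⟨i, h⟩) le_rfl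

section StrongMixing
variable {Ω : Type*} [MeasurableSpace Ω] {μ : Measure Ω} [IsProbabilityMeasure μ] {X : ℤ → Ω → ℝ}

lemma pastSigma_le (hX : ∀ i, Measurable (X i)) (k : ℤ) : pastSigma X k ≤ ‹MeasurableSpace Ω› :=
  iSup_le fun i => (hX i.1).comap_le

lemma futureSigma_le (hX : ∀ i, Measurable (X i)) (k : ℤ) :
    futureSigma X k ≤ ‹MeasurableSpace Ω› :=
  iSup_le fun i => (hX i.1).comap_le

lemma abs_measureReal_inter_sub_le_one (A B : Set Ω) :
    |μ.real (A ∩ B) - μ.real A * μ.real B| ≤ 1 := by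
  have h1 : μ.real (A ∩ B) ≤ 1 := measureReal_le_one
  have h2 : μ.real A ≤ 1 := measureReal_le_one
  have h3 : μ.real B ≤ 1 := measureReal_le_one
  have h4 : 0 ≤ μ.real (A ∩ B) := measureReal_nonneg
  have h5 : 0 ≤ μ.real A := measureReal_nonneg
  have h6 : 0 ≤ μ.real B := measureReal_nonneg
  rw [abs_le]
  constructor <;> nlinarith

lemma alphaCoeff_pastSigma_futureSigma_le_one (k l : ℤ) :
    alphaCoeff μ (pastSigma X k) (futureSigma X l) ≤ 1 :=
  have : Nonempty ({A : Set Ω // MeasurableSet[pastSigma X k] A} ×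
      {B : Set Ω // MeasurableSet[futureSigma X l] B}) :=
    ⟨⟨⟨∅, @MeasurableSet.empty _ (pastSigma X k)⟩, ⟨∅, @MeasurableSet.empty _ (futureSigma X l)⟩⟩⟩
  ciSup_le fun _ => abs_measureReal_inter_sub_le_one _ _

lemma abs_measureReal_inter_sub_le_alphaMixing (k : ℤ) (t : ℕ) {A B : Set Ω}
    (hA : MeasurableSet[pastSigma X k] A) (hB : MeasurableSet[futureSigma X (k + t)] B) :
    |μ.real (A ∩ B) - μ.real A * μ.real B| ≤ alphaMixing μ X t := by
  have h1 : |μ.real (A ∩ B) - μ.real A * μ.real B| ≤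
      alphaCoeff μ (pastSigma X k) (futureSigma X (k + t)) :=
    le_ciSup (f := fun p : {A : Set Ω // MeasurableSet[pastSigma X k] A} ×
      {B : Set Ω // MeasurableSet[futureSigma X (k + t)] B} =>
      |μ.real (p.1.1 ∩ p.2.1) - μ.real p.1.1 * μ.real p.2.1|)
      ⟨1, by rintro _ ⟨p, rfl⟩; exact abs_measureReal_inter_sub_le_one _ _⟩ ⟨⟨A, hA⟩, ⟨B, hB⟩⟩
  exact h1.trans (le_ciSup (f := fun k : ℤ => alphaCoeff μ (pastSigma X k) (futureSigma X (k + t)))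
    ⟨1, by rintro _ ⟨p, rfl⟩; exact alphaCoeff_pastSigma_futureSigma_le_one _ _⟩ k)

lemma alphaMixing_nonneg (t : ℕ) : 0 ≤ alphaMixing μ X t :=
  (abs_nonneg _).trans (abs_measureReal_inter_sub_le_alphaMixing (μ := μ) (X := X) 0 t
    (A := ∅) (B := ∅) (@MeasurableSet.empty _ (pastSigma X 0)) (@MeasurableSet.empty _ (futureSigma X (0 + t))))

/-- A function of a middle block is nearly uncorrelated with a product of a function of the remote
past and a function of the remote future. -/
lemma norm_integral_past_mul_present_mul_future_sub_le (hX : ∀ i, Measurable (X i)) {k l : ℤ}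
    {t : ℕ} {V U Z : Ω → ℂ} (hV : Measurable[pastSigma X k] V)
    (hVl : Measurable[pastSigma X l] V)
    (hU : Measurable[futureSigma X (k + t)] U) (hUl : Measurable[pastSigma X l] U)
    (hZk : Measurable[futureSigma X (k + t)] Z)
    (hZ : Measurable[futureSigma X (l + t)] Z) {u : ℝ}
    (hVb : ∀ ω, ‖V ω‖ ≤ 1) (hUb : ∀ ω, ‖U ω‖ ≤ u) (hZb : ∀ ω, ‖Z ω‖ ≤ 1) :
    ‖∫ ω, U ω * (V ω * Z ω) ∂μ - (∫ ω, U ω ∂μ) * ∫ ω, V ω * Z ω ∂μ‖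
      ≤ 48 * alphaMixing μ X t * u := by
  have hu := nonneg_of_forall_norm_le μ hUb
  have hp := pastSigma_le hX
  have hf := futureSigma_le hX
  have hmix := fun k => fun A B (hA : MeasurableSet[pastSigma X k] A)
    (hB : MeasurableSet[futureSigma X (k + t)] B) =>
      abs_measureReal_inter_sub_le_alphaMixing (μ := μ) k t hA hB
  have hVUb : ∀ ω, ‖V ω * U ω‖ ≤ u := fun ω => by
    rw [norm_mul]
    exact (mul_le_mul (hVb ω) (hUb ω) (norm_nonneg _) zero_le_one).trans_eq (one_mul u)
  have hVUm : Measurable[pastSigma X l] fun ω => V ω * U ω := hVl.mul hUl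
  have c1 := norm_covariance_le_of_strongMixing (μ := μ) (hp l) (hf (l + t)) (hmix l)
    hVUm hZ hVUb hZb
  have c2 := norm_covariance_le_of_strongMixing (μ := μ) (hp k) (hf (k + t)) (hmix k) hV hU hVb hUb
  have c3 := norm_covariance_le_of_strongMixing (μ := μ) (hp k) (hf (k + t)) (hmix k) hV hZk hVb hZb
  have hUn : ‖∫ ω, U ω ∂μ‖ ≤ u := by
    simpa using norm_integral_le_of_norm_le_const (μ := μ) (ae_of_all _ hUb)
  have hZn : ‖∫ ω, Z ω ∂μ‖ ≤ 1 := by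
    simpa using norm_integral_le_of_norm_le_const (μ := μ) (ae_of_all _ hZb)
  have ha := alphaMixing_nonneg (μ := μ) (X := X) t
  have e : (∫ ω, U ω * (V ω * Z ω) ∂μ) = ∫ ω, V ω * U ω * Z ω ∂μ := by
    congr 1; ext ω; ring
  rw [e]
  set α := alphaMixing μ X t
  set IU := ∫ ω, U ω ∂μ
  set IZ := ∫ ω, Z ω ∂μ
  set IV := ∫ ω, V ω ∂μ
  -- Three covariances occur: `VU` against `Z`, `V` against `U`, and `V` against `Z` to reassemble
  -- `E[VZ]`. Each costs `16 α u`, which is the constant `48`.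
  have e2 : (∫ ω, V ω * U ω * Z ω ∂μ) - IU * ∫ ω, V ω * Z ω ∂μ
      = ((∫ ω, V ω * U ω * Z ω ∂μ) - (∫ ω, V ω * U ω ∂μ) * IZ)
        + ((∫ ω, V ω * U ω ∂μ) - IV * IU) * IZ - IU * ((∫ ω, V ω * Z ω ∂μ) - IV * IZ) := by ring
  rw [e2]
  refine (norm_sub_le _ _).trans ((add_le_add (norm_add_le _ _) le_rfl).trans ?_)
  rw [norm_mul, norm_mul]
  have t2 := mul_le_mul c2 hZn (norm_nonneg _) (by positivity)
  have t3 := mul_le_mul hUn c3 (norm_nonneg _) hu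
  linarith

end StrongMixing

/-! ### Smoothing by the Fejér kernel. -/

/-- The Fejér kernel `2 (1 - cos x) / x²`, as the cosine transform of the tent function. -/
noncomputable def fejerKernel (x : ℝ) : ℝ := 2 * ∫ s in (0 : ℝ)..1, (1 - s) * Real.cos (s * x)

lemma fejerKernel_eq {x : ℝ} (hx : x ≠ 0) : fejerKernel x = 2 * ((1 - Real.cos x) / x ^ 2) := by
  unfold fejerKernel
  congr 1
  have h : ∀ s ∈ Set.uIcc (0 : ℝ) 1, HasDerivAt
      (fun s => (1 - s) * (Real.sin (s * x) / x) - Real.cos (s * x) / x ^ 2)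
      ((1 - s) * Real.cos (s * x)) s := by
    intro s _
    have h1 : HasDerivAt (fun s : ℝ => s * x) x s := by simpa using (hasDerivAt_id s).mul_const x
    have h2 := ((hasDerivAt_id s).const_sub 1).mul ((h1.sin).div_const x)
    have h3 := (h1.cos).div_const (x ^ 2)
    refine (h2.sub h3).congr_deriv ?_
    simp only [id]
    field_simp
    ring
  rw [intervalIntegral.integral_eq_sub_of_hasDerivAt h
    (Continuous.intervalIntegrable (by fun_prop) _ _)]
  simp
  field_simp
  ring

lemma continuous_fejerKernel : Continuous fejerKernel := by
  unfold fejerKernel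
  refine continuous_const.mul ?_
  exact intervalIntegral.continuous_parametric_intervalIntegral_of_continuous' (by fun_prop) _ _

lemma fejerKernel_zero : fejerKernel 0 = 1 := by
  simp only [fejerKernel, mul_zero, Real.cos_zero, mul_one]
  rw [intervalIntegral.integral_sub (by simp) (by simp)]
  norm_num

lemma fejerKernel_nonneg (x : ℝ) : 0 ≤ fejerKernel x := by
  rcases eq_or_ne x 0 with rfl | hx
  · rw [fejerKernel_zero]; norm_num
  · rw [fejerKernel_eq hx]
    have := Real.cos_le_one x
    have : 0 ≤ 1 - Real.cos x := by linarith
    positivity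

lemma fejerKernel_le_two (x : ℝ) : fejerKernel x ≤ 2 := by
  unfold fejerKernel
  have : ‖∫ s in (0 : ℝ)..1, (1 - s) * Real.cos (s * x)‖ ≤ 1 * |1 - 0| := by
    refine intervalIntegral.norm_integral_le_of_norm_le_const fun s hs => ?_
    rw [Set.uIoc_of_le zero_le_one] at hs
    rw [norm_mul, Real.norm_eq_abs, Real.norm_eq_abs, abs_of_nonneg (by linarith [hs.2])]
    have := Real.abs_cos_le_one (s * x)
    have := abs_nonneg (Real.cos (s * x))
    nlinarith [hs.1, hs.2]
  have h2 := (le_abs_self _).trans this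
  norm_num at h2
  linarith

lemma integrable_fejerKernel : Integrable fejerKernel := by
  -- The kernel is at most `2` for `x² ≤ 1` and at most `4/x²` beyond; both are below `8/(1+x²)`.
  refine (integrable_inv_one_add_sq.const_mul 8).mono'
    continuous_fejerKernel.aestronglyMeasurable (ae_of_all _ fun x => ?_)
  rw [Real.norm_of_nonneg (fejerKernel_nonneg x)]
  have h0 : 0 < 1 + x ^ 2 := by positivity
  rw [← div_eq_mul_inv, le_div_iff₀ h0]
  rcases le_total (x ^ 2) 1 with h | h
  · nlinarith [fejerKernel_le_two x, fejerKernel_nonneg x]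
  · have hx : x ≠ 0 := by rintro rfl; norm_num at h
    rw [fejerKernel_eq hx, mul_div_assoc', div_mul_eq_mul_div, div_le_iff₀ (by positivity)]
    nlinarith [Real.neg_one_le_cos x, Real.cos_le_one x]

lemma integral_fejerKernel_pos : 0 < ∫ x, fejerKernel x :=
  integral_pos_of_integrable_nonneg_nonzero continuous_fejerKernel integrable_fejerKernel
    fejerKernel_nonneg (x := 0) (by rw [fejerKernel_zero]; norm_num)

/-- Exchanging the integrals turns cosines into sines, whose averages over `P` are read off from the
characteristic function. -/
lemma integral_fejerKernel_eq (A B : ℝ) : ∫ w in A..B, fejerKernel w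
    = 2 * ∫ s in (0 : ℝ)..1, (1 - s) * ((Real.sin (s * B) - Real.sin (s * A)) / s) := by
  unfold fejerKernel
  rw [intervalIntegral.integral_const_mul]
  congr 1
  rw [intervalIntegral_intervalIntegral_swap]
  · refine intervalIntegral.integral_congr_ae ?_
    rw [Set.uIoc_of_le zero_le_one]
    refine ae_of_all _ fun s hs => ?_
    rw [intervalIntegral.integral_const_mul]
    congr 1
    have hs0 : s ≠ 0 := hs.1.ne'
    rw [intervalIntegral.integral_comp_mul_left (fun x => Real.cos x) hs0, integral_cos]
    simp [div_eq_inv_mul]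
  · refine ContinuousOn.integrableOn_compact (K := Set.uIcc A B ×ˢ Set.uIcc 0 1) ?_ ?_ |>.mono_set
      (Set.prod_mono Set.uIoc_subset_uIcc Set.uIoc_subset_uIcc)
    · exact isCompact_uIcc.prod isCompact_uIcc
    · exact Continuous.continuousOn (by unfold Function.uncurry; fun_prop)

lemma measurable_cdf (P : Measure ℝ) : Measurable (cdf P) := (monotone_cdf P).measurable

lemma integrable_cdf_mul_fejerKernel (P : Measure ℝ) (T y : ℝ) :
    Integrable fun w => cdf P (y - w / T) * fejerKernel w := by
  refine integrable_fejerKernel.bdd_mul (c := 1)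
    ((measurable_cdf P).comp (by fun_prop)).aestronglyMeasurable (ae_of_all _ fun w => ?_)
  rw [Real.norm_of_nonneg (cdf_nonneg _ _)]
  exact cdf_le_one _ _

section Smoothing
variable {P Q : Measure ℝ} [IsProbabilityMeasure P] [IsProbabilityMeasure Q]

lemma integral_sin_mul_sub_eq (t y : ℝ) : ∫ x, Real.sin (t * (y - x)) ∂P
    = -(Complex.exp (-(t * y) * Complex.I) * charFun P t).im := by
  rw [charFun_apply_real, ← integral_const_mul]
  have hint : Integrable
      (fun x : ℝ => Complex.exp (-(t * y) * Complex.I) * Complex.exp (t * x * Complex.I)) P := by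
    refine Integrable.of_bound (by fun_prop) 1 (ae_of_all _ fun x => ?_)
    rw [← Complex.exp_add, ← add_mul]
    have : (-(t * y : ℂ) + t * x) = ((-(t * y) + t * x : ℝ) : ℂ) := by push_cast; ring
    rw [this, Complex.norm_exp_ofReal_mul_I]
  have := integral_im hint
  simp only [RCLike.im_eq_complex_im] at this
  rw [← this, ← integral_neg]
  congr 1
  ext x
  rw [← Complex.exp_add, ← add_mul]
  have : (-(t * y : ℂ) + t * x) = ((-(t * (y - x)) : ℝ) : ℂ) := by push_cast; ring
  rw [this, Complex.exp_ofReal_mul_I_im, Real.sin_neg, neg_neg]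

lemma abs_integral_sin_sub_le (t y : ℝ) :
    |∫ x, Real.sin (t * (y - x)) ∂P - ∫ x, Real.sin (t * (y - x)) ∂Q|
      ≤ ‖charFun P t - charFun Q t‖ := by
  rw [integral_sin_mul_sub_eq, integral_sin_mul_sub_eq]
  have : -(Complex.exp (-(t * y) * Complex.I) * charFun P t).im
      - -(Complex.exp (-(t * y) * Complex.I) * charFun Q t).im
      = -(Complex.exp (-(t * y) * Complex.I) * (charFun P t - charFun Q t)).im := by
    rw [mul_sub, Complex.sub_im]; ring
  rw [this, abs_neg]
  refine (Complex.abs_im_le_norm _).trans ?_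
  rw [norm_mul]
  have : (-(t * y) : ℂ) = ((-(t * y) : ℝ) : ℂ) := by push_cast; ring
  rw [this, Complex.norm_exp_ofReal_mul_I, one_mul]


/-- The singularity `1/s` is cancelled because two sines with arguments `sT|y - a|` apart are
compared. This is why increments over `[a, y]` are treated first, and `a → -∞` only afterwards. -/
lemma integrable_fejerKernel_integrand (T a y : ℝ) :
    Integrable (Function.uncurry fun s x : ℝ => (1 - s) *
        ((Real.sin (s * (T * (y - x))) - Real.sin (s * (T * (a - x)))) / s))
      ((volume.restrict (Set.uIoc (0 : ℝ) 1)).prod P) := by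
  have hm : Measurable (Function.uncurry fun s x : ℝ => (1 - s) *
      ((Real.sin (s * (T * (y - x))) - Real.sin (s * (T * (a - x)))) / s)) := by
    unfold Function.uncurry; fun_prop
  have h1 : IsFiniteMeasure (volume.restrict (Set.uIoc (0 : ℝ) 1)) := by
    rw [Set.uIoc_of_le zero_le_one]; infer_instance
  have hae : ∀ᵐ p : ℝ × ℝ ∂((volume.restrict (Set.uIoc (0 : ℝ) 1)).prod P),
      p.1 ∈ Set.uIoc (0 : ℝ) 1 :=
    Measure.quasiMeasurePreserving_fst.ae (ae_restrict_mem measurableSet_uIoc)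
  refine Integrable.of_bound hm.aestronglyMeasurable (|T| * |y - a|) ?_
  filter_upwards [hae] with p hp
  rw [Set.uIoc_of_le zero_le_one] at hp
  have h2 := Real.abs_sin_sub_sin_le (p.1 * (T * (y - p.2))) (p.1 * (T * (a - p.2)))
  have e : p.1 * (T * (y - p.2)) - p.1 * (T * (a - p.2)) = p.1 * (T * (y - a)) := by ring
  rw [e, abs_mul, abs_of_pos hp.1, abs_mul] at h2
  simp only [Function.uncurry]
  rw [norm_mul, norm_div, Real.norm_eq_abs, Real.norm_eq_abs, Real.norm_eq_abs, abs_of_pos hp.1,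
    abs_of_nonneg (by linarith [hp.2])]
  calc _ ≤ 1 * (|T| * |y - a|) := by
        refine mul_le_mul (by linarith [hp.1]) ?_ (by have := hp.1; positivity) zero_le_one
        rw [div_le_iff₀ hp.1]; linarith
    _ = _ := one_mul _

lemma integral_integral_fejerKernel_eq (T a y : ℝ) :
    ∫ x, (∫ w in T * (a - x)..T * (y - x), fejerKernel w) ∂P
      = 2 * ∫ s in (0 : ℝ)..1, (∫ x, (1 - s) *
        ((Real.sin (s * (T * (y - x))) - Real.sin (s * (T * (a - x)))) / s) ∂P) := by
  simp_rw [integral_fejerKernel_eq]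
  rw [integral_const_mul, ← intervalIntegral_integral_swap (integrable_fejerKernel_integrand T a y)]

lemma intervalIntegrable_fejerKernel_integrand (T a y : ℝ) :
    IntervalIntegrable (fun s => ∫ x, (1 - s) *
        ((Real.sin (s * (T * (y - x))) - Real.sin (s * (T * (a - x)))) / s) ∂P) volume 0 1 := by
  rw [intervalIntegrable_iff]
  exact (integrable_fejerKernel_integrand T a y).integral_prod_left

/-- The tent is supported in `[0,1]`, so only frequencies `sT ≤ T` enter. The constant is `2 · 2`:
the factor in the kernel and the two endpoints `a` and `y`. -/
lemma abs_integral_integral_fejerKernel_sub_le {T : ℝ} (hT : 0 < T) {g : ℝ → ℝ} (hg : Continuous g)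
    (hb : ∀ t, 0 < t → t ≤ T → ‖charFun P t - charFun Q t‖ ≤ t * g t) (a y : ℝ) :
    |∫ x, (∫ w in T * (a - x)..T * (y - x), fejerKernel w) ∂P
      - ∫ x, (∫ w in T * (a - x)..T * (y - x), fejerKernel w) ∂Q| ≤ 4 * ∫ t in (0 : ℝ)..T, g t := by
  have sinint : ∀ (P : Measure ℝ) [IsProbabilityMeasure P] (s y : ℝ),
      Integrable (fun x => Real.sin (s * (T * (y - x)))) P := fun P _ s y =>
    Integrable.of_bound (by fun_prop) 1 (ae_of_all _ fun x => Real.abs_sin_le_one _)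
  have split : ∀ (P : Measure ℝ) [IsProbabilityMeasure P] (s : ℝ), ∫ x, (1 - s) *
      ((Real.sin (s * (T * (y - x))) - Real.sin (s * (T * (a - x)))) / s) ∂P
      = (1 - s) * ((∫ x, Real.sin (s * T * (y - x)) ∂P
          - ∫ x, Real.sin (s * T * (a - x)) ∂P) / s) := by
    intro P _ s
    rw [integral_const_mul, integral_div, integral_sub (sinint P s y) (sinint P s a)]
    simp_rw [mul_assoc]
  rw [integral_integral_fejerKernel_eq, integral_integral_fejerKernel_eq, ← mul_sub,
    ← intervalIntegral.integral_sub (intervalIntegrable_fejerKernel_integrand T a y)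
      (intervalIntegrable_fejerKernel_integrand T a y), abs_mul, abs_two]
  have h1 : ‖∫ s in (0 : ℝ)..1, ((∫ x, (1 - s) *
        ((Real.sin (s * (T * (y - x))) - Real.sin (s * (T * (a - x)))) / s) ∂P)
      - ∫ x, (1 - s) *
        ((Real.sin (s * (T * (y - x))) - Real.sin (s * (T * (a - x)))) / s) ∂Q)‖
      ≤ ∫ s in (0 : ℝ)..1, 2 * (T * g (s * T)) := by
    refine intervalIntegral.norm_integral_le_of_norm_le zero_le_one (ae_of_all _ fun s hs => ?_)
      (Continuous.intervalIntegrable (by fun_prop) _ _)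
    rw [split, split, ← mul_sub, ← sub_div, norm_mul, norm_div, Real.norm_eq_abs, Real.norm_eq_abs,
      Real.norm_eq_abs, abs_of_pos hs.1, abs_of_nonneg (by linarith [hs.2])]
    have hc := hb (s * T) (mul_pos hs.1 hT) (mul_le_of_le_one_left hT.le hs.2)
    have b1 := (abs_integral_sin_sub_le (P := P) (Q := Q) (s * T) y).trans hc
    have b2 := (abs_integral_sin_sub_le (P := P) (Q := Q) (s * T) a).trans hc
    have b3 : |∫ x, Real.sin (s * T * (y - x)) ∂P - ∫ x, Real.sin (s * T * (a - x)) ∂P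
        - (∫ x, Real.sin (s * T * (y - x)) ∂Q - ∫ x, Real.sin (s * T * (a - x)) ∂Q)|
        ≤ 2 * (s * T * g (s * T)) := by
      rw [abs_le] at *
      constructor <;> linarith
    calc _ ≤ 1 * (2 * (T * g (s * T))) := by
          refine mul_le_mul (by linarith [hs.1]) ?_ (by have := hs.1; positivity) zero_le_one
          rw [div_le_iff₀ hs.1]; linarith
      _ = _ := one_mul _
  have h2 : ∫ s in (0 : ℝ)..1, 2 * (T * g (s * T)) = 2 * ∫ t in (0 : ℝ)..T, g t := by
    rw [intervalIntegral.integral_const_mul, intervalIntegral.integral_const_mul,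
      intervalIntegral.mul_integral_comp_mul_right]
    simp
  rw [h2] at h1
  rw [Real.norm_eq_abs] at h1
  linarith

/-- Fubini on the strip `T(a - x) < w ≤ T(y - x)`, read as a condition on `x` for fixed `w`. -/
lemma integral_integral_fejerKernel_eq_integral_cdf {T : ℝ} (hT : 0 < T) {a y : ℝ} (hay : a ≤ y) :
    ∫ x, (∫ w in T * (a - x)..T * (y - x), fejerKernel w) ∂P
      = ∫ w, (cdf P (y - w / T) - cdf P (a - w / T)) * fejerKernel w := by
  have hS : MeasurableSet {p : ℝ × ℝ | p.2 ∈ Set.Ioc (T * (a - p.1)) (T * (y - p.1))} := by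
    have h1 : MeasurableSet {p : ℝ × ℝ | T * (a - p.1) < p.2} :=
      measurableSet_lt (by fun_prop) (by fun_prop)
    have h2 : MeasurableSet {p : ℝ × ℝ | p.2 ≤ T * (y - p.1)} :=
      measurableSet_le (by fun_prop) (by fun_prop)
    exact h1.inter h2
  have hint := (integrable_fejerKernel.comp_snd P).indicator hS
  have e1 : ∀ x, ∫ w in T * (a - x)..T * (y - x), fejerKernel w
      = ∫ w, ({p : ℝ × ℝ | p.2 ∈ Set.Ioc (T * (a - p.1)) (T * (y - p.1))}.indicator
        (fun p : ℝ × ℝ => fejerKernel p.2)) (x, w) := by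
    intro x
    rw [intervalIntegral.integral_of_le (by gcongr), ← integral_indicator measurableSet_Ioc]
    rfl
  simp_rw [e1]
  rw [integral_integral_swap (f := fun x w =>
    ({p : ℝ × ℝ | p.2 ∈ Set.Ioc (T * (a - p.1)) (T * (y - p.1))}.indicator
        (fun p : ℝ × ℝ => fejerKernel p.2)) (x, w)) hint]
  congr 1
  ext w
  have e2 : ∀ x : ℝ, ({p : ℝ × ℝ | p.2 ∈ Set.Ioc (T * (a - p.1)) (T * (y - p.1))}.indicator
        (fun p : ℝ × ℝ => fejerKernel p.2)) (x, w)
      = (Set.Ioc (a - w / T) (y - w / T)).indicator (fun _ => fejerKernel w) x := by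
    intro x
    have : w ∈ Set.Ioc (T * (a - x)) (T * (y - x)) ↔ x ∈ Set.Ioc (a - w / T) (y - w / T) := by
      simp only [Set.mem_Ioc]
      rw [sub_lt_comm, lt_div_iff₀ hT, le_sub_comm, div_le_iff₀ hT, mul_comm, mul_comm T]
    by_cases h : w ∈ Set.Ioc (T * (a - x)) (T * (y - x))
    · rw [Set.indicator_of_mem (this.1 h), Set.indicator_of_mem (by exact h)]
    · rw [Set.indicator_of_notMem (fun h' => h (this.2 h')), Set.indicator_of_notMem (by exact h)]
  simp_rw [e2]
  rw [integral_indicator measurableSet_Ioc, setIntegral_const, cdf_eq_real, cdf_eq_real,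
    ← Set.Iic_sdiff_Iic, measureReal_sdiff (Set.Iic_subset_Iic.2 (by linarith)) measurableSet_Iic,
    smul_eq_mul]

/-- The bound for increments is uniform in the left endpoint, which is sent to `-∞` along the
integers by dominated convergence. -/
lemma abs_integral_cdf_sub_cdf_mul_fejerKernel_le {T : ℝ} (hT : 0 < T) {g : ℝ → ℝ}
    (hg : Continuous g)
    (hb : ∀ t, 0 < t → t ≤ T → ‖charFun P t - charFun Q t‖ ≤ t * g t) (y : ℝ) :
    |∫ w, (cdf P (y - w / T) - cdf Q (y - w / T)) * fejerKernel w| ≤ 4 * ∫ t in (0 : ℝ)..T, g t := by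
  have lim : ∀ (P : Measure ℝ) [IsProbabilityMeasure P],
      Tendsto (fun n : ℕ => ∫ x, (∫ w in T * (-(n : ℝ) - x)..T * (y - x), fejerKernel w) ∂P) atTop
        (𝓝 (∫ w, cdf P (y - w / T) * fejerKernel w)) := by
    intro P _
    have h1 : Tendsto (fun n : ℕ => ∫ w, (cdf P (y - w / T) - cdf P (-(n : ℝ) - w / T))
        * fejerKernel w) atTop (𝓝 (∫ w, cdf P (y - w / T) * fejerKernel w)) := by
      refine tendsto_integral_of_dominated_convergence fejerKernel (fun n => ?_)
        integrable_fejerKernel (fun n => ae_of_all _ fun w => ?_) (ae_of_all _ fun w => ?_)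
      · exact ((((measurable_cdf P).comp (by fun_prop)).sub
          ((measurable_cdf P).comp (by fun_prop))).mul
          continuous_fejerKernel.measurable).aestronglyMeasurable
      · rw [norm_mul, Real.norm_of_nonneg (fejerKernel_nonneg w)]
        refine mul_le_of_le_one_left (fejerKernel_nonneg w) ?_
        rw [Real.norm_eq_abs, abs_le]
        constructor <;> linarith [cdf_nonneg P (y - w / T), cdf_le_one P (y - w / T),
          cdf_nonneg P (-(n : ℝ) - w / T), cdf_le_one P (-(n : ℝ) - w / T)]
      · have h2 : Tendsto (fun n : ℕ => cdf P (-(n : ℝ) - w / T)) atTop (𝓝 0) := by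
          refine (tendsto_cdf_atBot P).comp ?_
          exact tendsto_atBot_add_const_right _ _
            (tendsto_neg_atTop_atBot.comp tendsto_natCast_atTop_atTop)
        simpa using (h2.const_sub (cdf P (y - w / T))).mul_const (fejerKernel w)
    refine h1.congr' ?_
    filter_upwards [eventually_ge_atTop ⌈-y⌉₊] with n hn
    rw [integral_integral_fejerKernel_eq_integral_cdf hT]
    linarith [Nat.ceil_le.1 hn]
  have h := ((lim P).sub (lim Q)).abs
  have e : ∫ w, (cdf P (y - w / T) - cdf Q (y - w / T)) * fejerKernel w
      = (∫ w, cdf P (y - w / T) * fejerKernel w) - ∫ w, cdf Q (y - w / T) * fejerKernel w := by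
    rw [← integral_sub (integrable_cdf_mul_fejerKernel _ T y) (integrable_cdf_mul_fejerKernel _ T y)]
    simp_rw [sub_mul]
  rw [e]
  exact le_of_tendsto h (Eventually.of_forall fun n =>
    abs_integral_integral_fejerKernel_sub_le hT hg hb _ _)

end Smoothing

/-! ### Esseen's smoothing inequality. -/

lemma exists_fejerKernel_concentration : ∃ r : ℝ, 0 < r ∧
    3 / 4 * (∫ w, fejerKernel w) ≤ ∫ w in -r..r, fejerKernel w := by
  have h := intervalIntegral_tendsto_integral integrable_fejerKernel tendsto_neg_atTop_atBot
    tendsto_id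
  have h2 : 3 / 4 * (∫ w, fejerKernel w) < ∫ w, fejerKernel w := by
    linarith [integral_fejerKernel_pos]
  obtain ⟨r, hr, hr0⟩ := ((h.eventually (lt_mem_nhds h2)).and (eventually_gt_atTop 0)).exists
  exact ⟨r, hr0, hr.le⟩

/-- If a bounded function is at least `κ` near a point then so is, up to a third of its bound, its
average against the rescaled Fejér kernel. -/
lemma le_integral_mul_fejerKernel {r η κ : ℝ} (hr0 : 0 < r)
    (hr : 3 / 4 * (∫ w, fejerKernel w) ≤ ∫ w in -r..r, fejerKernel w) {D : ℝ → ℝ}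
    (hD : Integrable fun w => D w * fejerKernel w) (hη : ∀ w, -η ≤ D w)
    (hκ : ∀ w, -r ≤ w → w ≤ r → κ ≤ D w) (hκη : 0 ≤ κ + η) :
    (3 / 4 * κ - 1 / 4 * η) * (∫ w, fejerKernel w) ≤ ∫ w, D w * fejerKernel w := by
  -- `D` is bounded below by the step function equal to `κ` on the window and `-η` outside.
  have h1 : ∫ w, ((κ + η) * (Set.Ioc (-r) r).indicator fejerKernel w - η * fejerKernel w)
      ≤ ∫ w, D w * fejerKernel w := by
    refine integral_mono (((integrable_fejerKernel.indicator measurableSet_Ioc).const_mul _).sub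
      (integrable_fejerKernel.const_mul _)) hD fun w => ?_
    have h0 := fejerKernel_nonneg w
    simp only
    by_cases hw : w ∈ Set.Ioc (-r) r
    · rw [Set.indicator_of_mem hw]
      nlinarith [hκ w hw.1.le hw.2]
    · rw [Set.indicator_of_notMem hw]
      nlinarith [hη w]
  rw [integral_sub ((integrable_fejerKernel.indicator measurableSet_Ioc).const_mul _)
    (integrable_fejerKernel.const_mul _), integral_const_mul, integral_const_mul,
    integral_indicator measurableSet_Ioc, ← intervalIntegral.integral_of_le (by linarith)] at h1
  nlinarith

/-- The smoothing inequality of Berry and Esseen. -/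
theorem exists_abs_cdf_sub_cdf_le : ∃ C : ℝ, 0 < C ∧ ∀ (P Q : Measure ℝ) [IsProbabilityMeasure P]
    [IsProbabilityMeasure Q] (L T : ℝ) (g : ℝ → ℝ), 0 < T →
    (∀ x y, x ≤ y → cdf Q y - cdf Q x ≤ L * (y - x)) → Continuous g →
    (∀ t, 0 < t → t ≤ T → ‖charFun P t - charFun Q t‖ ≤ t * g t) →
    ∀ x, |cdf P x - cdf Q x| ≤ C * ((∫ t in (0 : ℝ)..T, g t) + L / T) := by
  obtain ⟨r, hr0, hr⟩ := exists_fejerKernel_concentration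
  set c := ∫ w, fejerKernel w with hc
  have hc0 : 0 < c := integral_fejerKernel_pos
  refine ⟨8 / c + 3 * r, by positivity, ?_⟩
  intro P Q _ _ L T g hT hL hg hb
  have hL0 : 0 ≤ L := by
    have := hL 0 1 zero_le_one
    have := monotone_cdf Q (zero_le_one (α := ℝ))
    linarith
  set I := ∫ t in (0 : ℝ)..T, g t
  have main := abs_integral_cdf_sub_cdf_mul_fejerKernel_le hT hg hb
  have hI : 0 ≤ I := by linarith [abs_nonneg _ |>.trans (main 0)]
  set Δ : ℝ → ℝ := fun x => cdf P x - cdf Q x with hΔ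
  have hΔ1 : ∀ x, |Δ x| ≤ 1 := fun x => by
    rw [abs_le]
    constructor <;> linarith [cdf_nonneg P x, cdf_le_one P x, cdf_nonneg Q x, cdf_le_one Q x]
  set η := ⨆ x, |Δ x| with hη
  have hle : ∀ x, |Δ x| ≤ η :=
    le_ciSup (f := fun x => |Δ x|) ⟨1, by rintro _ ⟨x, rfl⟩; exact hΔ1 x⟩
  have hη0 : 0 ≤ η := (abs_nonneg _).trans (hle 0)
  have hΔi : ∀ y, Integrable fun w => Δ (y - w / T) * fejerKernel w := fun y => by
    simp only [hΔ, sub_mul]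
    exact (integrable_cdf_mul_fejerKernel P T y).sub (integrable_cdf_mul_fejerKernel Q T y)
  set K := 2 * L * r / T + 16 / 3 * I / c with hK
  have hLr : L * (2 * r / T) = 2 * L * r / T := by ring
  have hK0 : 0 ≤ 16 / 3 * I / c := by positivity
  -- With three quarters of the mass in the window, the value `κ` is recovered up to `η/3`; the
  -- share below one allows `η` to be absorbed at the end.
  have conc : ∀ κ, (3 / 4 * κ - 1 / 4 * η) * c ≤ 4 * I → κ ≤ η / 3 + 16 / 3 * I / c := by
    intro κ h
    have : 3 / 4 * κ - 1 / 4 * η ≤ 4 * I / c := by rwa [le_div_iff₀ hc0]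
    have e : 16 / 3 * I / c = 4 / 3 * (4 * I / c) := by ring
    rw [e]; linarith
  have hw : ∀ w : ℝ, -r ≤ w → w ≤ r → -(r / T) ≤ w / T ∧ w / T ≤ r / T := fun w h1 h2 =>
    ⟨by rw [← neg_div]; gcongr, by gcongr⟩
  have e2 : 2 * r / T = 2 * (r / T) := by ring
  -- The centre is moved to `x + r/T` so that the window covers `[x, x + 2r/T]`. There the
  -- distribution function of `P` has not dropped below its value at `x`, and that of `Q` has grown
  -- by at most `2Lr/T`.
  have up : ∀ x, Δ x ≤ η / 3 + K := by
    intro x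
    by_cases hk : Δ x - 2 * L * r / T ≤ 0
    · simp only [hK]; linarith
    · have := le_integral_mul_fejerKernel (η := η) (κ := Δ x - 2 * L * r / T) hr0 hr
        (hΔi (x + r / T)) (fun w => (abs_le.1 (hle _)).1) (fun w h1 h2 => by
          obtain ⟨h3, h4⟩ := hw w h1 h2
          have m1 := monotone_cdf P (show x ≤ x + r / T - w / T by linarith)
          have m2 := monotone_cdf Q (show x + r / T - w / T ≤ x + 2 * r / T by rw [e2]; linarith)
          have m3 := hL x (x + 2 * r / T) (by have : 0 < 2 * r / T := by positivity
                                              linarith)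
          rw [add_sub_cancel_left, hLr] at m3
          simp only [hΔ]
          linarith) (by linarith)
      have := conc _ (this.trans ((le_abs_self _).trans (main _)))
      simp only [hK]; linarith
  -- For the other sign the window lies to the left, `[x - 2r/T, x]`.
  have down : ∀ x, -Δ x ≤ η / 3 + K := by
    intro x
    by_cases hk : -Δ x - 2 * L * r / T ≤ 0
    · simp only [hK]; linarith
    · have hneg : Integrable fun w => (-Δ (x - r / T - w / T)) * fejerKernel w := by
        simp only [neg_mul]
        exact (hΔi (x - r / T)).neg
      have := le_integral_mul_fejerKernel (η := η) (κ := -Δ x - 2 * L * r / T) hr0 hr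
        hneg (fun w => by linarith [(abs_le.1 (hle (x - r / T - w / T))).2]) (fun w h1 h2 => by
          obtain ⟨h3, h4⟩ := hw w h1 h2
          have m1 := monotone_cdf P (show x - r / T - w / T ≤ x by linarith)
          have m2 := monotone_cdf Q (show x - 2 * r / T ≤ x - r / T - w / T by rw [e2]; linarith)
          have m3 := hL (x - 2 * r / T) x (by have : 0 < 2 * r / T := by positivity
                                              linarith)
          rw [sub_sub_cancel, hLr] at m3
          simp only [hΔ]
          linarith) (by linarith)
      simp only [neg_mul, integral_neg] at this
      have := conc _ (this.trans ((neg_le_abs _).trans (main _)))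
      simp only [hK]; linarith
  -- The supremum satisfies `η ≤ η/3 + K`, whence `η ≤ 3K/2`; this yields the constants `8/c` and
  -- `3r`.
  have hηK : η ≤ η / 3 + K := ciSup_le fun x => abs_le'.2 ⟨up x, down x⟩
  intro x
  have h1 : η ≤ 3 / 2 * K := by linarith
  have h2 : 3 / 2 * K = 8 / c * I + 3 * r * (L / T) := by simp only [hK]; ring
  have h3 : 0 ≤ L / T := by positivity
  calc |cdf P x - cdf Q x| ≤ η := hle x
    _ ≤ 8 / c * I + 3 * r * (L / T) := by linarith
    _ ≤ _ := by
      have : 0 ≤ 8 / c * (L / T) := by positivity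
      have : 0 ≤ 3 * r * I := by positivity
      nlinarith

/-! ### Comparison with the Gaussian characteristic function. -/

/-- Stability of the differential equation `φ' = -v t φ` of the Gaussian characteristic function. -/
lemma norm_sub_exp_le_of_norm_deriv_add_le {φ φ' : ℝ → ℂ} (hφ : ∀ t, HasDerivAt φ (φ' t) t)
    (h0 : φ 0 = 1) {v a b κ ε c T : ℝ} (hv : 0 < v) (ha : 0 ≤ a) (hb : 0 ≤ b) (hε0 : 0 ≤ ε)
    (hode : ∀ t, 0 ≤ t → t ≤ T →
      ‖φ' t + (v * t : ℝ) * φ t‖ ≤ (a * t + b * t ^ 2) * ‖φ t‖ + (κ * t ^ 2 + ε))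
    (hT : a + b * T ≤ v / 4) (hε : ε < c) (hκ : 2 * κ ≤ v * c) {t : ℝ} (ht0 : 0 ≤ t) (htT : t ≤ T) :
    ‖φ t - (Real.exp (-(v * t ^ 2) / 2) : ℝ)‖ ≤
      t * ((a * t + b * t ^ 2) * Real.exp (-(v / 4) * t ^ 2) + c) := by
  set E : ℝ → ℝ := fun t => Real.exp (v * t ^ 2 / 2) with hE
  set H : ℝ → ℝ := fun t => Real.exp (v * t ^ 2 / 4) with hH
  have hEd : ∀ t, HasDerivAt E (v * t * E t) t := fun t => by
    have h1 : HasDerivAt (fun t : ℝ => v * t ^ 2 / 2) (v * t) t :=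
      ((((hasDerivAt_id t).pow 2).const_mul v).div_const 2).congr_deriv (by simp; ring)
    exact h1.exp.congr_deriv (by simp only [hE]; ring)
  have hHd : ∀ t, HasDerivAt H (v * t / 2 * H t) t := fun t => by
    have h1 : HasDerivAt (fun t : ℝ => v * t ^ 2 / 4) (v * t / 2) t :=
      ((((hasDerivAt_id t).pow 2).const_mul v).div_const 4).congr_deriv (by simp; ring)
    exact h1.exp.congr_deriv (by simp only [hH]; ring)
  have hE0 : ∀ t, 0 < E t := fun t => Real.exp_pos _
  have hH1 : ∀ t, 1 ≤ H t := fun t => Real.one_le_exp (by positivity)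
  set p : ℝ → ℝ := fun t => a * t ^ 2 / 2 + b * t ^ 3 / 3 with hp
  have hpd : ∀ t, HasDerivAt p (a * t + b * t ^ 2) t := fun t => by
    have h1 := ((((hasDerivAt_id t).pow 2).const_mul a).div_const 2).add
      ((((hasDerivAt_id t).pow 3).const_mul b).div_const 3)
    exact h1.congr_deriv (by simp; ring)
  -- The integrating factor removes the drift: `u' = (φ' + v t φ) E`.
  set u : ℝ → ℂ := fun t => φ t * (E t : ℂ) - 1 with hu
  have hud : ∀ t, HasDerivAt u ((φ' t + (v * t : ℝ) * φ t) * (E t : ℂ)) t := fun t => by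
    have h1 := ((hφ t).mul (hEd t).ofReal_comp).sub_const 1
    exact h1.congr_deriv (by push_cast; ring)
  -- The barrier. The errors proportional to `|φ|` accumulate to `p`, with growth `H = √E` as
  -- reserve, which is possible since their rate is at most `v t / 4`. The additive errors
  -- accumulate to `c t E`. Division by `E` leaves `p` with Gaussian decay.
  set B : ℝ → ℝ := fun t => H t * p t + c * t * E t with hB
  have hBd : ∀ t, HasDerivAt B ((v * t / 2 * H t * p t + H t * (a * t + b * t ^ 2))
      + (c * E t + c * t * (v * t * E t))) t := fun t => by
    have h1 := ((hHd t).mul (hpd t)).add ((((hasDerivAt_id t).const_mul c)).mul (hEd t))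
    exact h1.congr_deriv (by simp)
  have key := image_norm_le_of_norm_deriv_right_lt_deriv_boundary (f := u) (a := 0) (b := T)
    (fun x _ => (hud x).continuousAt.continuousWithinAt) (fun x _ => (hud x).hasDerivWithinAt)
    (B := B) (by simp [hu, hB, h0, hE, hp]) hBd (by
      intro x hx hxB
      have hx0 := hx.1
      have hlam0 : 0 ≤ a * x + b * x ^ 2 := by positivity
      have hlam : a * x + b * x ^ 2 ≤ v * x / 4 := by
        have h : a + b * x ≤ v / 4 := by nlinarith [mul_le_mul_of_nonneg_left hx.2.le hb]
        nlinarith [mul_le_mul_of_nonneg_right h hx0]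
      have hp0 : 0 ≤ p x := by simp only [hp]; positivity
      rw [norm_mul, Complex.norm_real, Real.norm_of_nonneg (hE0 x).le]
      have hφu : ‖φ x‖ * E x ≤ ‖u x‖ + 1 := by
        have : φ x * (E x : ℂ) = u x + 1 := by simp [hu]
        calc ‖φ x‖ * E x = ‖φ x * (E x : ℂ)‖ := by
              rw [norm_mul, Complex.norm_real, Real.norm_of_nonneg (hE0 x).le]
          _ ≤ ‖u x‖ + 1 := by rw [this]; simpa using norm_add_le (u x) 1
      have h1 := mul_le_mul_of_nonneg_right (hode x hx0 hx.2.le) (hE0 x).le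
      have h2 := mul_le_mul_of_nonneg_left hφu hlam0
      rw [hxB] at h2
      simp only [hB] at h2
      have h3 : (a * x + b * x ^ 2) * (H x * p x) ≤ v * x / 2 * H x * p x := by
        have : 0 ≤ H x * p x := mul_nonneg (by linarith [hH1 x]) hp0
        nlinarith
      have h4 : a * x + b * x ^ 2 ≤ H x * (a * x + b * x ^ 2) := by nlinarith [hH1 x]
      have hc0 : 0 ≤ c := by linarith
      have h5 : (a * x + b * x ^ 2) * (c * x * E x) ≤ v * x / 4 * (c * x * E x) := by
        have := (hE0 x).le
        gcongr
      -- `ε < c` gives the strict inequality demanded at a contact point, and `2κ ≤ v c` takes half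
      -- of the term `v c t² E` of `B'`; the bound `h5` uses another quarter.
      have h6 : (κ * x ^ 2 + ε) * E x < (c + c * x * (v * x) * (1 / 2)) * E x := by
        refine mul_lt_mul_of_pos_right ?_ (hE0 x)
        nlinarith [sq_nonneg x]
      have h7 : 0 ≤ c * x * (v * x) * E x := by have := (hE0 x).le; positivity
      nlinarith) ⟨ht0, htT⟩
  have hEi : Real.exp (-(v * t ^ 2) / 2) * E t = 1 := by
    simp only [hE]; rw [← Real.exp_add]; ring_nf; simp
  have hEH : H t * Real.exp (-(v * t ^ 2) / 2) = Real.exp (-(v / 4) * t ^ 2) := by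
    simp only [hH]; rw [← Real.exp_add]; congr 1; ring
  have e1 : φ t - (Real.exp (-(v * t ^ 2) / 2) : ℝ) = u t * (Real.exp (-(v * t ^ 2) / 2) : ℝ) := by
    simp only [hu]
    rw [sub_mul, mul_assoc, ← Complex.ofReal_mul, mul_comm (E t), hEi]
    simp
  rw [e1, norm_mul, Complex.norm_real, Real.norm_of_nonneg (Real.exp_pos _).le]
  calc _ ≤ B t * Real.exp (-(v * t ^ 2) / 2) := by gcongr
    _ = p t * Real.exp (-(v / 4) * t ^ 2) + c * t := by
      rw [← hEH]; simp only [hB]; rw [add_mul, mul_assoc (c * t), mul_comm (E t), hEi]; ring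
    _ ≤ t * (a * t + b * t ^ 2) * Real.exp (-(v / 4) * t ^ 2) + c * t := by
      gcongr
      simp only [hp]
      have : 0 ≤ a * t ^ 2 := by positivity
      have : 0 ≤ b * t ^ 3 := by positivity
      nlinarith
    _ = _ := by ring

/-- The constant of the Gaussian smoothing integral. -/
lemma exists_integral_linear_add_sq_mul_exp_le {v : ℝ} (hv : 0 < v) : ∃ M : ℝ, 0 < M ∧
    ∀ a b c T : ℝ, 0 ≤ a → 0 ≤ b → 0 ≤ T →
      ∫ t in (0 : ℝ)..T, ((a * t + b * t ^ 2) * Real.exp (-(v / 4) * t ^ 2) + c)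
        ≤ M * (a + b) + c * T := by
  have h1 : Integrable fun t : ℝ => |t| * Real.exp (-(v / 4) * t ^ 2) := by
    have := (integrable_mul_exp_neg_mul_sq (b := v / 4) (by positivity)).norm
    refine this.congr (ae_of_all _ fun t => ?_)
    simp
  have h2 : Integrable fun t : ℝ => t ^ 2 * Real.exp (-(v / 4) * t ^ 2) := by
    have := integrable_rpow_mul_exp_neg_mul_sq (b := v / 4) (by positivity) (s := 2) (by norm_num)
    simpa using this
  have n1 : 0 ≤ ∫ t : ℝ, |t| * Real.exp (-(v / 4) * t ^ 2) := integral_nonneg fun t => by positivity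
  have n2 : 0 ≤ ∫ t : ℝ, t ^ 2 * Real.exp (-(v / 4) * t ^ 2) :=
    integral_nonneg fun t => by positivity
  refine ⟨(∫ t : ℝ, |t| * Real.exp (-(v / 4) * t ^ 2))
    + (∫ t : ℝ, t ^ 2 * Real.exp (-(v / 4) * t ^ 2)) + 1, by positivity, ?_⟩
  intro a b c T ha hb hT
  rw [intervalIntegral.integral_add (Continuous.intervalIntegrable (by fun_prop) _ _)
    (Continuous.intervalIntegrable (by fun_prop) _ _)]
  have e1 : ∫ t in (0 : ℝ)..T, (a * t + b * t ^ 2) * Real.exp (-(v / 4) * t ^ 2)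
      ≤ a * (∫ t : ℝ, |t| * Real.exp (-(v / 4) * t ^ 2))
        + b * ∫ t : ℝ, t ^ 2 * Real.exp (-(v / 4) * t ^ 2) := by
    rw [intervalIntegral.integral_of_le hT, ← integral_const_mul, ← integral_const_mul,
      ← integral_add (h1.const_mul a) (h2.const_mul b)]
    have e2 : ∫ t in Set.Ioc 0 T, (a * t + b * t ^ 2) * Real.exp (-(v / 4) * t ^ 2)
        = ∫ t in Set.Ioc 0 T, (a * (|t| * Real.exp (-(v / 4) * t ^ 2))
          + b * (t ^ 2 * Real.exp (-(v / 4) * t ^ 2))) := by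
      refine setIntegral_congr_fun measurableSet_Ioc fun t ht => ?_
      rw [abs_of_pos ht.1]; ring
    rw [e2]
    exact setIntegral_le_integral ((h1.const_mul a).add (h2.const_mul b))
      (ae_of_all _ fun t => by positivity)
  have e3 : ∫ _ in (0 : ℝ)..T, c = c * T := by simp [mul_comm]
  rw [e3]
  nlinarith [mul_nonneg hb n1, mul_nonneg ha n2]

/-! ### Second order expansion of one term. -/

/-- The character `x ↦ e^{ix}`. -/
noncomputable def expI (x : ℝ) : ℂ := Complex.exp (Complex.I * x)

lemma norm_expI (x : ℝ) : ‖expI x‖ = 1 := by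
  rw [expI, mul_comm, Complex.norm_exp_ofReal_mul_I]

lemma expI_add (x y : ℝ) : expI (x + y) = expI x * expI y := by
  rw [expI, expI, expI, ← Complex.exp_add]; push_cast; ring_nf

lemma expI_zero : expI 0 = 1 := by simp [expI]

lemma norm_expI_sub_one_le (x : ℝ) : ‖expI x - 1‖ ≤ |x| := Real.norm_exp_I_mul_ofReal_sub_one_le

lemma norm_expI_sub_one_le_two (x : ℝ) : ‖expI x - 1‖ ≤ 2 := by
  have := norm_sub_le (expI x) 1
  rw [norm_expI, norm_one] at this
  linarith

lemma norm_expI_sub_one_sub_le (x : ℝ) : ‖expI x - 1 - Complex.I * x‖ ≤ 2 * x ^ 2 := by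
  have hn : ‖Complex.I * (x : ℂ)‖ = |x| := by simp
  rcases le_total |x| 1 with h | h
  · have := Complex.norm_exp_sub_one_sub_id_le (hn.trans_le h)
    rw [hn, sq_abs] at this
    exact this.trans (by nlinarith [sq_nonneg x])
  · have h1 := norm_sub_le (expI x - 1) (Complex.I * x)
    rw [hn] at h1
    have h2 := norm_expI_sub_one_le x
    have h3 : |x| ≤ x ^ 2 := by rw [← sq_abs]; nlinarith
    linarith

@[fun_prop] lemma continuous_expI : Continuous expI := by unfold expI; fun_prop

@[fun_prop] lemma measurable_expI : Measurable expI := continuous_expI.measurable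

section Core
variable {Ω : Type*} [MeasurableSpace Ω] {μ : Measure Ω} [IsProbabilityMeasure μ]

lemma Measurable.integrable_of_norm_le {E : Type*} [NormedAddCommGroup E] [MeasurableSpace E]
    [BorelSpace E] [SecondCountableTopology E] {V : Ω → E} (hV : Measurable V) {v : ℝ}
    (hVb : ∀ ω, ‖V ω‖ ≤ v) : Integrable V μ :=
  Integrable.of_bound hV.aestronglyMeasurable v (ae_of_all _ hVb)

/-- Second order expansion of `E[Y e^{iS}]` for `S = η + ζ + F`, when `Y` is nearly uncorrelated with
`e^{i(ζ + F)}` and `(Y, η)` nearly uncorrelated with `e^{iF}`. -/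
lemma norm_integral_mul_expI_sub_le {Y η ζ F : Ω → ℝ} (hY : Measurable Y) (hη : Measurable η)
    (hζ : Measurable ζ) (hF : Measurable F) {B : ℝ} (hYb : ∀ ω, |Y ω| ≤ B)
    (hηb : ∀ ω, |η ω| ≤ B) (hζb : ∀ ω, |ζ ω| ≤ B) {e₁ e₂ : ℝ}
    (h₁ : ‖∫ ω, (Y ω : ℂ) * expI (ζ ω + F ω) ∂μ‖ ≤ e₁)
    (h₂ : ‖∫ ω, ((Y ω : ℂ) * (expI (η ω) - 1)) * expI (F ω) ∂μ
      - (∫ ω, (Y ω : ℂ) * (expI (η ω) - 1) ∂μ) * ∫ ω, expI (F ω) ∂μ‖ ≤ e₂) :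
    ‖∫ ω, (Y ω : ℂ) * expI (η ω + (ζ ω + F ω)) ∂μ
      - Complex.I * (∫ ω, Y ω * η ω ∂μ : ℝ) * ∫ ω, expI (η ω + (ζ ω + F ω)) ∂μ‖
      ≤ 2 * (∫ ω, |Y ω| * η ω ^ 2 ∂μ) * ‖∫ ω, expI (η ω + (ζ ω + F ω)) ∂μ‖
        + (∫ ω, |Y ω * η ω| ∂μ) * (∫ ω, |η ω + ζ ω| ∂μ)
        + (∫ ω, |Y ω| * |η ω| * |ζ ω| ∂μ) + e₁ + e₂ := by
  have hB : 0 ≤ B := nonneg_of_forall_norm_le μ (V := Y) hYb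
  set φ := ∫ ω, expI (η ω + (ζ ω + F ω)) ∂μ with hφ
  set ψ := ∫ ω, expI (F ω) ∂μ with hψ
  have i1 : Integrable (fun ω => (Y ω : ℂ) * expI (ζ ω + F ω)) μ :=
    Measurable.integrable_of_norm_le (by fun_prop) (v := B) fun ω => by
      rw [norm_mul, norm_expI, Complex.norm_real, mul_one]; exact hYb ω
  have i2 : Integrable (fun ω => ((Y ω : ℂ) * (expI (η ω) - 1)) * expI (F ω)) μ :=
    Measurable.integrable_of_norm_le (by fun_prop) (v := B * 2) fun ω => by
      rw [norm_mul, norm_mul, norm_expI, Complex.norm_real, mul_one]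
      exact mul_le_mul (hYb ω) (norm_expI_sub_one_le_two _) (norm_nonneg _) hB
  have i3 : Integrable (fun ω => ((Y ω : ℂ) * (expI (η ω) - 1)) * (expI (ζ ω) - 1) * expI (F ω)) μ :=
    Measurable.integrable_of_norm_le (by fun_prop) (v := B * 2 * 2) fun ω => by
      rw [norm_mul, norm_mul, norm_mul, norm_expI, Complex.norm_real, mul_one]
      exact mul_le_mul (mul_le_mul (hYb ω) (norm_expI_sub_one_le_two _) (norm_nonneg _) hB)
        (norm_expI_sub_one_le_two _) (norm_nonneg _) (by positivity)
  have i4 : Integrable (fun ω => (Y ω : ℂ) * (expI (η ω) - 1)) μ :=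
    Measurable.integrable_of_norm_le (by fun_prop) (v := B * 2) fun ω => by
      rw [norm_mul, Complex.norm_real]
      exact mul_le_mul (hYb ω) (norm_expI_sub_one_le_two _) (norm_nonneg _) hB
  have i5 : Integrable (fun ω => Y ω * η ω) μ :=
    Measurable.integrable_of_norm_le (by fun_prop) (v := B * B) fun ω => by
      rw [norm_mul]; exact mul_le_mul (hYb ω) (hηb ω) (norm_nonneg _) hB
  have i6 : Integrable (fun ω => expI (η ω + (ζ ω + F ω))) μ :=
    Measurable.integrable_of_norm_le (by fun_prop) (v := 1) fun ω => (norm_expI _).le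
  have i7 : Integrable (fun ω => expI (F ω)) μ :=
    Measurable.integrable_of_norm_le (by fun_prop) (v := 1) fun ω => (norm_expI _).le
  -- The telescoping `e^{i(η+ζ+F)} = e^{i(ζ+F)} + (e^{iη}-1) e^{iF} + (e^{iη}-1)(e^{iζ}-1) e^{iF}`:
  -- the first two terms decouple by mixing, the third is small by absolute moments.
  have d1 : ∫ ω, (Y ω : ℂ) * expI (η ω + (ζ ω + F ω)) ∂μ = (∫ ω, (Y ω : ℂ) * expI (ζ ω + F ω) ∂μ)
      + (∫ ω, ((Y ω : ℂ) * (expI (η ω) - 1)) * expI (F ω) ∂μ)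
      + ∫ ω, ((Y ω : ℂ) * (expI (η ω) - 1)) * (expI (ζ ω) - 1) * expI (F ω) ∂μ := by
    have i12 : Integrable (fun ω => (Y ω : ℂ) * expI (ζ ω + F ω)
        + ((Y ω : ℂ) * (expI (η ω) - 1)) * expI (F ω)) μ := i1.add i2
    rw [← integral_add i1 i2, ← integral_add i12 i3]
    congr 1; ext ω
    simp only [expI_add]; ring
  have d2 : (∫ ω, (Y ω : ℂ) * (expI (η ω) - 1) ∂μ)
      = (∫ ω, (Y ω : ℂ) * (expI (η ω) - 1 - Complex.I * η ω) ∂μ)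
        + Complex.I * (∫ ω, Y ω * η ω ∂μ : ℝ) := by
    have i5c : Integrable (fun ω => Complex.I * ((Y ω * η ω : ℝ) : ℂ)) μ :=
      Integrable.const_mul (Integrable.ofReal (𝕜 := ℂ) i5) Complex.I
    rw [← integral_complex_ofReal, ← integral_const_mul, ← integral_add]
    · congr 1; ext ω; push_cast; ring
    · refine (i4.sub i5c).congr (ae_of_all _ fun ω => ?_)
      simp only [Pi.sub_apply]; push_cast; ring
    · exact i5c
  have b3 : ‖∫ ω, ((Y ω : ℂ) * (expI (η ω) - 1)) * (expI (ζ ω) - 1) * expI (F ω) ∂μ‖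
      ≤ ∫ ω, |Y ω| * |η ω| * |ζ ω| ∂μ := by
    refine norm_integral_le_of_norm_le (Measurable.integrable_of_norm_le (by fun_prop)
      (v := B * B * B) fun ω => ?_) (ae_of_all _ fun ω => ?_)
    · have := hYb ω; have := hηb ω; have := hζb ω
      simp only [norm_mul, Real.norm_eq_abs, abs_abs]
      gcongr
    · rw [norm_mul, norm_mul, norm_mul, norm_expI, Complex.norm_real, mul_one, Real.norm_eq_abs]
      have := norm_expI_sub_one_le (η ω); have := norm_expI_sub_one_le (ζ ω)
      gcongr
  have b4 : ‖∫ ω, (Y ω : ℂ) * (expI (η ω) - 1 - Complex.I * η ω) ∂μ‖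
      ≤ 2 * ∫ ω, |Y ω| * η ω ^ 2 ∂μ := by
    rw [← integral_const_mul]
    refine norm_integral_le_of_norm_le ((Measurable.integrable_of_norm_le (by fun_prop)
      (v := B * B ^ 2) fun ω => ?_).const_mul 2) (ae_of_all _ fun ω => ?_)
    · have := hYb ω; have := hηb ω
      simp only [norm_mul, norm_pow, Real.norm_eq_abs, abs_abs]
      gcongr
    · rw [norm_mul, Complex.norm_real, Real.norm_eq_abs]
      have := mul_le_mul_of_nonneg_left (norm_expI_sub_one_sub_le (η ω)) (abs_nonneg (Y ω))
      linarith
  have b5 : ‖∫ ω, (Y ω : ℂ) * (expI (η ω) - 1) ∂μ‖ ≤ ∫ ω, |Y ω * η ω| ∂μ := by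
    refine norm_integral_le_of_norm_le i5.abs (ae_of_all _ fun ω => ?_)
    rw [norm_mul, Complex.norm_real, Real.norm_eq_abs, abs_mul]
    exact mul_le_mul_of_nonneg_left (norm_expI_sub_one_le _) (abs_nonneg _)
  -- Returning from `ψ` to `φ` makes the main term and the third-order error multiples of `φ`
  -- itself, as the differential inequality requires.
  have b6 : ‖ψ - φ‖ ≤ ∫ ω, |η ω + ζ ω| ∂μ := by
    rw [← norm_neg, neg_sub, hφ, hψ, ← integral_sub i6 i7]
    refine norm_integral_le_of_norm_le (Measurable.integrable_of_norm_le (by fun_prop)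
      (v := B + B) fun ω => ?_) (ae_of_all _ fun ω => ?_)
    · rw [Real.norm_eq_abs, abs_abs]; exact (abs_add_le _ _).trans (add_le_add (hηb ω) (hζb ω))
    · have : expI (η ω + (ζ ω + F ω)) - expI (F ω) = (expI (η ω + ζ ω) - 1) * expI (F ω) := by
        rw [← add_assoc, expI_add]; ring
      rw [this, norm_mul, norm_expI, mul_one]
      exact norm_expI_sub_one_le _
  have e : ∫ ω, (Y ω : ℂ) * expI (η ω + (ζ ω + F ω)) ∂μ - Complex.I * (∫ ω, Y ω * η ω ∂μ : ℝ) * φ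
      = (∫ ω, (Y ω : ℂ) * (expI (η ω) - 1 - Complex.I * η ω) ∂μ) * φ
        + (∫ ω, (Y ω : ℂ) * (expI (η ω) - 1) ∂μ) * (ψ - φ)
        + (∫ ω, ((Y ω : ℂ) * (expI (η ω) - 1)) * (expI (ζ ω) - 1) * expI (F ω) ∂μ)
        + (∫ ω, (Y ω : ℂ) * expI (ζ ω + F ω) ∂μ)
        + ((∫ ω, ((Y ω : ℂ) * (expI (η ω) - 1)) * expI (F ω) ∂μ)
          - (∫ ω, (Y ω : ℂ) * (expI (η ω) - 1) ∂μ) * ψ) := by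
    rw [d1, d2]; ring
  rw [e]
  refine (norm_add_le _ _).trans (add_le_add ((norm_add_le _ _).trans (add_le_add
    ((norm_add_le _ _).trans (add_le_add ((norm_add_le _ _).trans (add_le_add ?_ ?_)) b3)) h₁)) h₂)
  · rw [norm_mul]; gcongr
  · rw [norm_mul]; gcongr

end Core

/-! ### Blocks of near and far indices. -/

/-- The indices in `{1, …, n}` at distance at most `r` from `i`. -/
def nearIndices (n : ℕ) (i : ℤ) (r : ℕ) : Finset ℕ :=
  (Finset.Icc 1 n).filter fun j => |(j : ℤ) - i| ≤ r

/-- The indices in `{1, …, n}` at distance more than `r` from `i`. -/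
def farIndices (n : ℕ) (i : ℤ) (r : ℕ) : Finset ℕ :=
  (Finset.Icc 1 n).filter fun j => ¬ |(j : ℤ) - i| ≤ r

lemma sum_nearIndices_add_sum_farIndices (n : ℕ) (i : ℤ) (r : ℕ) (y : ℕ → ℝ) :
    ∑ j ∈ nearIndices n i r, y j + ∑ j ∈ farIndices n i r, y j = ∑ j ∈ Finset.Icc 1 n, y j :=
  Finset.sum_filter_add_sum_filter_not _ _ _

lemma nearIndices_mono (n : ℕ) (i : ℤ) {r s : ℕ} (h : r ≤ s) :
    nearIndices n i r ⊆ nearIndices n i s := by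
  intro j hj
  simp only [nearIndices, Finset.mem_filter] at hj ⊢
  exact ⟨hj.1, hj.2.trans (by exact_mod_cast h)⟩

lemma sum_farIndices_eq (n : ℕ) (i : ℤ) {r s : ℕ} (h : r ≤ s) (y : ℕ → ℝ) :
    ∑ j ∈ farIndices n i r, y j
      = ∑ j ∈ nearIndices n i s \ nearIndices n i r, y j + ∑ j ∈ farIndices n i s, y j := by
  have h1 := sum_nearIndices_add_sum_farIndices n i r y
  have h2 := sum_nearIndices_add_sum_farIndices n i s y
  have h3 := Finset.sum_sdiff (f := y) (nearIndices_mono n i h)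
  linarith

lemma card_nearIndices_le (n : ℕ) (i : ℤ) (r : ℕ) : (nearIndices n i r).card ≤ 2 * r + 1 := by
  have h : (nearIndices n i r).card ≤ (Finset.Icc (i - r) (i + r)).card := by
    refine Finset.card_le_card_of_injOn (fun j : ℕ => (j : ℤ)) ?_ Nat.cast_injective.injOn
    intro j hj
    simp only [nearIndices, Finset.coe_filter, Set.mem_ofPred_eq, abs_le] at hj
    simp only [Finset.coe_Icc, Set.mem_Icc]
    omega
  rw [Int.card_Icc] at h
  omega

lemma mem_nearIndices_self {n i : ℕ} (hi : i ∈ Finset.Icc 1 n) (r : ℕ) : i ∈ nearIndices n i r := by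
  simp [nearIndices, Finset.mem_filter, hi, -Finset.mem_Icc]

lemma abs_sum_le_card_mul {Ω : Type*} {X : ℤ → Ω → ℝ} {G : ℝ → ℝ} {B : ℝ} (hGb : ∀ x, |G x| ≤ B) (s : Finset ℕ) (ω : Ω) :
    |∑ j ∈ s, G (X j ω)| ≤ s.card * B :=
  (Finset.abs_sum_le_sum_abs _ _).trans
    ((Finset.sum_le_card_nsmul _ _ B fun _ _ => hGb _).trans_eq (nsmul_eq_mul _ _))

section WeakDependence
variable {Ω : Type*} [MeasurableSpace Ω] {μ : Measure Ω} [IsProbabilityMeasure μ] {X : ℤ → Ω → ℝ}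

/-- A function of the process near time `i` is nearly uncorrelated with the character of a sum over
times far from `i`. -/
lemma norm_integral_mul_expI_farIndices_sub_le (hX : ∀ i, Measurable (X i)) {G : ℝ → ℝ}
    (hG : Measurable G) (n : ℕ) (i : ℤ) (r m : ℕ) (τ : ℝ) {U : Ω → ℂ}
    (hU : Measurable[futureSigma X (i - r)] U) (hU' : Measurable[pastSigma X (i + r)] U) {u : ℝ}
    (hUb : ∀ ω, ‖U ω‖ ≤ u) :
    ‖∫ ω, U ω * expI (τ * ∑ j ∈ farIndices n i (r + m), G (X j ω)) ∂μ
      - (∫ ω, U ω ∂μ) * ∫ ω, expI (τ * ∑ j ∈ farIndices n i (r + m), G (X j ω)) ∂μ‖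
      ≤ 48 * alphaMixing μ X m * u := by
  set P := (farIndices n i (r + m)).filter fun j : ℕ => (j : ℤ) < i
  set F := (farIndices n i (r + m)).filter fun j : ℕ => ¬ (j : ℤ) < i
  have hPm : ∀ j ∈ P, (j : ℤ) ≤ i - r - m := by
    intro j hj
    simp only [P, farIndices, Finset.mem_filter, abs_le] at hj
    push_cast at hj
    omega
  have hFm : ∀ j ∈ F, i + r + m ≤ (j : ℤ) := by
    intro j hj
    simp only [F, farIndices, Finset.mem_filter, abs_le] at hj
    push_cast at hj
    omega
  have hpast : ∀ k : ℤ, i - r - m ≤ k →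
      Measurable[pastSigma X k] fun ω => expI (τ * ∑ j ∈ P, G (X j ω)) := by
    intro k hk
    refine measurable_expI.comp (measurable_const.mul (Finset.measurable_sum _ fun j hj => ?_))
    exact hG.comp (measurable_pastSigma ((hPm j hj).trans hk))
  have hfut : ∀ k : ℤ, k ≤ i + r + m →
      Measurable[futureSigma X k] fun ω => expI (τ * ∑ j ∈ F, G (X j ω)) := by
    intro k hk
    refine measurable_expI.comp (measurable_const.mul (Finset.measurable_sum _ fun j hj => ?_))
    exact hG.comp (measurable_futureSigma (hk.trans (hFm j hj)))
  -- The far indices lie on both sides of `i`, so the character of their sum is a past factor times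
  -- a future factor.
  have e : ∀ ω, expI (τ * ∑ j ∈ farIndices n i (r + m), G (X j ω))
      = expI (τ * ∑ j ∈ P, G (X j ω)) * expI (τ * ∑ j ∈ F, G (X j ω)) := by
    intro ω
    rw [← expI_add, ← mul_add, Finset.sum_filter_add_sum_filter_not]
  simp_rw [e]
  have hk : i - r - m + m = i - (r : ℤ) := by ring
  exact norm_integral_past_mul_present_mul_future_sub_le (μ := μ) hX (k := i - r - m) (l := i + r)
    (t := m) (hpast _ le_rfl) (hpast _ (by omega)) (by rw [hk]; exact hU) hU'
    (hfut _ (by omega)) (hfut _ le_rfl) (fun ω => (norm_expI _).le) hUb (fun ω => (norm_expI _).le)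

/-- Expansion of one term of the derivative of the characteristic function of the partial sum. -/
lemma norm_integral_mul_expI_sum_sub_le (hX : ∀ i, Measurable (X i)) {G : ℝ → ℝ}
    (hG : Measurable G) {B : ℝ} (hGb : ∀ x, |G x| ≤ B) {n i : ℕ} (m : ℕ) (τ : ℝ)
    (hmean : ∫ ω, G (X i ω) ∂μ = 0) :
    ‖∫ ω, (G (X i ω) : ℂ) * expI (τ * ∑ j ∈ Finset.Icc 1 n, G (X j ω)) ∂μ
      - Complex.I * τ * (∑ j ∈ nearIndices n i m, ∫ ω, G (X i ω) * G (X j ω) ∂μ : ℝ)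
        * ∫ ω, expI (τ * ∑ j ∈ Finset.Icc 1 n, G (X j ω)) ∂μ‖
      ≤ 2 * τ ^ 2 * (∑ j ∈ nearIndices n i m, ∑ k ∈ nearIndices n i m,
            ∫ ω, |G (X i ω)| * |G (X j ω)| * |G (X k ω)| ∂μ)
          * ‖∫ ω, expI (τ * ∑ j ∈ Finset.Icc 1 n, G (X j ω)) ∂μ‖
        + τ ^ 2 * (∑ j ∈ nearIndices n i m, ∫ ω, |G (X i ω)| * |G (X j ω)| ∂μ)
          * (∑ j ∈ nearIndices n i (m + m), ∫ ω, |G (X j ω)| ∂μ)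
        + τ ^ 2 * (∑ j ∈ nearIndices n i m, ∑ k ∈ nearIndices n i (m + m) \ nearIndices n i m,
            ∫ ω, |G (X i ω)| * |G (X j ω)| * |G (X k ω)| ∂μ)
        + 144 * alphaMixing μ X m * B := by
  have hB : 0 ≤ B := (abs_nonneg _).trans (hGb 0)
  have hGm : ∀ j : ℕ, Measurable fun ω => G (X j ω) := fun j => hG.comp (hX _)
  set N := nearIndices n i m
  set N' := nearIndices n i (m + m) \ nearIndices n i m
  set R := farIndices n i (m + m)
  set η : Ω → ℝ := fun ω => τ * ∑ j ∈ N, G (X j ω) with hη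
  set ζ : Ω → ℝ := fun ω => τ * ∑ j ∈ N', G (X j ω) with hζ
  set F : Ω → ℝ := fun ω => τ * ∑ j ∈ R, G (X j ω) with hF
  have hfar : ∀ ω, ζ ω + F ω = τ * ∑ j ∈ farIndices n i m, G (X j ω) := fun ω => by
    simp only [hζ, hF, N', R]
    rw [← mul_add, ← sum_farIndices_eq n i (by omega : m ≤ m + m) (fun j => G (X j ω))]
  have htot : ∀ ω, τ * ∑ j ∈ Finset.Icc 1 n, G (X j ω) = η ω + (ζ ω + F ω) := fun ω => by
    rw [hfar]; simp only [hη, N]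
    rw [← mul_add, sum_nearIndices_add_sum_farIndices n i m (fun j => G (X j ω))]
  have hsum : ∀ ω, η ω + ζ ω = τ * ∑ j ∈ nearIndices n i (m + m), G (X j ω) := fun ω => by
    simp only [hη, hζ, N, N']
    rw [← mul_add, add_comm, Finset.sum_sdiff (nearIndices_mono n i (by omega : m ≤ m + m))]
  have hηm : Measurable η := measurable_const.mul (Finset.measurable_sum _ fun j _ => hGm j)
  have hζm : Measurable ζ := measurable_const.mul (Finset.measurable_sum _ fun j _ => hGm j)
  have hFm : Measurable F := measurable_const.mul (Finset.measurable_sum _ fun j _ => hGm j)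
  -- A crude common bound that serves integrability only; it does not enter the estimate.
  set B' := B + |τ| * (N.card * B) + |τ| * (N'.card * B) with hB'
  have p1 : 0 ≤ |τ| * (N.card * B) := by positivity
  have p2 : 0 ≤ |τ| * (N'.card * B) := by positivity
  have bη : ∀ ω, |η ω| ≤ B' := fun ω => by
    have := mul_le_mul_of_nonneg_left (abs_sum_le_card_mul (X := X) hGb N ω) (abs_nonneg τ)
    simp only [hη, abs_mul]; linarith
  have bζ : ∀ ω, |ζ ω| ≤ B' := fun ω => by
    have := mul_le_mul_of_nonneg_left (abs_sum_le_card_mul (X := X) hGb N' ω) (abs_nonneg τ)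
    simp only [hζ, abs_mul]; linarith
  have bY : ∀ ω, |G (X i ω)| ≤ B' := fun ω => by have := hGb (X i ω); linarith
  -- Here the block is the single time `i`, that is `r = 0`, and the product of means vanishes by
  -- centring.
  have h₁ : ‖∫ ω, (G (X i ω) : ℂ) * expI (ζ ω + F ω) ∂μ‖ ≤ 48 * alphaMixing μ X m * B := by
    have := norm_integral_mul_expI_farIndices_sub_le (μ := μ) hX hG n i 0 m τ
      (U := fun ω => (G (X i ω) : ℂ))
      (Complex.measurable_ofReal.comp (hG.comp (measurable_futureSigma (by simp))))
      (Complex.measurable_ofReal.comp (hG.comp (measurable_pastSigma (by simp))))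
      (u := B) (fun ω => by rw [Complex.norm_real]; exact hGb _)
    rw [integral_complex_ofReal, hmean] at this
    simp_rw [zero_add, ← hfar] at this
    simpa using this
  have mη : ∀ (M : MeasurableSpace Ω), (∀ j ∈ N, Measurable[M] (X j)) → Measurable[M] (X i) →
      Measurable[M] fun ω => (G (X i ω) : ℂ) * (expI (η ω) - 1) := by
    intro M hM hMi
    refine (Complex.measurable_ofReal.comp (hG.comp hMi)).mul ((measurable_expI.comp
      (measurable_const.mul (Finset.measurable_sum _ fun j hj => hG.comp (hM j hj)))).sub_const 1)
  have hNm : ∀ j ∈ N, (i : ℤ) - m ≤ j ∧ (j : ℤ) ≤ i + m := by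
    intro j hj
    simp only [N, nearIndices, Finset.mem_filter, abs_le] at hj
    omega
  -- The middle block has radius `m` and the far sum starts after `2m`, which leaves a gap `m`. The
  -- bound `2B` gives `96 α B`, so the total is `(48 + 96) α B`.
  have h₂ : ‖∫ ω, ((G (X i ω) : ℂ) * (expI (η ω) - 1)) * expI (F ω) ∂μ
      - (∫ ω, (G (X i ω) : ℂ) * (expI (η ω) - 1) ∂μ) * ∫ ω, expI (F ω) ∂μ‖
      ≤ 48 * alphaMixing μ X m * (B * 2) :=
    norm_integral_mul_expI_farIndices_sub_le (μ := μ) hX hG n i m m τ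
      (mη _ (fun j hj => measurable_futureSigma (hNm j hj).1) (measurable_futureSigma (by omega)))
      (mη _ (fun j hj => measurable_pastSigma (hNm j hj).2) (measurable_pastSigma (by omega)))
      (fun ω => by
        rw [norm_mul, Complex.norm_real]
        exact mul_le_mul (hGb _) (norm_expI_sub_one_le_two _) (norm_nonneg _) hB)
  have core := norm_integral_mul_expI_sub_le (μ := μ) (hGm i) hηm hζm hFm bY bη bζ h₁ h₂
  simp_rw [← htot, hsum] at core
  have int1 : ∀ j : ℕ, Integrable (fun ω => |G (X j ω)|) μ := fun j =>
    Measurable.integrable_of_norm_le (by have := hGm j; fun_prop) (v := B) fun ω => by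
      rw [Real.norm_eq_abs, abs_abs]; exact hGb _
  have int2 : ∀ j : ℕ, Integrable (fun ω => G (X i ω) * G (X j ω)) μ := fun j =>
    Measurable.integrable_of_norm_le (by have := hGm j; have := hGm i; fun_prop) (v := B * B)
      fun ω => by
        rw [norm_mul]; exact mul_le_mul (hGb _) (hGb _) (norm_nonneg _) hB
  have int2' : ∀ j : ℕ, Integrable (fun ω => |G (X i ω)| * |G (X j ω)|) μ := fun j => by
    simpa only [abs_mul] using (int2 j).abs
  have int3 : ∀ j k : ℕ, Integrable (fun ω => |G (X i ω)| * |G (X j ω)| * |G (X k ω)|) μ :=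
    fun j k => Measurable.integrable_of_norm_le
      (by have := hGm j; have := hGm i; have := hGm k; fun_prop) (v := B * B * B) fun ω => by
        simp only [norm_mul, Real.norm_eq_abs, abs_abs]
        exact mul_le_mul (mul_le_mul (hGb _) (hGb _) (abs_nonneg _) hB) (hGb _) (abs_nonneg _)
          (by positivity)
  have q1 : ∫ ω, G (X i ω) * η ω ∂μ = τ * ∑ j ∈ N, ∫ ω, G (X i ω) * G (X j ω) ∂μ := by
    rw [← integral_finsetSum _ fun j _ => int2 j, ← integral_const_mul]
    congr 1; ext ω
    simp only [hη, Finset.mul_sum]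
    exact Finset.sum_congr rfl fun j _ => by ring
  have q2 : ∫ ω, |G (X i ω)| * η ω ^ 2 ∂μ ≤ τ ^ 2 * ∑ j ∈ N, ∑ k ∈ N,
      ∫ ω, |G (X i ω)| * |G (X j ω)| * |G (X k ω)| ∂μ := by
    simp_rw [← integral_finsetSum _ fun k _ => int3 _ k]
    rw [← integral_finsetSum _ fun j _ => integrable_finsetSum _ fun k _ => int3 j k,
      ← integral_const_mul]
    refine integral_mono_of_nonneg (ae_of_all _ fun ω => by positivity)
      ((integrable_finsetSum _ fun j _ => integrable_finsetSum _ fun k _ => int3 j k).const_mul _)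
      (ae_of_all _ fun ω => ?_)
    have a1 : |∑ j ∈ N, G (X j ω)| ≤ ∑ j ∈ N, |G (X j ω)| := Finset.abs_sum_le_sum_abs _ _
    have a2 : ∑ j ∈ N, ∑ k ∈ N, |G (X i ω)| * |G (X j ω)| * |G (X k ω)|
        = |G (X i ω)| * (∑ j ∈ N, |G (X j ω)|) ^ 2 := by
      simp_rw [mul_assoc, ← Finset.mul_sum, ← Finset.sum_mul]; ring
    simp only [hη]
    rw [a2, mul_pow, ← sq_abs (∑ j ∈ N, G (X j ω))]
    calc _ = τ ^ 2 * (|G (X i ω)| * |∑ j ∈ N, G (X j ω)| ^ 2) := by ring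
      _ ≤ _ := by gcongr
  have q3 : ∫ ω, |G (X i ω) * η ω| ∂μ
      ≤ |τ| * ∑ j ∈ N, ∫ ω, |G (X i ω)| * |G (X j ω)| ∂μ := by
    rw [← integral_finsetSum _ fun j _ => int2' j, ← integral_const_mul]
    refine integral_mono_of_nonneg (ae_of_all _ fun ω => by positivity)
      ((integrable_finsetSum _ fun j _ => int2' j).const_mul _) (ae_of_all _ fun ω => ?_)
    have a1 : |∑ j ∈ N, G (X j ω)| ≤ ∑ j ∈ N, |G (X j ω)| := Finset.abs_sum_le_sum_abs _ _
    simp only [hη, abs_mul, ← Finset.mul_sum]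
    calc _ = |τ| * (|G (X i ω)| * |∑ j ∈ N, G (X j ω)|) := by ring
      _ ≤ _ := by gcongr
  have q4 : ∫ ω, |τ * ∑ j ∈ nearIndices n i (m + m), G (X j ω)| ∂μ
      ≤ |τ| * ∑ j ∈ nearIndices n i (m + m), ∫ ω, |G (X j ω)| ∂μ := by
    rw [← integral_finsetSum _ fun j _ => int1 j, ← integral_const_mul]
    refine integral_mono_of_nonneg (ae_of_all _ fun ω => by positivity)
      ((integrable_finsetSum _ fun j _ => int1 j).const_mul _) (ae_of_all _ fun ω => ?_)
    simp only [abs_mul]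
    gcongr
    exact Finset.abs_sum_le_sum_abs _ _
  have q5 : ∫ ω, |G (X i ω)| * |η ω| * |ζ ω| ∂μ ≤ τ ^ 2 * ∑ j ∈ N, ∑ k ∈ N',
      ∫ ω, |G (X i ω)| * |G (X j ω)| * |G (X k ω)| ∂μ := by
    simp_rw [← integral_finsetSum _ fun k _ => int3 _ k]
    rw [← integral_finsetSum _ fun j _ => integrable_finsetSum _ fun k _ => int3 j k,
      ← integral_const_mul]
    refine integral_mono_of_nonneg (ae_of_all _ fun ω => by positivity)
      ((integrable_finsetSum _ fun j _ => integrable_finsetSum _ fun k _ => int3 j k).const_mul _)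
      (ae_of_all _ fun ω => ?_)
    have a1 : |∑ j ∈ N, G (X j ω)| ≤ ∑ j ∈ N, |G (X j ω)| := Finset.abs_sum_le_sum_abs _ _
    have a3 : |∑ j ∈ N', G (X j ω)| ≤ ∑ j ∈ N', |G (X j ω)| := Finset.abs_sum_le_sum_abs _ _
    have a2 : ∑ j ∈ N, ∑ k ∈ N', |G (X i ω)| * |G (X j ω)| * |G (X k ω)|
        = |G (X i ω)| * ((∑ j ∈ N, |G (X j ω)|) * ∑ j ∈ N', |G (X j ω)|) := by
      simp_rw [mul_assoc, ← Finset.mul_sum, ← Finset.sum_mul]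
    simp only [hη, hζ]
    rw [a2, abs_mul, abs_mul, ← sq_abs τ]
    calc _ = |τ| ^ 2 * (|G (X i ω)| * (|∑ j ∈ N, G (X j ω)| * |∑ j ∈ N', G (X j ω)|)) := by ring
      _ ≤ _ := by gcongr
  rw [q1] at core
  have q34 := mul_le_mul q3 q4 (integral_nonneg fun ω => abs_nonneg _)
    ((integral_nonneg fun ω => abs_nonneg _).trans q3)
  have q2' := mul_le_mul_of_nonneg_right q2
    (norm_nonneg (∫ ω, expI (τ * ∑ j ∈ Finset.Icc 1 n, G (X j ω)) ∂μ))
  have e : Complex.I * τ * (∑ j ∈ N, ∫ ω, G (X i ω) * G (X j ω) ∂μ : ℝ)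
      = Complex.I * (τ * ∑ j ∈ N, ∫ ω, G (X i ω) * G (X j ω) ∂μ : ℝ) := by
    push_cast; ring
  rw [e]
  refine core.trans ?_
  have e2 : |τ| * (∑ j ∈ N, ∫ ω, |G (X i ω)| * |G (X j ω)| ∂μ)
      * (|τ| * ∑ j ∈ nearIndices n i (m + m), ∫ ω, |G (X j ω)| ∂μ)
      = τ ^ 2 * (∑ j ∈ N, ∫ ω, |G (X i ω)| * |G (X j ω)| ∂μ)
          * (∑ j ∈ nearIndices n i (m + m), ∫ ω, |G (X j ω)| ∂μ) := by
    rw [← sq_abs τ]; ring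
  rw [e2] at q34
  linarith

end WeakDependence

/-! ### Sums over blocks of sparse variables. -/

section SparseMoments
variable {Ω : Type*} [MeasurableSpace Ω]

/-- Bounded variables `G (X i)` of size one on events of probability of order `h` that are jointly as
rare as independent ones, up to the third order. -/
structure SparseMoments (μ : Measure Ω) (X : ℤ → Ω → ℝ) (G : ℝ → ℝ) (A B h : ℝ) : Prop where
  bound : ∀ x, |G x| ≤ B
  first : ∀ i : ℤ, ∫ ω, |G (X i ω)| ∂μ ≤ A * h
  second : ∀ i j : ℤ, i ≠ j → ∫ ω, |G (X i ω)| * |G (X j ω)| ∂μ ≤ A * h ^ 2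
  third : ∀ i j k : ℤ, i ≠ j → i ≠ k → j ≠ k →
    ∫ ω, |G (X i ω)| * |G (X j ω)| * |G (X k ω)| ∂μ ≤ A * h ^ 3

variable {μ : Measure Ω} {X : ℤ → Ω → ℝ} {G : ℝ → ℝ} {A B h : ℝ}

/-- Only the diagonal term has order `h`; each of the at most `2m + 1 ≤ 3m` others has order `h²`.
-/
lemma SparseMoments.abs_sum_nearIndices_sub_le (hs : SparseMoments μ X G A B h)
    (hA : 0 ≤ A) {n i : ℕ} (hi : i ∈ Finset.Icc 1 n) {m : ℕ} (hm : 1 ≤ m) :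
    |∑ j ∈ nearIndices n i m, ∫ ω, G (X i ω) * G (X j ω) ∂μ - ∫ ω, G (X i ω) ^ 2 ∂μ|
      ≤ 3 * A * (m * h ^ 2) := by
  have hm' : (1 : ℝ) ≤ m := by exact_mod_cast hm
  rw [← Finset.add_sum_erase _ _ (mem_nearIndices_self hi m)]
  simp_rw [← sq]
  rw [add_sub_cancel_left]
  calc _ ≤ ∑ j ∈ (nearIndices n i m).erase i, |∫ ω, G (X i ω) * G (X j ω) ∂μ| :=
        Finset.abs_sum_le_sum_abs _ _
    _ ≤ ∑ j ∈ (nearIndices n i m).erase i, A * h ^ 2 := by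
        refine Finset.sum_le_sum fun j hj => ?_
        have := hs.second i j (by exact_mod_cast (Finset.ne_of_mem_erase hj).symm)
        refine le_trans (abs_integral_le_integral_abs.trans_eq ?_) this
        simp_rw [abs_mul]
    _ = ((nearIndices n i m).erase i).card * (A * h ^ 2) := by rw [Finset.sum_const, nsmul_eq_mul]
    _ ≤ (3 * m) * (A * h ^ 2) := by
        gcongr
        have h1 : ((nearIndices n i m).erase i).card ≤ 2 * m + 1 :=
          (Finset.card_le_card (Finset.erase_subset _ _)).trans (card_nearIndices_le n i m)
        have h2 : (((nearIndices n i m).erase i).card : ℝ) ≤ 2 * m + 1 := by exact_mod_cast h1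
        linarith
    _ = _ := by ring

variable [IsProbabilityMeasure μ]

lemma SparseMoments.integrable_mul (hs : SparseMoments μ X G A B h) (hX : ∀ i, Measurable (X i))
    (hG : Measurable G) (i j : ℤ) : Integrable (fun ω => |G (X i ω)| * |G (X j ω)|) μ :=
  Measurable.integrable_of_norm_le
    (by have := hG.comp (hX i); have := hG.comp (hX j); fun_prop) (v := B * B) fun ω => by
      have hB : 0 ≤ B := (abs_nonneg _).trans (hs.bound 0)
      simp only [norm_mul, Real.norm_eq_abs, abs_abs]
      exact mul_le_mul (hs.bound _) (hs.bound _) (abs_nonneg _) hB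

lemma SparseMoments.integrable_abs (hs : SparseMoments μ X G A B h) (hX : ∀ i, Measurable (X i))
    (hG : Measurable G) (i : ℤ) : Integrable (fun ω => |G (X i ω)|) μ :=
  Measurable.integrable_of_norm_le
    (by have := hG.comp (hX i); fun_prop) (v := B) fun ω => by
      simp only [Real.norm_eq_abs, abs_abs]; exact hs.bound _

/-- The factor `1_{j=i} + h` records that a new index costs `h` and a repeated one costs nothing, so
that sums over blocks need no case distinction. -/
lemma SparseMoments.integral_mul_le (hs : SparseMoments μ X G A B h) (hX : ∀ i, Measurable (X i))
    (hG : Measurable G) (hA : 0 ≤ A) (hh : 0 ≤ h) (i j : ℕ) :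
    ∫ ω, |G (X i ω)| * |G (X j ω)| ∂μ
      ≤ A * (1 + B + B ^ 2) * h * ((if j = i then 1 else 0) + h) := by
  have hB : 0 ≤ B := (abs_nonneg _).trans (hs.bound 0)
  have p1 : 0 ≤ A * h := by positivity
  have p2 : 0 ≤ A * h ^ 2 := by positivity
  by_cases hij : j = i
  · subst hij
    have : ∫ ω, |G (X j ω)| * |G (X j ω)| ∂μ ≤ B * ∫ ω, |G (X j ω)| ∂μ := by
      rw [← integral_const_mul]
      exact integral_mono (hs.integrable_mul hX hG j j) ((hs.integrable_abs hX hG j).const_mul B)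
        fun ω => mul_le_mul_of_nonneg_right (hs.bound _) (abs_nonneg _)
    have h1 := mul_le_mul_of_nonneg_left (hs.first j) hB
    rw [if_pos rfl]
    have : 0 ≤ A * h * B ^ 2 := by positivity
    have : 0 ≤ A * h ^ 2 * (1 + B + B ^ 2) := by positivity
    nlinarith
  · rw [if_neg hij]
    have := hs.second i j (by omega)
    have : 0 ≤ A * h ^ 2 * (B + B ^ 2) := by positivity
    nlinarith

/-- As for pairs: whenever two indices coincide, one factor is replaced by its bound `B` and a lower
moment remains. -/
lemma SparseMoments.integral_mul_mul_le (hs : SparseMoments μ X G A B h)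
    (hX : ∀ i, Measurable (X i)) (hG : Measurable G) (hA : 0 ≤ A) (hh : 0 ≤ h) (i j k : ℕ) :
    ∫ ω, |G (X i ω)| * |G (X j ω)| * |G (X k ω)| ∂μ
      ≤ A * (1 + B + B ^ 2) * h * ((if j = i then 1 else 0) + h)
        * ((if k = i then 1 else 0) + (if k = j then 1 else 0) + h) := by
  have hB : 0 ≤ B := (abs_nonneg _).trans (hs.bound 0)
  have p1 : 0 ≤ A * h := by positivity
  have p2 : 0 ≤ A * h ^ 2 := by positivity
  have p3 : 0 ≤ A * h ^ 3 := by positivity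
  have red : ∀ a b : ℕ, ∀ f : Ω → ℝ, (∀ ω, 0 ≤ f ω) →
      (∀ ω, f ω ≤ B * (|G (X a ω)| * |G (X b ω)|)) →
      ∫ ω, f ω ∂μ ≤ B * ∫ ω, |G (X a ω)| * |G (X b ω)| ∂μ := by
    intro a b f h0 h1
    rw [← integral_const_mul]
    exact integral_mono_of_nonneg (ae_of_all _ h0) ((hs.integrable_mul hX hG a b).const_mul B)
      (ae_of_all _ h1)
  have nn : ∀ ω, 0 ≤ |G (X i ω)| * |G (X j ω)| * |G (X k ω)| := fun ω => by positivity
  by_cases hji : j = i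
  · subst hji
    by_cases hkj : k = j
    · subst hkj
      have r1 := red k k _ nn fun ω => by
        have := mul_le_mul_of_nonneg_right (hs.bound (X k ω))
          (mul_nonneg (abs_nonneg (G (X k ω))) (abs_nonneg (G (X k ω))))
        linarith
      have r2 : ∫ ω, |G (X k ω)| * |G (X k ω)| ∂μ ≤ B * ∫ ω, |G (X k ω)| ∂μ := by
        rw [← integral_const_mul]
        exact integral_mono (hs.integrable_mul hX hG k k) ((hs.integrable_abs hX hG k).const_mul B)
          fun ω => mul_le_mul_of_nonneg_right (hs.bound _) (abs_nonneg _)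
      have r3 := mul_le_mul_of_nonneg_left (r2.trans (mul_le_mul_of_nonneg_left (hs.first k) hB)) hB
      simp only [if_true]
      calc _ ≤ B * (B * (A * h)) := r1.trans r3
        _ = A * B ^ 2 * h * 1 * 1 := by ring
        _ ≤ _ := by gcongr <;> nlinarith
    · have r1 := red j k _ nn fun ω => by
        have := mul_le_mul_of_nonneg_right (hs.bound (X j ω))
          (mul_nonneg (abs_nonneg (G (X j ω))) (abs_nonneg (G (X k ω))))
        linarith
      have r2 := mul_le_mul_of_nonneg_left (hs.second j k (by omega)) hB
      simp only [if_true, if_neg hkj]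
      calc _ ≤ B * (A * h ^ 2) := r1.trans r2
        _ = A * B * h * 1 * h := by ring
        _ ≤ _ := by gcongr <;> nlinarith
  · have hij : (i : ℤ) ≠ j := by omega
    by_cases hki : k = i
    · have r1 := red i j _ nn fun ω => by
        have := mul_le_mul_of_nonneg_left (hs.bound (X k ω))
          (mul_nonneg (abs_nonneg (G (X i ω))) (abs_nonneg (G (X j ω))))
        linarith
      have r2 := mul_le_mul_of_nonneg_left (hs.second i j hij) hB
      simp only [if_neg hji, if_pos hki]
      calc _ ≤ B * (A * h ^ 2) := r1.trans r2
        _ = A * B * h * h * 1 := by ring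
        _ ≤ _ := by
          have : (0 : ℝ) ≤ if k = j then 1 else 0 := by split_ifs <;> norm_num
          gcongr <;> nlinarith
    · by_cases hkj : k = j
      · have r1 := red i j _ nn fun ω => by
          have := mul_le_mul_of_nonneg_left (hs.bound (X k ω))
            (mul_nonneg (abs_nonneg (G (X i ω))) (abs_nonneg (G (X j ω))))
          linarith
        have r2 := mul_le_mul_of_nonneg_left (hs.second i j hij) hB
        simp only [if_neg hji, if_pos hkj, if_neg hki]
        calc _ ≤ B * (A * h ^ 2) := r1.trans r2
          _ = A * B * h * h * 1 := by ring
          _ ≤ _ := by gcongr <;> nlinarith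
      · have r1 := hs.third i j k hij (by omega)
          (by omega)
        simp only [if_neg hji, if_neg hkj, if_neg hki]
        calc _ ≤ A * h ^ 3 := r1
          _ = A * 1 * h * h * h := by ring
          _ ≤ _ := by gcongr <;> nlinarith

lemma sum_ite_eq_add_const_le (s : Finset ℕ) (i : ℕ) {h : ℝ} :
    ∑ j ∈ s, ((if j = i then 1 else 0) + h) ≤ 1 + s.card * h := by
  rw [Finset.sum_add_distrib, Finset.sum_ite_eq' s i, Finset.sum_const, nsmul_eq_mul]
  gcongr
  split_ifs <;> norm_num

/-- The differential inequality for one term, with all moments estimated. -/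
lemma SparseMoments.norm_integral_mul_expI_sum_sub_le (hs : SparseMoments μ X G A B h)
    (hX : ∀ i, Measurable (X i)) (hG : Measurable G) (hA : 0 ≤ A) (hh : 0 ≤ h) {D : ℝ}
    (hD : A * (1 + B + B ^ 2) ≤ D) {n i : ℕ} {m : ℕ} (hm : 1 ≤ m) (hmh : (2 * m + 1) * h ≤ 1) (τ : ℝ)
    (hmean : ∫ ω, G (X i ω) ∂μ = 0) :
    ‖∫ ω, (G (X i ω) : ℂ) * expI (τ * ∑ j ∈ Finset.Icc 1 n, G (X j ω)) ∂μ
      - Complex.I * τ * (∑ j ∈ nearIndices n i m, ∫ ω, G (X i ω) * G (X j ω) ∂μ : ℝ)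
        * ∫ ω, expI (τ * ∑ j ∈ Finset.Icc 1 n, G (X j ω)) ∂μ‖
      ≤ 12 * D * h * τ ^ 2 * ‖∫ ω, expI (τ * ∑ j ∈ Finset.Icc 1 n, G (X j ω)) ∂μ‖
        + 10 * D * (D + 1) * (m * h ^ 2) * τ ^ 2 + 144 * alphaMixing μ X m * B := by
  have hB : 0 ≤ B := (abs_nonneg _).trans (hs.bound 0)
  have hAD : A ≤ D := by
    have : 0 ≤ A * (B + B ^ 2) := by positivity
    nlinarith
  have hD0 : 0 ≤ D := hA.trans hAD
  have hm' : (1 : ℝ) ≤ m := by exact_mod_cast hm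
  refine (_root_.norm_integral_mul_expI_sum_sub_le hX hG hs.bound m τ hmean).trans ?_
  set N := nearIndices n i m
  set N' := nearIndices n i (m + m) \ N
  have hN : (N.card : ℝ) ≤ 2 * m + 1 := by exact_mod_cast card_nearIndices_le n i m
  have hN2 : ((nearIndices n i (m + m)).card : ℝ) ≤ 4 * m + 1 := by
    have := card_nearIndices_le n i (m + m)
    have h2 : ((nearIndices n i (m + m)).card : ℝ) ≤ (2 * (m + m) + 1 : ℕ) := by exact_mod_cast this
    push_cast at h2; linarith
  have hN' : (N'.card : ℝ) ≤ 4 * m + 1 :=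
    le_trans (by exact_mod_cast Finset.card_le_card Finset.sdiff_subset) hN2
  have hNh : (N.card : ℝ) * h ≤ 1 := le_trans (by gcongr) hmh
  have hite : ∀ i j : ℕ, (0 : ℝ) ≤ if j = i then 1 else 0 := fun i j => by split_ifs <;> norm_num
  have T2 := fun j => hs.integral_mul_le hX hG hA hh i j
  have T3 := fun j k => hs.integral_mul_mul_le hX hG hA hh i j k
  have s1 : ∑ j ∈ nearIndices n i (m + m), ∫ ω, |G (X j ω)| ∂μ ≤ 5 * m * D * h := by
    calc _ ≤ ∑ j ∈ nearIndices n i (m + m), A * h := Finset.sum_le_sum fun j _ => hs.first j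
      _ = (nearIndices n i (m + m)).card * (A * h) := by rw [Finset.sum_const, nsmul_eq_mul]
      _ ≤ (5 * m) * (D * h) := by gcongr; linarith
      _ = _ := by ring
  -- The block is short enough, `(2m+1) h ≤ 1`, for its off-diagonal part not to exceed the
  -- diagonal.
  have s0 : ∑ j ∈ N, ((if j = i then 1 else 0) + h) ≤ 2 :=
    (sum_ite_eq_add_const_le N i).trans (by linarith)
  have s2 : ∑ j ∈ N, ∫ ω, |G (X i ω)| * |G (X j ω)| ∂μ ≤ 2 * D * h := by
    calc _ ≤ ∑ j ∈ N, D * h * ((if j = i then 1 else 0) + h) :=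
          Finset.sum_le_sum fun j _ => (T2 j).trans (by have := hite i j; gcongr)
      _ = D * h * ∑ j ∈ N, ((if j = i then 1 else 0) + h) := by rw [Finset.mul_sum]
      _ ≤ D * h * 2 := by gcongr
      _ = _ := by ring
  -- Triple coincidences are allowed here, so only the order `h` is reached; this suffices because
  -- the term is multiplied by `|φ|`.
  have s3 : ∑ j ∈ N, ∑ k ∈ N, ∫ ω, |G (X i ω)| * |G (X j ω)| * |G (X k ω)| ∂μ ≤ 6 * D * h := by
    calc _ ≤ ∑ j ∈ N, D * h * ((if j = i then 1 else 0) + h) * 3 := by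
          refine Finset.sum_le_sum fun j _ => ?_
          calc _ ≤ ∑ k ∈ N, D * h * ((if j = i then 1 else 0) + h)
                * ((if k = i then 1 else 0) + ((if k = j then 1 else 0) + h)) := by
                refine Finset.sum_le_sum fun k _ => (T3 j k).trans ?_
                have := hite i j; have := hite i k; have := hite j k
                rw [← add_assoc]
                gcongr
            _ = D * h * ((if j = i then 1 else 0) + h) * ∑ k ∈ N,
                ((if k = i then 1 else 0) + ((if k = j then 1 else 0) + h)) := by
                rw [Finset.mul_sum]
            _ ≤ _ := by
                have := hite i j
                gcongr
                rw [Finset.sum_add_distrib, Finset.sum_ite_eq' N i]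
                have h1 := sum_ite_eq_add_const_le N j (h := h)
                have h2 : (if i ∈ N then (1 : ℝ) else 0) ≤ 1 := by split_ifs <;> norm_num
                linarith
      _ = D * h * 3 * ∑ j ∈ N, ((if j = i then 1 else 0) + h) := by
          rw [Finset.mul_sum]; exact Finset.sum_congr rfl fun j _ => by ring
      _ ≤ D * h * 3 * 2 := by gcongr
      _ = _ := by ring
  -- An index `k` of the outer annulus meets neither `i` nor `j`, so a factor `h` is always gained.
  -- This term is not damped by `|φ|` and needs the smaller order `m h²`.
  have s4 : ∑ j ∈ N, ∑ k ∈ N', ∫ ω, |G (X i ω)| * |G (X j ω)| * |G (X k ω)| ∂μ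
      ≤ 10 * D * (m * h ^ 2) := by
    calc _ ≤ ∑ j ∈ N, D * h * ((if j = i then 1 else 0) + h) * (5 * m * h) := by
          refine Finset.sum_le_sum fun j hj => ?_
          calc _ ≤ ∑ k ∈ N', D * h * ((if j = i then 1 else 0) + h) * h := by
                refine Finset.sum_le_sum fun k hk => (T3 j k).trans ?_
                have hkN : k ∉ N := (Finset.mem_sdiff.1 hk).2
                have hkj : k ≠ j := fun e => hkN (e ▸ hj)
                have hki : k ≠ i := fun e => by
                  refine hkN (e ▸ ?_)
                  have := (Finset.mem_sdiff.1 hk).1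
                  simp only [N, nearIndices, Finset.mem_filter] at this ⊢
                  rw [e] at this
                  exact ⟨this.1, by simp⟩
                rw [if_neg hkj, if_neg hki, zero_add, zero_add]
                have := hite i j
                gcongr
            _ = N'.card * (D * h * ((if j = i then 1 else 0) + h) * h) := by
                rw [Finset.sum_const, nsmul_eq_mul]
            _ ≤ (5 * m) * (D * h * ((if j = i then 1 else 0) + h) * h) := by
                have := hite i j
                gcongr
                linarith
            _ = _ := by ring
      _ = D * h * (5 * m * h) * ∑ j ∈ N, ((if j = i then 1 else 0) + h) := by
          rw [Finset.mul_sum]; exact Finset.sum_congr rfl fun j _ => by ring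
      _ ≤ D * h * (5 * m * h) * 2 := by gcongr
      _ = _ := by ring
  have n1 : 0 ≤ ∑ j ∈ nearIndices n i (m + m), ∫ ω, |G (X j ω)| ∂μ :=
    Finset.sum_nonneg fun j _ => integral_nonneg fun ω => abs_nonneg _
  calc _ ≤ 2 * τ ^ 2 * (6 * D * h) * ‖∫ ω, expI (τ * ∑ j ∈ Finset.Icc 1 n, G (X j ω)) ∂μ‖
        + τ ^ 2 * (2 * D * h) * (5 * m * D * h) + τ ^ 2 * (10 * D * (m * h ^ 2))
        + 144 * alphaMixing μ X m * B := by gcongr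
    _ = _ := by ring

end SparseMoments

/-! ### The differential inequality and the Berry–Esseen bound. -/

lemma hasDerivAt_expI_mul (w t : ℝ) :
    HasDerivAt (fun t : ℝ => expI (t * w)) (Complex.I * w * expI (t * w)) t := by
  unfold expI
  have h1 : HasDerivAt (fun t : ℝ => Complex.I * ((t * w : ℝ) : ℂ)) (Complex.I * w) t := by
    have h2 : HasDerivAt (fun t : ℝ => t * w) w t := by simpa using (hasDerivAt_id t).mul_const w
    exact h2.ofReal_comp.const_mul Complex.I
  exact h1.cexp.congr_deriv (by ring)

lemma charFun_map_eq_integral_expI {Ω : Type*} [MeasurableSpace Ω] {μ : Measure Ω} {W : Ω → ℝ} (hW : Measurable W) (t : ℝ) :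
    charFun (μ.map W) t = ∫ ω, expI (t * W ω) ∂μ := by
  rw [charFun_apply_real, integral_map hW.aemeasurable (by fun_prop)]
  congr 1; ext ω
  unfold expI
  push_cast; ring_nf

/-- The Lipschitz constant is the maximum of the density. It serves both as `L` in the smoothing
inequality and to move the argument by the bias remainder. -/
lemma cdf_gaussianReal_sub_le {v : NNReal} (hv : v ≠ 0) {x y : ℝ} (hxy : x ≤ y) :
    cdf (gaussianReal 0 v) y - cdf (gaussianReal 0 v) x ≤ (√(2 * Real.pi * v))⁻¹ * (y - x) := by
  have h1 : (gaussianReal 0 v).real (Set.Ioc x y)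
      = cdf (gaussianReal 0 v) y - cdf (gaussianReal 0 v) x := by
    rw [cdf_eq_real, cdf_eq_real, ← Set.Iic_sdiff_Iic,
      measureReal_sdiff (Set.Iic_subset_Iic.2 hxy) measurableSet_Iic]
  rw [← h1, Measure.real, gaussianReal_apply _ hv]
  have h2 : ∫⁻ z in Set.Ioc x y, gaussianPDF 0 v z
      ≤ ∫⁻ z in Set.Ioc x y, ENNReal.ofReal (√(2 * Real.pi * v))⁻¹ := by
    refine lintegral_mono fun z => ?_
    rw [gaussianPDF, gaussianPDFReal]
    refine ENNReal.ofReal_le_ofReal (mul_le_of_le_one_right (by positivity) ?_)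
    rw [Real.exp_le_one_iff]
    have : 0 ≤ (z - 0) ^ 2 / (2 * v) := by positivity
    rw [neg_div]; linarith
  rw [setLIntegral_const, Real.volume_Ioc, ← ENNReal.ofReal_mul (by positivity)] at h2
  exact ENNReal.toReal_le_of_le_ofReal (mul_nonneg (by positivity) (by linarith)) h2

section BerryEsseen
variable {Ω : Type*} [MeasurableSpace Ω] {μ : Measure Ω} [IsProbabilityMeasure μ]

lemma hasDerivAt_integral_expI_mul {W : Ω → ℝ} (hW : Measurable W) {M : ℝ} (hM : ∀ ω, |W ω| ≤ M)
    (t : ℝ) : HasDerivAt (fun t => ∫ ω, expI (t * W ω) ∂μ)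
      (∫ ω, Complex.I * W ω * expI (t * W ω) ∂μ) t := by
  refine (hasDerivAt_integral_of_dominated_loc_of_deriv_le (s := Set.univ) (bound := fun _ => M)
    univ_mem (Eventually.of_forall fun t => by fun_prop)
    (Measurable.integrable_of_norm_le (by fun_prop) (v := 1) fun ω => (norm_expI _).le)
    (by fun_prop) (ae_of_all _ fun ω t _ => ?_) (integrable_const _)
    (ae_of_all _ fun ω t _ => hasDerivAt_expI_mul _ _)).2
  rw [norm_mul, norm_mul, norm_expI, Complex.norm_I, one_mul, mul_one, Complex.norm_real]
  exact hM ω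

variable {X : ℤ → Ω → ℝ} {G : ℝ → ℝ} {A B h : ℝ}

/-- The characteristic function of the normalised sum nearly solves the differential equation of the
Gaussian one. -/
lemma SparseMoments.norm_deriv_charFun_add_le (hs : SparseMoments μ X G A B h)
    (hX : ∀ i, Measurable (X i)) (hG : Measurable G) (hA : 0 ≤ A) (hh : 0 < h) {D : ℝ}
    (hD : A * (1 + B + B ^ 2) ≤ D) {n : ℕ} (hn : 1 ≤ n) {m : ℕ} (hm : 1 ≤ m)
    (hmh : (2 * m + 1) * h ≤ 1) (hmean : ∀ i : ℤ, ∫ ω, G (X i ω) ∂μ = 0) {v w : ℝ}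
    (hvar : ∀ i : ℤ, ∫ ω, G (X i ω) ^ 2 ∂μ = w) {N : ℝ} (hN0 : 0 < N) (hN : N ^ 2 = n * h)
    {W : Ω → ℝ} (hW : ∀ ω, W ω = (∑ j ∈ Finset.Icc 1 n, G (X j ω)) / N) {t : ℝ} (ht : 0 ≤ t) :
    ‖∫ ω, Complex.I * W ω * expI (t * W ω) ∂μ + (v * t : ℝ) * ∫ ω, expI (t * W ω) ∂μ‖
      ≤ ((|v - w / h| + 3 * D * (m * h)) * t + 12 * D / N * t ^ 2) * ‖∫ ω, expI (t * W ω) ∂μ‖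
        + (10 * D * (D + 1) * (m * h) / N * t ^ 2 + 144 * alphaMixing μ X m * B * n / N) := by
  have hB : 0 ≤ B := (abs_nonneg _).trans (hs.bound 0)
  have hAD : A ≤ D := by
    have : 0 ≤ A * (B + B ^ 2) := by positivity
    nlinarith
  have hD0 : 0 ≤ D := hA.trans hAD
  have hn0 : (0 : ℝ) < n := by exact_mod_cast hn
  set τ := t / N with hτ
  have harg : ∀ ω, t * W ω = τ * ∑ j ∈ Finset.Icc 1 n, G (X j ω) := fun ω => by
    rw [hW, hτ]; ring
  set φ := ∫ ω, expI (t * W ω) ∂μ with hφ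
  have hφ' : ∫ ω, expI (τ * ∑ j ∈ Finset.Icc 1 n, G (X j ω)) ∂μ = φ := by
    simp_rw [← harg]; rfl
  set E : ℕ → ℂ := fun i => ∫ ω, (G (X i ω) : ℂ) * expI (τ * ∑ j ∈ Finset.Icc 1 n, G (X j ω)) ∂μ
  set V : ℕ → ℝ := fun i => ∑ j ∈ nearIndices n i m, ∫ ω, G (X i ω) * G (X j ω) ∂μ
  have hGm : ∀ j : ℕ, Measurable fun ω => G (X j ω) := fun j => hG.comp (hX _)
  have hSm : Measurable fun ω => ∑ j ∈ Finset.Icc 1 n, G (X j ω) :=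
    Finset.measurable_sum _ fun j _ => hGm j
  have hder : ∫ ω, Complex.I * W ω * expI (t * W ω) ∂μ
      = Complex.I / N * ∑ i ∈ Finset.Icc 1 n, E i := by
    simp only [E]
    rw [← integral_finsetSum, ← integral_const_mul]
    · congr 1; ext ω
      rw [harg, hW, ← Finset.sum_mul]
      push_cast
      ring
    · intro i _
      refine Measurable.integrable_of_norm_le (by have := hGm i; fun_prop) (v := B) fun ω => ?_
      rw [norm_mul, norm_expI, Complex.norm_real, mul_one]; exact hs.bound _
  set R : ℕ → ℂ := fun i => E i - Complex.I * τ * (V i : ℝ) * φ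
  have hR : ∀ i ∈ Finset.Icc 1 n, ‖R i‖ ≤ 12 * D * h * τ ^ 2 * ‖φ‖
      + 10 * D * (D + 1) * (m * h ^ 2) * τ ^ 2 + 144 * alphaMixing μ X m * B := by
    intro i _
    have := hs.norm_integral_mul_expI_sum_sub_le hX hG hA hh.le hD (n := n) (i := i) hm hmh τ
      (hmean i)
    rw [hφ'] at this
    exact this
  have hNc : (N : ℂ) ≠ 0 := by exact_mod_cast hN0.ne'
  -- With `τ = t/N` the main terms contribute `-(t/N²) ∑ V_i φ`, since `I² = -1`; the coefficient of
  -- `φ` is thus the defect of the blockwise variance from `v`.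
  have hdec : Complex.I / N * ∑ i ∈ Finset.Icc 1 n, E i + (v * t : ℝ) * φ
      = Complex.I / N * ∑ i ∈ Finset.Icc 1 n, R i
        + ((t * (v - (∑ i ∈ Finset.Icc 1 n, V i) / N ^ 2) : ℝ) : ℂ) * φ := by
    simp only [R]
    rw [Finset.sum_sub_distrib, ← Finset.sum_mul, ← Finset.mul_sum, mul_sub, hτ]
    push_cast
    field_simp
    ring_nf
    rw [Complex.I_sq]
    ring
  have hV : |v - (∑ i ∈ Finset.Icc 1 n, V i) / N ^ 2| ≤ |v - w / h| + 3 * D * (m * h) := by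
    have h1 : |(∑ i ∈ Finset.Icc 1 n, V i) - n * w| ≤ n * (3 * D * (m * h ^ 2)) := by
      have : (n : ℝ) * w = ∑ i ∈ Finset.Icc 1 n, w := by simp
      rw [this, ← Finset.sum_sub_distrib]
      calc _ ≤ ∑ i ∈ Finset.Icc 1 n, |V i - w| := Finset.abs_sum_le_sum_abs _ _
        _ ≤ ∑ i ∈ Finset.Icc 1 n, 3 * D * (m * h ^ 2) := by
            refine Finset.sum_le_sum fun i hi => ?_
            rw [← hvar i]
            refine (hs.abs_sum_nearIndices_sub_le hA hi hm).trans ?_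
            gcongr
        _ = _ := by simp
    have h2 : v - (∑ i ∈ Finset.Icc 1 n, V i) / N ^ 2
        = (v - w / h) - ((∑ i ∈ Finset.Icc 1 n, V i) - n * w) / (n * h) := by
      rw [hN]; field_simp; ring
    rw [h2]
    refine (abs_sub _ _).trans (add_le_add le_rfl ?_)
    rw [abs_div, abs_of_pos (by positivity : 0 < (n : ℝ) * h), div_le_iff₀ (by positivity)]
    calc _ ≤ n * (3 * D * (m * h ^ 2)) := h1
      _ = _ := by ring
  rw [hder, hdec]
  refine (norm_add_le _ _).trans ?_
  have b1 : ‖Complex.I / N * ∑ i ∈ Finset.Icc 1 n, R i‖ ≤ 1 / N * (n * (12 * D * h * τ ^ 2 * ‖φ‖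
      + 10 * D * (D + 1) * (m * h ^ 2) * τ ^ 2 + 144 * alphaMixing μ X m * B)) := by
    rw [norm_mul, norm_div, Complex.norm_I, Complex.norm_real, Real.norm_of_nonneg hN0.le]
    gcongr
    refine (norm_sum_le _ _).trans ((Finset.sum_le_card_nsmul _ _ _ hR).trans_eq ?_)
    simp only [Nat.card_Icc, add_tsub_cancel_right, nsmul_eq_mul]
  have b2 : ‖((t * (v - (∑ i ∈ Finset.Icc 1 n, V i) / N ^ 2) : ℝ) : ℂ) * φ‖
      ≤ t * (|v - w / h| + 3 * D * (m * h)) * ‖φ‖ := by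
    rw [norm_mul, Complex.norm_real, norm_mul, Real.norm_of_nonneg ht, Real.norm_eq_abs]
    gcongr
  have hnτ : (n : ℝ) * h * τ ^ 2 = t ^ 2 := by
    rw [← hN, hτ]; field_simp
  calc _ ≤ _ := add_le_add b1 b2
    _ = 1 / N * (12 * D * (n * h * τ ^ 2) * ‖φ‖ + 10 * D * (D + 1) * (m * h) * (n * h * τ ^ 2)
        + 144 * alphaMixing μ X m * B * n) + t * (|v - w / h| + 3 * D * (m * h)) * ‖φ‖ := by ring
    _ = _ := by rw [hnτ]; ring

/-- The Berry–Esseen bound for sums of sparse weakly dependent variables. -/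
theorem SparseMoments.exists_abs_cdf_sub_le (hX : ∀ i, Measurable (X i)) {v D : ℝ} (hv : 0 < v)
    (hD0 : 0 < D) : ∃ C : ℝ, 0 < C ∧ ∀ (G : ℝ → ℝ) (A B h w N : ℝ) (n m : ℕ),
      SparseMoments μ X G A B h → Measurable G → 0 ≤ A → 0 < h → A * (1 + B + B ^ 2) ≤ D →
      1 ≤ n → 1 ≤ m → (2 * m + 1) * h ≤ 1 → (∀ i : ℤ, ∫ ω, G (X i ω) ∂μ = 0) →
      (∀ i : ℤ, ∫ ω, G (X i ω) ^ 2 ∂μ = w) → 0 < N → N ^ 2 = n * h →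
      |v - w / h| + 3 * D * (m * h) ≤ v / 8 → ∀ x,
      |μ.real {ω | (∑ j ∈ Finset.Icc 1 n, G (X j ω)) / N ≤ x} - cdf (gaussianReal 0 v.toNNReal) x|
        ≤ C * (|v - w / h| + m * h + 1 / N + alphaMixing μ X m * B * n) := by
  obtain ⟨C₀, hC₀, smooth⟩ := exists_abs_cdf_sub_cdf_le
  obtain ⟨M, hM, hint⟩ := exists_integral_linear_add_sq_mul_exp_le hv
  set L := (√(2 * Real.pi * v.toNNReal))⁻¹ with hL
  have hL0 : 0 ≤ L := by positivity
  have hvN : v.toNNReal ≠ 0 := by simpa using hv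
  -- Chosen so that `b T = v/8` for `T = ρN` and `b = 12D/N`; together with `a ≤ v/8` this meets the
  -- smallness condition `a + bT ≤ v/4`.
  set ρ := v / (96 * D) with hρ
  have hρ0 : 0 < ρ := by positivity
  set C₁ := M + 3 * D * M + ρ * (20 * D * (D + 1) / v) + (12 * D * M + ρ + L / ρ) + 144 * ρ with hC₁
  have hC₁0 : 0 < C₁ := by positivity
  -- This constant is fixed before `G` and `h`, which will vary with `n`; among the quantities of
  -- the bound it involves only `v` and `D`.
  refine ⟨C₀ * C₁, by positivity, ?_⟩
  intro G A B h w N n m hs hG hA hh hD hn hm hmh hmean hvar hN0 hN hsmall x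
  have hB : 0 ≤ B := (abs_nonneg _).trans (hs.bound 0)
  have hα := alphaMixing_nonneg (μ := μ) (X := X) m
  set α := alphaMixing μ X m
  set W : Ω → ℝ := fun ω => (∑ j ∈ Finset.Icc 1 n, G (X j ω)) / N with hW
  have hWm : Measurable W :=
    (Finset.measurable_sum _ fun j _ => hG.comp (hX _)).div_const N
  have hWb : ∀ ω, |W ω| ≤ n * B / N := fun ω => by
    simp only [hW]
    rw [abs_div, abs_of_pos hN0]
    gcongr
    simpa using abs_sum_le_card_mul (X := X) hs.bound (Finset.Icc 1 n) ω
  set a := |v - w / h| + 3 * D * (m * h) with ha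
  set b := 12 * D / N with hb
  set κ := 10 * D * (D + 1) * (m * h) / N with hκ
  set ε := 144 * α * B * n / N with hε
  -- The summand `1/N²` only makes `ε < c` strict; over `[0, T]` it costs `ρ/N`.
  set c := ε + 2 * κ / v + 1 / N ^ 2 with hc
  set T := ρ * N with hT
  have ha0 : 0 ≤ a := by positivity
  have hb0 : 0 ≤ b := by positivity
  have hε0 : 0 ≤ ε := by positivity
  have hκ0 : 0 ≤ κ := by positivity
  have hT0 : 0 < T := by positivity
  have hbT : b * T = v / 8 := by rw [hb, hT, hρ]; field_simp; norm_num
  have hprob : IsProbabilityMeasure (μ.map W) := Measure.isProbabilityMeasure_map hWm.aemeasurable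
  have hcf : ∀ t, 0 < t → t ≤ T → ‖charFun (μ.map W) t - charFun (gaussianReal 0 v.toNNReal) t‖
      ≤ t * ((a * t + b * t ^ 2) * Real.exp (-(v / 4) * t ^ 2) + c) := by
    intro t ht htT
    have key := norm_sub_exp_le_of_norm_deriv_add_le (κ := κ) (c := c) (T := T)
      (hasDerivAt_integral_expI_mul (μ := μ) hWm hWb) (by simp [expI_zero]) hv ha0 hb0 hε0
      (fun t ht0 _ => hs.norm_deriv_charFun_add_le hX hG hA hh hD hn hm hmh hmean hvar hN0 hN
        (fun ω => rfl) ht0) (by linarith) (by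
          have : 0 ≤ 2 * κ / v := by positivity
          have : 0 < 1 / N ^ 2 := by positivity
          linarith) (by
          have e : v * c = v * ε + 2 * κ + v * (1 / N ^ 2) := by rw [hc]; field_simp
          have : 0 ≤ v * ε := by positivity
          have : 0 ≤ v * (1 / N ^ 2) := by positivity
          linarith) ht.le htT
    rw [charFun_map_eq_integral_expI hWm, charFun_gaussianReal]
    convert key using 4
    rw [Complex.ofReal_exp]
    congr 1
    push_cast
    rw [show ((v.toNNReal : ℝ) : ℂ) = (v : ℂ) by rw [Real.coe_toNNReal _ hv.le]]
    ring
  have main := smooth (μ.map W) (gaussianReal 0 v.toNNReal) L T _ hT0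
    (fun x y hxy => cdf_gaussianReal_sub_le hvN hxy) (by fun_prop) hcf x
  have hcdf : cdf (μ.map W) x = μ.real {ω | W ω ≤ x} := by
    rw [cdf_eq_real, map_measureReal_apply hWm measurableSet_Iic]; rfl
  rw [hcdf] at main
  refine main.trans ?_
  rw [mul_assoc]
  refine mul_le_mul_of_nonneg_left ?_ hC₀.le
  have hi := hint a b c T ha0 hb0 hT0.le
  have e1 : c * T = 144 * ρ * (α * B * n) + ρ * (20 * D * (D + 1) / v) * (m * h) + ρ * (1 / N) := by
    rw [hc, hT, hε, hκ]; field_simp; ring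
  have e2 : L / T = L / ρ * (1 / N) := by rw [hT]; field_simp
  have e3 : M * (a + b) = M * |v - w / h| + 3 * D * M * (m * h) + 12 * D * M * (1 / N) := by
    rw [ha, hb]; ring
  have q1 : 0 ≤ |v - w / h| := abs_nonneg _
  have q2 : 0 ≤ (m : ℝ) * h := by positivity
  have q3 : 0 ≤ 1 / N := by positivity
  have q4 : 0 ≤ α * B * n := by positivity
  have r1 : M * |v - w / h| ≤ C₁ * |v - w / h| := by
    refine mul_le_mul_of_nonneg_right ?_ q1
    have : 0 ≤ C₁ - M := by rw [hC₁]; ring_nf; positivity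
    linarith
  have r2 : (3 * D * M + ρ * (20 * D * (D + 1) / v)) * (m * h) ≤ C₁ * (m * h) := by
    refine mul_le_mul_of_nonneg_right ?_ q2
    have : 0 ≤ M + (12 * D * M + ρ + L / ρ) + 144 * ρ := by positivity
    rw [hC₁]; linarith
  have r3 : (12 * D * M + ρ + L / ρ) * (1 / N) ≤ C₁ * (1 / N) := by
    refine mul_le_mul_of_nonneg_right ?_ q3
    have : 0 ≤ M + 3 * D * M + ρ * (20 * D * (D + 1) / v) + 144 * ρ := by positivity
    rw [hC₁]; linarith
  have r4 : 144 * ρ * (α * B * n) ≤ C₁ * (α * B * n) := by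
    refine mul_le_mul_of_nonneg_right ?_ q4
    have : 0 ≤ M + 3 * D * M + ρ * (20 * D * (D + 1) / v) + (12 * D * M + ρ + L / ρ) := by
      positivity
    rw [hC₁]; linarith
  rw [e2]
  rw [e1, e3] at hi
  linarith

end BerryEsseen

/-! ### Sparse moments from bounded joint densities. -/

section Moments
variable {Ω : Type*} [MeasurableSpace Ω] {μ : Measure Ω} {X : ℤ → Ω → ℝ}

lemma StrictlyStationary.map_eq (hstat : StrictlyStationary μ X) (hX : ∀ i, Measurable (X i))
    (i j : ℤ) : μ.map (X i) = μ.map (X j) := by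
  have h := congrArg (fun ν => ν.map (fun x : Fin 1 → ℝ => x 0))
    (hstat 1 (fun _ => j) (i - j))
  rw [Measure.map_map (by fun_prop) (by fun_prop), Measure.map_map (by fun_prop) (by fun_prop)] at h
  simpa [Function.comp_def] using h

lemma StrictlyStationary.integral_comp_eq (hstat : StrictlyStationary μ X)
    (hX : ∀ i, Measurable (X i)) {F : ℝ → ℝ} (hF : Measurable F) (i j : ℤ) :
    ∫ ω, F (X i ω) ∂μ = ∫ ω, F (X j ω) ∂μ := by
  rw [← integral_map (hX i).aemeasurable hF.aestronglyMeasurable,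
    ← integral_map (hX j).aemeasurable hF.aestronglyMeasurable, hstat.map_eq hX i j]

/-- Under bounded joint densities, distinct members of the process are as rarely in the support of a
function jointly as independent ones, up to a constant. -/
lemma StrictlyStationary.exists_integral_prod_le (hstat : StrictlyStationary μ X)
    (hX : ∀ i, Measurable (X i)) (hjoint : HasBoundedJointDensities μ X) (d : ℕ) :
    ∃ M : ℝ, ∀ s : Finset ℤ, s.card = d + 1 → ∀ k : ℝ → ℝ, Measurable k → (∀ x, 0 ≤ k x) →
      Integrable k → ∫ ω, ∏ i ∈ s, k (X i ω) ∂μ ≤ M * (∫ x, k x) ^ (d + 1) := by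
  obtain ⟨M, hM⟩ := hjoint d
  refine ⟨M, fun s hs k hk hk0 hki => ?_⟩
  set e : Fin (d + 1) ↪o ℤ := s.orderEmbOfFin hs
  have hprod : ∀ ω, ∏ i ∈ s, k (X i ω) = ∏ l, k (X (e l) ω) := fun ω => by
    conv_lhs => rw [← Finset.map_orderEmbOfFin_univ s hs, Finset.prod_map]
    rfl
  -- The indices are listed increasingly and shifted by the smallest, so that the vector starts at
  -- time `0` as in the density hypothesis; stationarity undoes the shift.
  obtain ⟨g, hg, hgb, hlaw⟩ := hM (fun j => e j.succ - e 0)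
    (fun a b hab => by
      have := e.strictMono (Fin.succ_lt_succ_iff.2 hab)
      simp only; omega)
    (fun j => by have := e.strictMono (Fin.succ_pos j); omega)
  have hcons : (fun ω => (Fin.cons (X 0 ω) (fun j => X (e (Fin.succ j) - e 0) ω) : Fin (d + 1) → ℝ))
      = fun ω l => X (e l - e 0) ω := by
    ext ω l
    refine Fin.cases ?_ (fun j => ?_) l <;> simp
  have hshift := hstat (d + 1) (fun l => e l - e 0) (e 0)
  simp only [sub_add_cancel] at hshift
  rw [hcons, ← hshift] at hlaw
  have hkm : Measurable fun x : Fin (d + 1) → ℝ => ∏ l, k (x l) :=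
    Finset.measurable_prod _ fun l _ => hk.comp (measurable_pi_apply l)
  have hpi : Integrable fun x : Fin (d + 1) → ℝ => ∏ l, k (x l) :=
    Integrable.fintype_prod fun _ => hki
  simp_rw [hprod]
  calc ∫ ω, ∏ l, k (X (e l) ω) ∂μ
      = ∫ x, ∏ l, k (x l) ∂(μ.map fun ω l => X (e l) ω) :=
        (integral_map (by fun_prop) hkm.aestronglyMeasurable).symm
    _ = ∫ x : Fin (d + 1) → ℝ, (ENNReal.ofReal (g x)).toReal • ∏ l, k (x l) := by
        rw [hlaw, integral_withDensity_eq_integral_toReal_smul (by fun_prop)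
          (ae_of_all _ fun x => ENNReal.ofReal_lt_top)]
    _ ≤ ∫ x : Fin (d + 1) → ℝ, M * ∏ l, k (x l) := by
        refine integral_mono_of_nonneg (ae_of_all _ fun x => ?_) (hpi.const_mul M)
          (ae_of_all _ fun x => ?_)
        · exact smul_nonneg ENNReal.toReal_nonneg (Finset.prod_nonneg fun l _ => hk0 _)
        · simp only [ENNReal.toReal_ofReal (hgb x).1, smul_eq_mul]
          exact mul_le_mul_of_nonneg_right (hgb x).2 (Finset.prod_nonneg fun l _ => hk0 _)
    _ = _ := by
        rw [integral_const_mul, integral_fintype_prod_volume_eq_pow k, Fintype.card_fin]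

end Moments

/-- The kernel `K` centred at `x₀` and rescaled by `h`. -/
noncomputable def scaledKernel (K : ℝ → ℝ) (x₀ h x : ℝ) : ℝ := K ((x - x₀) / h)

lemma integral_comp_sub_div (F : ℝ → ℝ) (x₀ : ℝ) {h : ℝ} (hh : 0 < h) :
    ∫ x, F ((x - x₀) / h) = h * ∫ u, F u := by
  rw [integral_sub_right_eq_self (fun x => F (x / h)) x₀, Measure.integral_comp_div, abs_of_pos hh,
    smul_eq_mul]

lemma Integrable.comp_sub_div {F : ℝ → ℝ} (hF : Integrable F) (x₀ : ℝ) {h : ℝ} (hh : 0 < h) :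
    Integrable fun x => F ((x - x₀) / h) :=
  (hF.comp_div hh.ne').comp_sub_right x₀

section KernelMoments
variable {Ω : Type*} [MeasurableSpace Ω] {μ : Measure Ω} [IsProbabilityMeasure μ] {X : ℤ → Ω → ℝ}

/-- The centred kernel transforms of a process with bounded joint densities have sparse moments. -/
lemma StrictlyStationary.exists_sparseMoments (hstat : StrictlyStationary μ X)
    (hX : ∀ i, Measurable (X i)) (hjoint : HasBoundedJointDensities μ X) {K : ℝ → ℝ}
    (hK : IsDensityKernel K) (x₀ : ℝ) : ∃ A B : ℝ, 0 ≤ A ∧ 0 ≤ B ∧ ∀ h : ℝ, 0 < h → SparseMoments μ X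
        (fun x => scaledKernel K x₀ h x - ∫ ω, scaledKernel K x₀ h (X 1 ω) ∂μ) A B h := by
  obtain ⟨M₁, hM₁⟩ := hstat.exists_integral_prod_le hX hjoint 0
  obtain ⟨M₂, hM₂⟩ := hstat.exists_integral_prod_le hX hjoint 1
  obtain ⟨M₃, hM₃⟩ := hstat.exists_integral_prod_le hX hjoint 2
  obtain ⟨B, hB⟩ := hK.bounded
  have hB0 : 0 ≤ B := (hK.nonneg 0).trans (hB 0)
  set M := max 1 (max M₁ (max M₂ M₃)) with hMdef
  have h1M : 1 ≤ M := le_max_left _ _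
  have hM₁M : M₁ ≤ M := (le_max_left _ _).trans (le_max_right _ _)
  have hM₂M : M₂ ≤ M := (le_max_left _ _).trans ((le_max_right _ _).trans (le_max_right _ _))
  have hM₃M : M₃ ≤ M := (le_max_right _ _).trans ((le_max_right _ _).trans (le_max_right _ _))
  -- Expanding the products of `k + p` with `p ≤ M h` gives at most `M + 3M² + 4M³`, which is at
  -- most `8M³` as `M ≥ 1`. The bound `B` survives centring because `k` and `p` both lie in `[0,
  -- B]`.
  refine ⟨8 * M ^ 3, B, by positivity, hB0, fun h hh => ?_⟩
  set k := scaledKernel K x₀ h with hk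
  have hkm : Measurable k := hK.measurable.comp (by fun_prop)
  have hk0 : ∀ x, 0 ≤ k x := fun x => hK.nonneg _
  have hkB : ∀ x, k x ≤ B := fun x => hB _
  have hki : Integrable k := Integrable.comp_sub_div hK.integrable x₀ hh
  have hkint : ∫ x, k x = h := by
    simp only [hk, scaledKernel]
    rw [integral_comp_sub_div K x₀ hh, hK.integral_eq_one, mul_one]
  have E1 : ∀ i : ℤ, ∫ ω, k (X i ω) ∂μ ≤ M * h := fun i => by
    have := hM₁ {i} (by simp) k hkm hk0 hki
    simp only [Finset.prod_singleton, hkint, zero_add, pow_one] at this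
    exact this.trans (by gcongr)
  have E2 : ∀ i j : ℤ, i ≠ j → ∫ ω, k (X i ω) * k (X j ω) ∂μ ≤ M * h ^ 2 := fun i j hij => by
    have := hM₂ {i, j} (by rw [Finset.card_pair hij]) k hkm hk0 hki
    simp only [Finset.prod_pair hij, hkint] at this
    exact this.trans (by gcongr)
  have E3 : ∀ i j l : ℤ, i ≠ j → i ≠ l → j ≠ l →
      ∫ ω, k (X i ω) * k (X j ω) * k (X l ω) ∂μ ≤ M * h ^ 3 := fun i j l hij hil hjl => by
    have := hM₃ {i, j, l} (by rw [Finset.card_eq_three]; exact ⟨i, j, l, hij, hil, hjl, rfl⟩)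
      k hkm hk0 hki
    have e : ∀ ω, ∏ a ∈ {i, j, l}, k (X a ω) = k (X i ω) * k (X j ω) * k (X l ω) := fun ω => by
      rw [Finset.prod_insert (by simp [hij, hil]), Finset.prod_pair hjl, mul_assoc]
    simp only [e, hkint] at this
    exact this.trans (by gcongr)
  set p := ∫ ω, k (X 1 ω) ∂μ with hp
  have hp0 : 0 ≤ p := integral_nonneg fun ω => hk0 _
  have hpM : p ≤ M * h := E1 1
  have I1 : ∀ i : ℤ, Integrable (fun ω => k (X i ω)) μ := fun i =>
    Measurable.integrable_of_norm_le (hkm.comp (hX i)) (v := B) fun ω => by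
      rw [Real.norm_of_nonneg (hk0 _)]; exact hkB _
  have I2 : ∀ i j : ℤ, Integrable (fun ω => k (X i ω) * k (X j ω)) μ := fun i j =>
    Measurable.integrable_of_norm_le ((hkm.comp (hX i)).mul (hkm.comp (hX j))) (v := B * B)
      fun ω => by
        rw [Real.norm_of_nonneg (mul_nonneg (hk0 _) (hk0 _))]
        exact mul_le_mul (hkB _) (hkB _) (hk0 _) hB0
  have I3 : ∀ i j l : ℤ, Integrable (fun ω => k (X i ω) * k (X j ω) * k (X l ω)) μ := fun i j l =>
    Measurable.integrable_of_norm_le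
      (((hkm.comp (hX i)).mul (hkm.comp (hX j))).mul (hkm.comp (hX l))) (v := B * B * B)
      fun ω => by
        rw [Real.norm_of_nonneg (mul_nonneg (mul_nonneg (hk0 _) (hk0 _)) (hk0 _))]
        exact mul_le_mul (mul_le_mul (hkB _) (hkB _) (hk0 _) hB0) (hkB _) (hk0 _) (by positivity)
  have hpB : p ≤ B := by
    have := integral_mono (I1 1) (integrable_const B) fun ω => hkB _
    simpa using this
  have habs : ∀ x, |k x - p| ≤ k x + p := fun x => by
    rw [abs_le]; constructor <;> linarith [hk0 x]
  have hMh : 0 ≤ M * h := by positivity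
  have hM2 : M ^ 2 ≤ M ^ 3 := pow_le_pow_right₀ h1M (by norm_num)
  have hM3 : M ≤ M ^ 3 := le_self_pow₀ h1M (by norm_num)
  refine ⟨?_, ?_, ?_, ?_⟩
  · intro x
    rw [abs_le]; constructor <;> linarith [hk0 x, hkB x]
  · intro i
    calc ∫ ω, |k (X i ω) - p| ∂μ ≤ ∫ ω, (k (X i ω) + p) ∂μ :=
          integral_mono_of_nonneg (ae_of_all _ fun ω => abs_nonneg _)
            ((I1 i).add (integrable_const p)) (ae_of_all _ fun ω => habs _)
      _ = (∫ ω, k (X i ω) ∂μ) + p := by rw [integral_add (I1 i) (integrable_const p)]; simp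
      _ ≤ M * h + M * h := add_le_add (E1 i) hpM
      _ = 2 * M * h := by ring
      _ ≤ 8 * M ^ 3 * h := mul_le_mul_of_nonneg_right (by linarith) (by positivity)
  · intro i j hij
    calc ∫ ω, |k (X i ω) - p| * |k (X j ω) - p| ∂μ
        ≤ ∫ ω, (k (X i ω) * k (X j ω) + p * k (X i ω) + p * k (X j ω) + p ^ 2) ∂μ := by
          refine integral_mono_of_nonneg (ae_of_all _ fun ω => by positivity)
            ((((I2 i j).add ((I1 i).const_mul p)).add ((I1 j).const_mul p)).add
              (integrable_const _)) (ae_of_all _ fun ω => ?_)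
          have := mul_le_mul (habs (X i ω)) (habs (X j ω)) (abs_nonneg _)
            (by linarith [hk0 (X i ω)])
          simp only
          nlinarith
      _ = (∫ ω, k (X i ω) * k (X j ω) ∂μ) + p * (∫ ω, k (X i ω) ∂μ) + p * (∫ ω, k (X j ω) ∂μ)
          + p ^ 2 := by
          have J1 := (I2 i j).add ((I1 i).const_mul p)
          rw [integral_add (by exact J1.add ((I1 j).const_mul p)) (integrable_const _),
            integral_add (by exact J1) (by exact (I1 j).const_mul p),
            integral_add (I2 i j) ((I1 i).const_mul p), integral_const_mul, integral_const_mul]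
          simp
      _ ≤ M * h ^ 2 + M * h * (M * h) + M * h * (M * h) + (M * h) ^ 2 := by
          gcongr
          · exact E2 i j hij
          · exact integral_nonneg fun ω => hk0 _
          · exact E1 i
          · exact integral_nonneg fun ω => hk0 _
          · exact E1 j
      _ = (M + 3 * M ^ 2) * h ^ 2 := by ring
      _ ≤ 8 * M ^ 3 * h ^ 2 := mul_le_mul_of_nonneg_right (by linarith) (by positivity)
  · intro i j l hij hil hjl
    have J2 := (((I2 i j).const_mul p).add ((I2 i l).const_mul p)).add ((I2 j l).const_mul p)
    have J1 := (((I1 i).const_mul (p ^ 2)).add ((I1 j).const_mul (p ^ 2))).add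
      ((I1 l).const_mul (p ^ 2))
    calc ∫ ω, |k (X i ω) - p| * |k (X j ω) - p| * |k (X l ω) - p| ∂μ
        ≤ ∫ ω, (k (X i ω) * k (X j ω) * k (X l ω) + (p * (k (X i ω) * k (X j ω))
            + p * (k (X i ω) * k (X l ω)) + p * (k (X j ω) * k (X l ω)))
            + (p ^ 2 * k (X i ω) + p ^ 2 * k (X j ω) + p ^ 2 * k (X l ω)) + p ^ 3) ∂μ := by
          refine integral_mono_of_nonneg (ae_of_all _ fun ω => by positivity)
            ((((I3 i j l).add J2).add J1).add (integrable_const _)) (ae_of_all _ fun ω => ?_)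
          have h0 := hk0 (X i ω)
          have h1 := hk0 (X j ω)
          have := mul_le_mul (mul_le_mul (habs (X i ω)) (habs (X j ω)) (abs_nonneg _)
            (by linarith)) (habs (X l ω)) (abs_nonneg _)
            (mul_nonneg (by linarith) (by linarith))
          refine this.trans_eq ?_
          ring
      _ = (∫ ω, k (X i ω) * k (X j ω) * k (X l ω) ∂μ) + (p * (∫ ω, k (X i ω) * k (X j ω) ∂μ)
            + p * (∫ ω, k (X i ω) * k (X l ω) ∂μ) + p * (∫ ω, k (X j ω) * k (X l ω) ∂μ))
            + (p ^ 2 * (∫ ω, k (X i ω) ∂μ) + p ^ 2 * (∫ ω, k (X j ω) ∂μ)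
            + p ^ 2 * (∫ ω, k (X l ω) ∂μ)) + p ^ 3 := by
          rw [integral_add (by exact ((I3 i j l).add J2).add J1) (integrable_const _),
            integral_add (by exact (I3 i j l).add J2) (by exact J1),
            integral_add (I3 i j l) (by exact J2),
            integral_add (by exact ((I2 i j).const_mul p).add ((I2 i l).const_mul p))
              ((I2 j l).const_mul p),
            integral_add ((I2 i j).const_mul p) ((I2 i l).const_mul p),
            integral_add (by exact ((I1 i).const_mul (p ^ 2)).add ((I1 j).const_mul (p ^ 2)))
              ((I1 l).const_mul (p ^ 2)),
            integral_add ((I1 i).const_mul (p ^ 2)) ((I1 j).const_mul (p ^ 2)), integral_const_mul, integral_const_mul,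
            integral_const_mul, integral_const_mul, integral_const_mul, integral_const_mul]
          simp
      _ ≤ M * h ^ 3 + (M * h * (M * h ^ 2) + M * h * (M * h ^ 2) + M * h * (M * h ^ 2))
            + ((M * h) ^ 2 * (M * h) + (M * h) ^ 2 * (M * h) + (M * h) ^ 2 * (M * h))
            + (M * h) ^ 3 := by
          have n1 : ∀ i : ℤ, 0 ≤ ∫ ω, k (X i ω) ∂μ := fun i => integral_nonneg fun ω => hk0 _
          have n2 : ∀ i j : ℤ, 0 ≤ ∫ ω, k (X i ω) * k (X j ω) ∂μ := fun i j =>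
            integral_nonneg fun ω => mul_nonneg (hk0 _) (hk0 _)
          have := n1 i; have := n1 j; have := n1 l
          have := n2 i j; have := n2 i l; have := n2 j l
          have := E3 i j l hij hil hjl
          have := E2 i j hij; have := E2 i l hil; have := E2 j l hjl
          have := E1 i; have := E1 j; have := E1 l
          gcongr
      _ = (M + 3 * M ^ 2 + 4 * M ^ 3) * h ^ 3 := by ring
      _ ≤ 8 * M ^ 3 * h ^ 3 := mul_le_mul_of_nonneg_right (by linarith) (by positivity)

end KernelMoments

/-! ### Global Taylor bounds for a bounded function. -/

section Taylor

/-- A bounded function that is smooth at a point has a globally valid second order expansion with a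
cubic remainder there. -/
lemma ContDiffAt.exists_abs_sub_taylor_two_le {f : ℝ → ℝ} {x₀ M : ℝ} (hf : ContDiffAt ℝ 3 f x₀)
    (hM : ∀ x, |f x| ≤ M) : ∃ C : ℝ, 0 ≤ C ∧ ∀ v : ℝ,
      |f (x₀ + v) - f x₀ - iteratedDeriv 1 f x₀ * v - iteratedDeriv 2 f x₀ / 2 * v ^ 2|
        ≤ C * |v| ^ 3 := by
  obtain ⟨u, hu, hfu⟩ := hf.contDiffOn (m := 3) le_rfl (by simp)
  obtain ⟨δ, hδ, hball⟩ := Metric.mem_nhds_iff.1 hu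
  have hx₀ : x₀ ∈ Metric.ball x₀ δ := Metric.mem_ball_self hδ
  have hlo := taylor_isLittleO (n := 3) (convex_ball x₀ δ) hx₀ (hfu.mono hball)
  rw [Metric.isOpen_ball.nhdsWithin_eq hx₀] at hlo
  have hev := hlo.bound one_pos
  obtain ⟨ε, hε, hεb⟩ := Metric.eventually_nhds_iff.1 hev
  have hder : ∀ k, iteratedDerivWithin k f (Metric.ball x₀ δ) x₀ = iteratedDeriv k f x₀ :=
    fun k => iteratedDerivWithin_of_isOpen Metric.isOpen_ball hx₀
  have hM0 : 0 ≤ M := (abs_nonneg _).trans (hM 0)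
  set D₁ := iteratedDeriv 1 f x₀
  set D₂ := iteratedDeriv 2 f x₀
  set D₃ := iteratedDeriv 3 f x₀
  -- The first bracket serves `|v| < ε`, where the Peano remainder is at most `|v|³`. The second
  -- serves `|v| ≥ ε`, where each lower power is absorbed by powers of `|v|/ε ≥ 1`.
  refine ⟨(1 + |D₃|) + (2 * M / ε ^ 3 + |D₁| / ε ^ 2 + |D₂| / ε), by positivity, fun v => ?_⟩
  rcases lt_or_ge |v| ε with hv | hv
  · have h1 := hεb (y := x₀ + v) (by simpa using hv)
    simp only [taylor_within_apply, Finset.sum_range_succ, Finset.sum_range_zero, hder,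
      add_sub_cancel_left, smul_eq_mul, iteratedDeriv_zero, Real.norm_eq_abs, abs_pow] at h1
    norm_num [Nat.factorial] at h1
    have h2 : |f (x₀ + v) - f x₀ - D₁ * v - D₂ / 2 * v ^ 2|
        ≤ |v| ^ 3 + |D₃| * |v| ^ 3 := by
      have h3 : |1 / 6 * v ^ 3 * D₃| ≤ |D₃| * |v| ^ 3 := by
        rw [abs_mul, abs_mul, abs_pow, abs_of_pos (by norm_num : (0 : ℝ) < 1 / 6)]
        nlinarith [mul_nonneg (abs_nonneg D₃) (pow_nonneg (abs_nonneg v) 3)]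
      refine le_trans ?_ (add_le_add h1 h3)
      refine le_trans (le_of_eq ?_) (abs_add_le _ _)
      congr 1
      simp only [D₁, D₂, D₃, iteratedDeriv_one]
      ring
    refine h2.trans ?_
    have : 0 ≤ (2 * M / ε ^ 3 + |D₁| / ε ^ 2 + |D₂| / ε) * |v| ^ 3 := by positivity
    linarith
  · have hv0 : 0 < |v| := hε.trans_le hv
    have a1 : 2 * M ≤ 2 * M / ε ^ 3 * |v| ^ 3 := by
      rw [div_mul_eq_mul_div, le_div_iff₀ (by positivity)]
      gcongr
    have a2 : |D₁| * |v| ≤ |D₁| / ε ^ 2 * |v| ^ 3 := by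
      rw [div_mul_eq_mul_div, le_div_iff₀ (by positivity)]
      calc |D₁| * |v| * ε ^ 2 ≤ |D₁| * |v| * |v| ^ 2 := by gcongr
        _ = _ := by ring
    have a3 : |D₂| / 2 * |v| ^ 2 ≤ |D₂| / ε * |v| ^ 3 := by
      rw [div_mul_eq_mul_div |D₂| ε, le_div_iff₀ (by positivity)]
      calc |D₂| / 2 * |v| ^ 2 * ε ≤ |D₂| / 2 * |v| ^ 2 * |v| := by gcongr
        _ = |D₂| * |v| ^ 3 / 2 := by ring
        _ ≤ _ := half_le_self (by positivity)
    have a4 : |f (x₀ + v) - f x₀ - D₁ * v - D₂ / 2 * v ^ 2|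
        ≤ 2 * M + |D₁| * |v| + |D₂| / 2 * |v| ^ 2 := by
      have b1 := abs_sub (f (x₀ + v)) (f x₀)
      have b2 := abs_sub (f (x₀ + v) - f x₀) (D₁ * v)
      have b3 := abs_sub (f (x₀ + v) - f x₀ - D₁ * v) (D₂ / 2 * v ^ 2)
      rw [abs_mul] at b2
      rw [abs_mul, abs_div, abs_pow, abs_two] at b3
      linarith [hM (x₀ + v), hM x₀]
    have : 0 ≤ (1 + |D₃|) * |v| ^ 3 := by positivity
    linarith

/-- For `|v| ≤ 1` the higher powers in the second order expansion are at most `|v|`; for `|v| ≥ 1`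
boundedness suffices. -/
lemma ContDiffAt.exists_abs_sub_le_mul_abs {f : ℝ → ℝ} {x₀ M : ℝ} (hf : ContDiffAt ℝ 3 f x₀)
    (hM : ∀ x, |f x| ≤ M) : ∃ L : ℝ, 0 ≤ L ∧ ∀ v : ℝ, |f (x₀ + v) - f x₀| ≤ L * |v| := by
  obtain ⟨C, hC, h⟩ := hf.exists_abs_sub_taylor_two_le hM
  have hM0 : 0 ≤ M := (abs_nonneg _).trans (hM 0)
  set D₁ := iteratedDeriv 1 f x₀
  set D₂ := iteratedDeriv 2 f x₀
  refine ⟨C + |D₁| + |D₂| + 2 * M, by positivity, fun v => ?_⟩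
  rcases le_total |v| 1 with hv | hv
  · have h1 : |f (x₀ + v) - f x₀| ≤ C * |v| ^ 3 + |D₁| * |v| + |D₂| * |v| ^ 2 := by
      have e : f (x₀ + v) - f x₀ = (f (x₀ + v) - f x₀ - D₁ * v - D₂ / 2 * v ^ 2)
          + D₁ * v + D₂ / 2 * v ^ 2 := by ring
      rw [e]
      refine (abs_add_le _ _).trans (add_le_add ((abs_add_le _ _).trans
        (add_le_add (h v) (abs_mul _ _).le)) ?_)
      rw [abs_mul, abs_div, abs_two, abs_pow]
      gcongr
      exact half_le_self (abs_nonneg _)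
    have h2 : |v| ^ 2 ≤ |v| := pow_le_of_le_one (abs_nonneg _) hv (by norm_num)
    have h3 : |v| ^ 3 ≤ |v| := pow_le_of_le_one (abs_nonneg _) hv (by norm_num)
    have h4 := mul_le_mul_of_nonneg_left h3 hC
    have h5 := mul_le_mul_of_nonneg_left h2 (abs_nonneg D₂)
    have h6 := mul_nonneg hM0 (abs_nonneg v)
    linarith
  · have b1 := abs_sub (f (x₀ + v)) (f x₀)
    have h1 : 2 * M ≤ 2 * M * |v| := le_mul_of_one_le_right (by positivity) hv
    have h2 : 0 ≤ (C + |D₁| + |D₂|) * |v| := by positivity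
    linarith [hM (x₀ + v), hM x₀]

end Taylor

/-! ### Bias and variance of the kernel estimator. -/

section Kernel
variable {K : ℝ → ℝ}

lemma IsDensityKernel.integrable_abs_mul (hK : IsDensityKernel K) :
    Integrable fun u => |u| * K u := by
  refine (hK.integrable.add hK.second_moment).mono'
    (by have := hK.measurable; fun_prop) (ae_of_all _ fun u => ?_)
  have h0 := hK.nonneg u
  rw [Real.norm_of_nonneg (by positivity)]
  have h1 : |u| ≤ 1 + u ^ 2 := by nlinarith [sq_abs u, sq_nonneg (|u| - 1)]
  calc |u| * K u ≤ (1 + u ^ 2) * K u := by gcongr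
    _ = _ := by simp only [Pi.add_apply]; ring

lemma IsDensityKernel.integrable_id_mul (hK : IsDensityKernel K) :
    Integrable fun u => u * K u :=
  hK.integrable_abs_mul.mono (by have := hK.measurable; fun_prop)
    (ae_of_all _ fun u => by simp)

lemma IsDensityKernel.integral_id_mul (hK : IsDensityKernel K) : ∫ u, u * K u = 0 := by
  have h := integral_neg_eq_self (fun u => u * K u) volume
  simp only [hK.symm, neg_mul, integral_neg] at h
  linarith

/-- A vanishing square integral would force `K = 0` almost everywhere, against unit mass. Hence the
limiting variance is positive. -/
lemma IsDensityKernel.kernelNu2_pos (hK : IsDensityKernel K) : 0 < kernelNu2 K := by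
  refine (integral_nonneg fun u => sq_nonneg _).lt_of_ne fun h => ?_
  have h1 := (integral_eq_zero_iff_of_nonneg (fun u => sq_nonneg (K u)) hK.sq_integrable).1 h.symm
  have h2 : K =ᵐ[volume] 0 := h1.mono fun u hu => by simpa using hu
  have := hK.integral_eq_one
  rw [integral_congr_ae h2] at this
  simp at this

end Kernel

section BiasVariance
variable {Ω : Type*} [MeasurableSpace Ω] {μ : Measure Ω} {Y : Ω → ℝ} {f K : ℝ → ℝ} {x₀ : ℝ}

lemma IsBoundedDensity.exists_abs_le (hf : IsBoundedDensity μ Y f) : ∃ M : ℝ, ∀ x, |f x| ≤ M := by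
  obtain ⟨M, hM⟩ := hf.bounded
  exact ⟨M, fun x => by rw [abs_of_nonneg (hf.nonneg x)]; exact hM x⟩

lemma IsBoundedDensity.integral_comp (hf : IsBoundedDensity μ Y f) (hY : Measurable Y)
    {G : ℝ → ℝ} (hG : Measurable G) : ∫ ω, G (Y ω) ∂μ = ∫ x, f x * G x := by
  rw [← integral_map hY.aemeasurable hG.aestronglyMeasurable, hf.law,
    integral_withDensity_eq_integral_toReal_smul (by have := hf.measurable; fun_prop)
      (ae_of_all _ fun x => ENNReal.ofReal_lt_top)]
  simp only [ENNReal.toReal_ofReal (hf.nonneg _), smul_eq_mul]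

lemma IsBoundedDensity.integral_comp_div (hf : IsBoundedDensity μ Y f) (hY : Measurable Y)
    {G : ℝ → ℝ} (hG : Measurable G) (x₀ : ℝ) {h : ℝ} (hh : 0 < h) :
    ∫ ω, G ((Y ω - x₀) / h) ∂μ = h * ∫ u, f (x₀ + h * u) * G u := by
  rw [hf.integral_comp hY (G := fun x => G ((x - x₀) / h)) (by fun_prop),
    ← integral_comp_sub_div _ x₀ hh]
  congr 1 with x
  rw [mul_div_cancel₀ _ hh.ne', add_sub_cancel]

lemma IsBoundedDensity.integrable_mul (hf : IsBoundedDensity μ Y f) {G : ℝ → ℝ}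
    (hG : Integrable G) (x₀ h : ℝ) : Integrable fun u => f (x₀ + h * u) * G u := by
  obtain ⟨M, hM⟩ := hf.exists_abs_le
  exact hG.bdd_mul (c := M) (hf.measurable.comp (by fun_prop)).aestronglyMeasurable
    (ae_of_all _ fun u => hM _)

/-- Second order expansion of the expectation of the kernel density estimator. -/
lemma IsBoundedDensity.exists_abs_bias_le (hf : IsBoundedDensity μ Y f) (hY : Measurable Y)
    (hK : IsDensityKernel K) (hfs : ContDiffAt ℝ 3 f x₀) : ∃ C : ℝ, 0 ≤ C ∧ ∀ h : ℝ, 0 < h →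
      |(∫ ω, scaledKernel K x₀ h (Y ω) ∂μ) / h - f x₀
        - h ^ 2 * iteratedDeriv 2 f x₀ * kernelMu2 K / 2| ≤ C * h ^ 3 := by
  obtain ⟨M, hM⟩ := hf.exists_abs_le
  obtain ⟨C, hC, hT⟩ := hfs.exists_abs_sub_taylor_two_le hM
  set D₁ := iteratedDeriv 1 f x₀
  set D₂ := iteratedDeriv 2 f x₀
  refine ⟨C * ∫ u, |u| ^ 3 * K u, mul_nonneg hC (integral_nonneg fun u =>
    mul_nonneg (by positivity) (hK.nonneg u)), fun h hh => ?_⟩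
  simp only [scaledKernel]
  rw [hf.integral_comp_div hY hK.measurable x₀ hh, mul_div_cancel_left₀ _ hh.ne']
  -- Unit mass, zero first moment by symmetry, and `μ₂` allow the Taylor polynomial to be subtracted
  -- under the integral.
  have e : (∫ u, f (x₀ + h * u) * K u) - f x₀ - h ^ 2 * D₂ * kernelMu2 K / 2
      = ∫ u, (f (x₀ + h * u) - f x₀ - D₁ * (h * u) - D₂ / 2 * (h * u) ^ 2) * K u := by
    have i0 := hf.integrable_mul hK.integrable x₀ h
    have i1 := hK.integrable.const_mul (f x₀)
    have i2 := hK.integrable_id_mul.const_mul (D₁ * h)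
    have i3 := hK.second_moment.const_mul (D₂ / 2 * h ^ 2)
    calc _ = (∫ u, f (x₀ + h * u) * K u) - (∫ u, f x₀ * K u) - (∫ u, D₁ * h * (u * K u))
          - ∫ u, D₂ / 2 * h ^ 2 * (u ^ 2 * K u) := by
          rw [integral_const_mul, integral_const_mul, integral_const_mul, hK.integral_eq_one,
            hK.integral_id_mul, kernelMu2]
          ring
      _ = _ := by
          rw [← integral_sub i0 i1, ← integral_sub (by exact i0.sub i1) i2,
            ← integral_sub (by exact (i0.sub i1).sub i2) i3]
          congr 1 with u
          ring
  rw [e, ← Real.norm_eq_abs]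
  refine (norm_integral_le_of_norm_le (hK.third_moment.const_mul (C * h ^ 3))
    (ae_of_all _ fun u => ?_)).trans_eq (by rw [integral_const_mul]; ring)
  rw [norm_mul, Real.norm_of_nonneg (hK.nonneg u)]
  calc _ ≤ C * |h * u| ^ 3 * K u := mul_le_mul_of_nonneg_right (hT _) (hK.nonneg u)
    _ = _ := by rw [abs_mul, abs_of_pos hh]; ring

/-- First order expansion of the variance of a summand of the kernel density estimator. -/
lemma IsBoundedDensity.exists_abs_variance_le [IsProbabilityMeasure μ]
    (hf : IsBoundedDensity μ Y f) (hY : Measurable Y)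
    (hK : IsDensityKernel K) (hfs : ContDiffAt ℝ 3 f x₀) : ∃ C : ℝ, 0 ≤ C ∧ ∀ h : ℝ, 0 < h →
      |f x₀ * kernelNu2 K - (∫ ω, (scaledKernel K x₀ h (Y ω)
        - ∫ ω', scaledKernel K x₀ h (Y ω') ∂μ) ^ 2 ∂μ) / h| ≤ C * h := by
  obtain ⟨M, hM⟩ := hf.exists_abs_le
  obtain ⟨L, hL, hT⟩ := hfs.exists_abs_sub_le_mul_abs hM
  obtain ⟨B, hB⟩ := hK.bounded
  have hB0 : 0 ≤ B := (hK.nonneg 0).trans (hB 0)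
  have hI0 : 0 ≤ ∫ u, |u| * K u := integral_nonneg fun u =>
    mul_nonneg (abs_nonneg u) (hK.nonneg u)
  -- `M² h` bounds the squared mean divided by `h`; the other part uses the Lipschitz bound at `x₀`
  -- and `K² ≤ B K`.
  refine ⟨L * B * (∫ u, |u| * K u) + M ^ 2, by positivity, fun h hh => ?_⟩
  set p := ∫ ω, scaledKernel K x₀ h (Y ω) ∂μ with hp
  have hkm : Measurable (scaledKernel K x₀ h) := hK.measurable.comp (by fun_prop)
  have hk0 : ∀ x, 0 ≤ scaledKernel K x₀ h x := fun x => hK.nonneg _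
  have hkB : ∀ x, scaledKernel K x₀ h x ≤ B := fun x => hB _
  have j1 : Integrable (fun ω => scaledKernel K x₀ h (Y ω)) μ :=
    Measurable.integrable_of_norm_le (hkm.comp hY) (v := B) fun ω => by
      rw [Real.norm_of_nonneg (hk0 _)]; exact hkB _
  have j2 : Integrable (fun ω => scaledKernel K x₀ h (Y ω) ^ 2) μ :=
    Measurable.integrable_of_norm_le ((hkm.comp hY).pow_const 2) (v := B ^ 2) fun ω => by
      rw [norm_pow, Real.norm_of_nonneg (hk0 _)]; exact pow_le_pow_left₀ (hk0 _) (hkB _) 2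
  have hw : ∫ ω, (scaledKernel K x₀ h (Y ω) - p) ^ 2 ∂μ
      = h * (∫ u, f (x₀ + h * u) * K u ^ 2) - p ^ 2 := by
    calc ∫ ω, (scaledKernel K x₀ h (Y ω) - p) ^ 2 ∂μ
        = ∫ ω, (scaledKernel K x₀ h (Y ω) ^ 2 - 2 * p * scaledKernel K x₀ h (Y ω) + p ^ 2) ∂μ := by
          congr 1 with ω
          ring
      _ = (∫ ω, scaledKernel K x₀ h (Y ω) ^ 2 ∂μ) - 2 * p * p + p ^ 2 := by
          rw [integral_add (by exact j2.sub (j1.const_mul _)) (integrable_const _),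
            integral_sub j2 (j1.const_mul _), integral_const_mul]
          simp [hp]
      _ = _ := by
          have := hf.integral_comp_div hY (hK.measurable.pow_const 2) x₀ hh
          simp only [scaledKernel]
          rw [this]
          ring
  have hp0 : 0 ≤ p := integral_nonneg fun ω => hk0 _
  have hpM : p ≤ M * h := by
    have e := hf.integral_comp_div hY hK.measurable x₀ hh
    have : ∫ u, f (x₀ + h * u) * K u ≤ ∫ u, M * K u :=
      integral_mono (hf.integrable_mul hK.integrable x₀ h) (hK.integrable.const_mul M) fun u =>
        mul_le_mul_of_nonneg_right ((le_abs_self _).trans (hM _)) (hK.nonneg u)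
    rw [integral_const_mul, hK.integral_eq_one, mul_one] at this
    rw [hp]
    simp only [scaledKernel]
    rw [e, mul_comm]
    gcongr
  have hp2 : p ^ 2 / h ≤ M ^ 2 * h := by
    rw [div_le_iff₀ hh]
    calc p ^ 2 ≤ (M * h) ^ 2 := pow_le_pow_left₀ hp0 hpM 2
      _ = _ := by ring
  have hmain : |∫ u, (f x₀ - f (x₀ + h * u)) * K u ^ 2| ≤ L * B * (∫ u, |u| * K u) * h := by
    rw [← Real.norm_eq_abs]
    refine (norm_integral_le_of_norm_le (hK.integrable_abs_mul.const_mul (L * B * h))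
      (ae_of_all _ fun u => ?_)).trans_eq (by rw [integral_const_mul]; ring)
    rw [norm_mul, norm_pow, Real.norm_of_nonneg (hK.nonneg u), Real.norm_eq_abs, abs_sub_comm]
    have h0 := hK.nonneg u
    calc |f (x₀ + h * u) - f x₀| * K u ^ 2 ≤ L * |h * u| * (B * K u) := by
          gcongr
          · exact hT _
          · rw [sq]; exact mul_le_mul_of_nonneg_right (hB u) h0
      _ = _ := by rw [abs_mul, abs_of_pos hh]; ring
  have e : f x₀ * kernelNu2 K - (h * (∫ u, f (x₀ + h * u) * K u ^ 2) - p ^ 2) / h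
      = (∫ u, (f x₀ - f (x₀ + h * u)) * K u ^ 2) + p ^ 2 / h := by
    simp only [sub_mul]
    rw [integral_sub (hK.sq_integrable.const_mul _) (hf.integrable_mul hK.sq_integrable x₀ h),
      integral_const_mul, kernelNu2]
    field_simp
    ring
  rw [hw, e]
  refine (abs_add_le _ _).trans ?_
  rw [abs_of_nonneg (by positivity : 0 ≤ p ^ 2 / h)]
  linarith

end BiasVariance

/-! ### Choice of the lag and the normal approximation. -/

section Approximation

lemma cdf_gaussianReal_div_sqrt {v : ℝ} (hv : 0 < v) (x : ℝ) :
    cdf (gaussianReal 0 1) (x / √v) = cdf (gaussianReal 0 v.toNNReal) x := by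
  have hs : 0 < √v := Real.sqrt_pos.2 hv
  have h : gaussianReal 0 v.toNNReal = (gaussianReal 0 1).map (√v * ·) := by
    rw [gaussianReal_map_const_mul, mul_zero, mul_one]
    congr 1
    ext
    simp [Real.sq_sqrt hv.le, hv.le]
  rw [cdf_eq_real, cdf_eq_real, h, map_measureReal_apply (by fun_prop) measurableSet_Iic]
  congr 1
  ext z
  simp [le_div_iff₀ hs, mul_comm]

lemma abs_cdf_gaussianReal_sub_le {v : NNReal} (hv : v ≠ 0) (x y : ℝ) :
    |cdf (gaussianReal 0 v) x - cdf (gaussianReal 0 v) y|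
      ≤ (√(2 * Real.pi * v))⁻¹ * |x - y| := by
  wlog h : x ≤ y generalizing x y
  · rw [abs_sub_comm, abs_sub_comm x]
    exact this y x (le_of_not_ge h)
  rw [abs_sub_comm, abs_sub_comm x, abs_of_nonneg (sub_nonneg.2 h),
    abs_of_nonneg (sub_nonneg.2 (monotone_cdf _ h))]
  exact cdf_gaussianReal_sub_le hv h

/-- The distribution function of the normalized kernel density estimator in terms of the centred
summands. -/
lemma kdeCdf_eq {Ω : Type*} [MeasurableSpace Ω] (μ : Measure Ω) (X : ℤ → Ω → ℝ) (K f : ℝ → ℝ)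
    (x₀ : ℝ) {n : ℕ} (hn : 1 ≤ n) {h : ℝ} (hh : 0 < h) (p y : ℝ) :
    kdeCdf μ X K f x₀ n h y = μ.real {ω | (∑ j ∈ Finset.Icc 1 n,
      (scaledKernel K x₀ h (X j ω) - p)) / √((n : ℝ) * h) ≤ y - √((n : ℝ) * h) * (p / h - f x₀)} := by
  have hn0 : (0 : ℝ) < n := by exact_mod_cast hn
  have hN : 0 < √((n : ℝ) * h) := Real.sqrt_pos.2 (by positivity)
  have hN2 : √((n : ℝ) * h) ^ 2 = n * h := Real.sq_sqrt (by positivity)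
  rw [kdeCdf]
  congr 1
  ext ω
  simp only [Set.mem_ofPred_eq, kde, Finset.sum_sub_distrib, Finset.sum_const, Nat.card_Icc,
    nsmul_eq_mul, add_tsub_cancel_right, scaledKernel]
  set S := ∑ j ∈ Finset.Icc 1 n, K ((X (j : ℤ) ω - x₀) / h)
  set N := √((n : ℝ) * h)
  have e : (S - n * p) / N = N * (((n : ℝ) * h)⁻¹ * S - f x₀) - N * (p / h - f x₀) := by
    have h1 : (S - n * p) / N = N * ((S - n * p) / (n * h)) := by
      rw [← hN2]; field_simp
    rw [h1]
    field_simp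
    ring
  rw [e, sub_le_sub_iff_right]

/-- With lags of order `log n`, this makes the smallness conditions on `m h` hold for large `n`. -/
lemma tendsto_mul_log_of_isBigO_rpow {h : ℕ → ℝ}
    (hO : h =O[atTop] (fun n : ℕ => (n : ℝ) ^ (-(1 / 5) : ℝ))) :
    Tendsto (fun n : ℕ => h n * Real.log n) atTop (𝓝 0) := by
  have h1 : (fun n : ℕ => Real.log n) =o[atTop] (fun n : ℕ => (n : ℝ) ^ (1 / 5 : ℝ)) :=
    (isLittleO_log_rpow_atTop (by norm_num : (0 : ℝ) < 1 / 5)).comp_tendsto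
      tendsto_natCast_atTop_atTop
  have h2 := hO.mul_isLittleO h1
  refine (isLittleO_one_iff ℝ).1 (h2.congr' EventuallyEq.rfl ?_)
  filter_upwards [eventually_ge_atTop 1] with n hn
  have hn0 : (0 : ℝ) < n := by exact_mod_cast hn
  rw [← Real.rpow_add hn0]
  norm_num

/-- The lag at which the mixing coefficients are negligible against `n⁻¹`. -/
noncomputable def mixingLag (C : ℝ) (n : ℕ) : ℕ := ⌈2 / C * Real.log n⌉₊

lemma tendsto_mixingLag {C : ℝ} (hC : 0 < C) : Tendsto (mixingLag C) atTop atTop :=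
  tendsto_nat_ceil_atTop.comp ((Real.tendsto_log_atTop.comp
    tendsto_natCast_atTop_atTop).const_mul_atTop (by positivity))

lemma one_le_log_natCast {n : ℕ} (hn : 3 ≤ n) : 1 ≤ Real.log n := by
  have h3 : (3 : ℝ) ≤ n := by exact_mod_cast hn
  rw [Real.le_log_iff_exp_le (by linarith)]
  linarith [Real.exp_one_lt_d9]

lemma mixingLag_le {C : ℝ} (hC : 0 < C) {n : ℕ} (hn : 3 ≤ n) :
    (mixingLag C n : ℝ) ≤ (2 / C + 1) * Real.log n := by
  have hl := one_le_log_natCast hn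
  have := Nat.ceil_lt_add_one (show 0 ≤ 2 / C * Real.log n by positivity)
  rw [mixingLag]
  linarith

/-- The order `n⁻²` is needed because the mixing coefficient enters the Berry–Esseen bound
multiplied by `n`. -/
lemma exp_neg_mul_mixingLag_le {C : ℝ} (hC : 0 < C) {n : ℕ} (hn : 1 ≤ n) :
    Real.exp (-C * mixingLag C n) ≤ ((n : ℝ) ^ 2)⁻¹ := by
  have hn0 : (0 : ℝ) < n := by exact_mod_cast hn
  have h1 := Nat.le_ceil (2 / C * Real.log n)
  have h2 : 2 * Real.log n ≤ C * mixingLag C n := by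
    have := mul_le_mul_of_nonneg_left h1 hC.le
    rw [mixingLag]
    calc 2 * Real.log n = C * (2 / C * Real.log n) := by field_simp
      _ ≤ _ := this
  rw [← Real.exp_log (show (0 : ℝ) < ((n : ℝ) ^ 2)⁻¹ by positivity), Real.exp_le_exp, Real.log_inv,
    Real.log_pow]
  push_cast
  linarith

variable {Ω : Type*} [MeasurableSpace Ω] {μ : Measure Ω} [IsProbabilityMeasure μ] {X : ℤ → Ω → ℝ}
  {f K : ℝ → ℝ} {x₀ C : ℝ} {h : ℕ → ℝ}

/-- The normal approximation to the distribution of the kernel density estimator of a strongly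
mixing process. -/
theorem kdeCdf_sub_normalApprox_isBigO (hX : ∀ i, Measurable (X i))
    (hstat : StrictlyStationary μ X) (hf : IsBoundedDensity μ (X 1) f)
    (hjoint : HasBoundedJointDensities μ X) (hK : IsDensityKernel K) (hfpos : 0 < f x₀)
    (hfs : ContDiffAt ℝ 3 f x₀) (hC : 0 < C)
    (hmix : (fun t : ℕ => alphaMixing μ X t) =O[atTop] (fun t : ℕ => Real.exp (-C * (t : ℝ))))
    (hh : ∀ n, 0 < h n) (hO : h =O[atTop] (fun n : ℕ => (n : ℝ) ^ (-(1 / 5) : ℝ))) (y : ℝ) :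
    (fun n : ℕ => kdeCdf μ X K f x₀ n (h n) y - normalApprox K f x₀ n (h n) y)
      =O[atTop] (fun n : ℕ => errorOrder n (h n)) := by
  obtain ⟨A, B, hA, hB, hs⟩ := hstat.exists_sparseMoments hX hjoint hK x₀
  obtain ⟨Cb, hCb, hbias⟩ := hf.exists_abs_bias_le (hX 1) hK hfs
  obtain ⟨Cv, hCv, hvar⟩ := hf.exists_abs_variance_le (hX 1) hK hfs
  set v := f x₀ * kernelNu2 K with hvdef
  have hv : 0 < v := mul_pos hfpos hK.kernelNu2_pos
  have hvN : v.toNNReal ≠ 0 := by simpa using hv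
  set D := A * (1 + B + B ^ 2) + 1 with hD
  have hD0 : 0 < D := by positivity
  obtain ⟨C₀, hC₀, hmain⟩ := SparseMoments.exists_abs_cdf_sub_le (μ := μ) hX hv hD0
  obtain ⟨Cα, hCα, hα⟩ := hmix.exists_pos
  obtain ⟨Ch, hCh, hhb⟩ := hO.exists_pos
  set Λ := (√(2 * Real.pi * v.toNNReal))⁻¹ with hΛ
  have hΛ0 : 0 ≤ Λ := by positivity
  set E := 2 / C + 1 with hE
  have hE0 : 0 < E := by positivity
  have hlog := tendsto_mul_log_of_isBigO_rpow hO
  set κ := C₀ * (Cv + E + 1 + Cα * B) + Λ * (Cb * √(Ch ^ 5)) with hκ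
  have hs1 : ∀ᶠ n : ℕ in atTop, (2 * E + 1) * (h n * Real.log n) < 1 :=
    (hlog.const_mul (2 * E + 1)).eventually_lt_const (by simp)
  have hs2 : ∀ᶠ n : ℕ in atTop, (Cv + 3 * D * E) * (h n * Real.log n) < v / 8 :=
    (hlog.const_mul (Cv + 3 * D * E)).eventually_lt_const (by simpa using hv)
  refine IsBigO.of_bound κ ?_
  filter_upwards [eventually_ge_atTop 3, hs1, hs2, hhb.bound,
    (tendsto_mixingLag hC).eventually hα.bound,
    (tendsto_mixingLag hC).eventually (eventually_ge_atTop 1)] with n hn hsn1 hsn2 hhn hαn hm1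
  have hn0 : (0 : ℝ) < n := by positivity
  have hn1 : (1 : ℝ) ≤ n := by exact_mod_cast (by omega : 1 ≤ n)
  have hhn0 := hh n
  set b := h n with hb
  set m := mixingLag C n with hm
  have hl1 := one_le_log_natCast hn
  set l := Real.log n with hl
  have hbl : b ≤ b * l := le_mul_of_one_le_right hhn0.le hl1
  have hmb : m * b ≤ E * (b * l) := by
    calc m * b ≤ E * l * b := mul_le_mul_of_nonneg_right (mixingLag_le hC hn) hhn0.le
      _ = _ := by ring
  set N := √((n : ℝ) * b) with hN
  have hN0 : 0 < N := Real.sqrt_pos.2 (by positivity)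
  have hN2 : N ^ 2 = n * b := Real.sq_sqrt (by positivity)
  set p := ∫ ω, scaledKernel K x₀ b (X 1 ω) ∂μ with hp
  set G : ℝ → ℝ := fun x => scaledKernel K x₀ b x - p with hG
  set w := ∫ ω, G (X 1 ω) ^ 2 ∂μ with hw
  have hkm : Measurable (scaledKernel K x₀ b) := hK.measurable.comp (by fun_prop)
  have hGm : Measurable G := hkm.sub_const p
  have hGs : SparseMoments μ X G A B b := hs b hhn0
  have hmean : ∀ i : ℤ, ∫ ω, G (X i ω) ∂μ = 0 := fun i => by
    obtain ⟨Bk, hBk⟩ := hK.bounded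
    rw [hstat.integral_comp_eq hX hGm i 1]
    have hi : Integrable (fun ω => scaledKernel K x₀ b (X 1 ω)) μ :=
      Measurable.integrable_of_norm_le (hkm.comp (hX 1)) (v := Bk) fun ω => by
        rw [Real.norm_of_nonneg (show 0 ≤ scaledKernel K x₀ b (X 1 ω) from hK.nonneg _)]
        exact hBk _
    simp only [hG]
    rw [integral_sub hi (integrable_const p)]
    simp [hp]
  have hvw : |v - w / b| ≤ Cv * b := hvar b hhn0
  have hvwl : |v - w / b| ≤ Cv * (b * l) := hvw.trans (by gcongr)
  have hclt := hmain G A B b w N n m hGs hGm hA hhn0 (by rw [hD]; linarith) (by omega) hm1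
    (by
      refine le_trans ?_ hsn1.le
      calc (2 * (m : ℝ) + 1) * b = 2 * (m * b) + b := by ring
        _ ≤ 2 * (E * (b * l)) + b * l := by gcongr
        _ = _ := by ring)
    hmean (fun i => hstat.integral_comp_eq hX (hGm.pow_const 2) i 1) hN0 hN2
    (by
      refine le_trans ?_ hsn2.le
      calc |v - w / b| + 3 * D * (m * b) ≤ Cv * (b * l) + 3 * D * (E * (b * l)) := by gcongr
        _ = _ := by ring)
    (y - N * (p / b - f x₀))
  have hNinv : ((n : ℝ) * b) ^ (-(1 / 2) : ℝ) = 1 / N := by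
    rw [Real.rpow_neg (by positivity), ← Real.sqrt_eq_rpow, one_div]
  have hb1 : b ≤ 1 := by
    refine hbl.trans (le_trans ?_ hsn1.le)
    exact le_mul_of_one_le_left (by positivity) (by linarith)
  -- The mixing term is of order `1/n`, and `N ≤ n` because `h ≤ 1`.
  have hαB : alphaMixing μ X m * B * n ≤ Cα * B * (1 / N) := by
    have h1 : alphaMixing μ X m ≤ Cα * ((n : ℝ) ^ 2)⁻¹ := by
      refine (le_abs_self _).trans (hαn.trans ?_)
      rw [Real.norm_of_nonneg (Real.exp_pos _).le]
      gcongr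
      exact exp_neg_mul_mixingLag_le hC (by omega)
    have h2 : N ≤ n := by
      rw [hN, Real.sqrt_le_left hn0.le, sq]
      gcongr
      exact hb1.trans hn1
    calc alphaMixing μ X m * B * n ≤ Cα * ((n : ℝ) ^ 2)⁻¹ * B * n := by gcongr
      _ = Cα * B * (1 / n) := by field_simp
      _ ≤ _ := by gcongr
  -- The remainder `N h³` equals `(N h²) h`, and `(N h²)² = n h⁵` is bounded by `Ch⁵`.
  have hshift : |N * (p / b - f x₀)
      - (n : ℝ) ^ (1 / 2 : ℝ) * b ^ (5 / 2 : ℝ) * iteratedDeriv 2 f x₀ * kernelMu2 K / 2|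
        ≤ Cb * √(Ch ^ 5) * b := by
    have e1 : (n : ℝ) ^ (1 / 2 : ℝ) * b ^ (5 / 2 : ℝ) = N * b ^ 2 := by
      rw [hN, Real.sqrt_mul hn0.le, Real.sqrt_eq_rpow, Real.sqrt_eq_rpow, mul_assoc,
        ← Real.rpow_natCast b 2, ← Real.rpow_add hhn0]
      norm_num
    have e2 : N * b ^ 2 ≤ √(Ch ^ 5) := by
      refine Real.le_sqrt_of_sq_le ?_
      rw [Real.norm_of_nonneg hhn0.le, Real.norm_of_nonneg (by positivity)] at hhn
      calc (N * b ^ 2) ^ 2 = n * b ^ 5 := by rw [mul_pow, hN2]; ring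
        _ ≤ n * (Ch * (n : ℝ) ^ (-(1 / 5) : ℝ)) ^ 5 := by gcongr
        _ = Ch ^ 5 := by
          rw [mul_pow, ← Real.rpow_natCast ((n : ℝ) ^ (-(1 / 5) : ℝ)) 5, ← Real.rpow_mul hn0.le]
          norm_num
          rw [Real.rpow_neg_one]
          field_simp
    rw [e1]
    calc |N * (p / b - f x₀) - N * b ^ 2 * iteratedDeriv 2 f x₀ * kernelMu2 K / 2|
        = N * |p / b - f x₀ - b ^ 2 * iteratedDeriv 2 f x₀ * kernelMu2 K / 2| := by
          rw [← abs_of_pos hN0, ← abs_mul, abs_of_pos hN0]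
          congr 1
          ring
      _ ≤ N * (Cb * b ^ 3) := by gcongr; exact hbias b hhn0
      _ = Cb * (N * b ^ 2) * b := by ring
      _ ≤ _ := by gcongr
  have hna : normalApprox K f x₀ n b y = cdf (gaussianReal 0 v.toNNReal)
      (y - (n : ℝ) ^ (1 / 2 : ℝ) * b ^ (5 / 2 : ℝ) * iteratedDeriv 2 f x₀ * kernelMu2 K / 2) := by
    rw [normalApprox, ← hvdef, cdf_gaussianReal_div_sqrt hv]
  have hgauss : |cdf (gaussianReal 0 v.toNNReal) (y - N * (p / b - f x₀))
      - normalApprox K f x₀ n b y| ≤ Λ * (Cb * √(Ch ^ 5)) * (b * l) := by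
    rw [hna]
    refine (abs_cdf_gaussianReal_sub_le hvN _ _).trans ?_
    rw [sub_sub_sub_cancel_left, abs_sub_comm, mul_assoc Λ]
    refine mul_le_mul_of_nonneg_left (hshift.trans ?_) hΛ0
    gcongr
  have herr : errorOrder n b = b * l + 1 / N := by rw [errorOrder, hNinv]
  have hN0' : 0 < 1 / N := by positivity
  have hbl0 : 0 < b * l := by positivity
  rw [Real.norm_eq_abs, herr, Real.norm_of_nonneg (by positivity),
    kdeCdf_eq μ X K f x₀ (by omega) hhn0 p y]
  refine (abs_sub_le _ (cdf (gaussianReal 0 v.toNNReal) (y - N * (p / b - f x₀))) _).trans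
    ((add_le_add hclt hgauss).trans ?_)
  calc C₀ * (|v - w / b| + m * b + 1 / N + alphaMixing μ X m * B * n)
        + Λ * (Cb * √(Ch ^ 5)) * (b * l)
      ≤ C₀ * (Cv * (b * l) + E * (b * l) + 1 / N + Cα * B * (1 / N))
        + Λ * (Cb * √(Ch ^ 5)) * (b * l) := by gcongr
    _ ≤ C₀ * ((Cv + E + 1 + Cα * B) * (b * l + 1 / N))
        + Λ * (Cb * √(Ch ^ 5)) * (b * l + 1 / N) := by
        have t1 : Cv * (b * l) ≤ Cv * (b * l + 1 / N) := by gcongr; linarith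
        have t2 : E * (b * l) ≤ E * (b * l + 1 / N) := by gcongr; linarith
        have t3 : Cα * B * (1 / N) ≤ Cα * B * (b * l + 1 / N) := by gcongr; linarith
        gcongr
        · linarith
        · linarith
    _ = κ * (b * l + 1 / N) := by rw [hκ]; ring

end Approximation

theorem theorem2 {Ω : Type*} [MeasurableSpace Ω] (μ : Measure Ω) [IsProbabilityMeasure μ]
    (X : ℤ → Ω → ℝ) (hX : ∀ i, Measurable (X i)) (hstat : StrictlyStationary μ X)
    (f : ℝ → ℝ) (hf : IsBoundedDensity μ (X 1) f) (hjoint : HasBoundedJointDensities μ X)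
    (K : ℝ → ℝ) (hK : IsDensityKernel K)
    (x₀ : ℝ) (hfpos : 0 < f x₀) (hfsmooth : ContDiffAt ℝ 4 f x₀)
    (C : ℝ) (hC : 0 < C)
    (hmix : (fun t : ℕ => alphaMixing μ X t) =O[atTop] (fun t : ℕ => Real.exp (-C * (t : ℝ)))) :
    -- the normal approximation with its error order
    (∀ h : ℕ → ℝ, (∀ n, 0 < h n) →
      Tendsto (fun n : ℕ => (n : ℝ) * h n) atTop atTop →
      h =O[atTop] (fun n : ℕ => (n : ℝ) ^ (-(1 / 5) : ℝ)) →
      ∀ y : ℝ,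
        (fun n : ℕ => kdeCdf μ X K f x₀ n (h n) y - normalApprox K f x₀ n (h n) y)
          =O[atTop] (fun n : ℕ => errorOrder n (h n))) ∧
    -- bandwidths of order `n^{-1/3} (log n)^{-2/3}` give the error `n^{-1/3} (log n)^{1/3}`
    (∀ h : ℕ → ℝ, (∀ n, 0 < h n) →
      h =Θ[atTop] (fun n : ℕ => (n : ℝ) ^ (-(1 / 3) : ℝ) * Real.log n ^ (-(2 / 3) : ℝ)) →
      ∀ y : ℝ,
        (fun n : ℕ => kdeCdf μ X K f x₀ n (h n) y - normalApprox K f x₀ n (h n) y)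
          =O[atTop] (fun n : ℕ => (n : ℝ) ^ (-(1 / 3) : ℝ) * Real.log n ^ (1 / 3 : ℝ))) ∧
    -- no bandwidth sequence makes the error order smaller than `n^{-1/3} (log n)^{1/3}`
    (∀ h : ℕ → ℝ, (∀ n, 0 < h n) →
      (fun n : ℕ => (n : ℝ) ^ (-(1 / 3) : ℝ) * Real.log n ^ (1 / 3 : ℝ))
        =O[atTop] (fun n : ℕ => errorOrder n (h n))) ∧
    -- the minimum order is attained exactly at bandwidths of order `n^{-1/3} (log n)^{-2/3}`
    (∀ h : ℕ → ℝ, (∀ n, 0 < h n) →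
      ((fun n : ℕ => errorOrder n (h n))
          =Θ[atTop] (fun n : ℕ => (n : ℝ) ^ (-(1 / 3) : ℝ) * Real.log n ^ (1 / 3 : ℝ)) ↔
        h =Θ[atTop] (fun n : ℕ => (n : ℝ) ^ (-(1 / 3) : ℝ) * Real.log n ^ (-(2 / 3) : ℝ)))) := by
  refine ⟨fun h hh _ hO y => ?_, fun h hh hT y => ?_, optimalError_isBigO_errorOrder,
    errorOrder_isTheta_iff⟩
  · exact kdeCdf_sub_normalApprox_isBigO hX hstat hf hjoint hK hfpos (hfsmooth.of_le (by norm_num))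
      hC hmix hh hO y
  · exact (kdeCdf_sub_normalApprox_isBigO hX hstat hf hjoint hK hfpos
      (hfsmooth.of_le (by norm_num)) hC hmix hh
      (isBigO_rpow_of_isTheta_optimalBandwidth h hT) y).trans
      ((errorOrder_isTheta_iff h hh).2 hT).1
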